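/- Let $\ell\ge 3$ and let $F(\mathbf x)=\mathbf x^tQ\mathbf x+\mathbf b^t\mathbf x+c$ with $Q\in M_\ell(\mathbb Z)$, $\mathbf b\in\mathbb Z^\ell$, $c\in\mathbb Z$. Put $Q_S=Q^t+Q$, $\Delta_F=\det Q_S$, $\mathcal R_F=2c\Delta_F-\mathbf b^t\,\mathrm{adj}(Q_S)\,\mathbf b$; let $\mathcal H_F=(-1)^{\ell/2}\Delta_F$ if $\ell$ is even and $\mathcal H_F=0$ if $\ell$ is odd; let $\mathcal O_F=(-1)^{(\ell+1)/2}\mathcal R_F$ if $\ell$ is odd and $\mathcal O_F=0$ if $\ell$ is even. Assume $\Delta_F\ne 0$. For $n,q\ge 1$ let $$\varrho_F(n)=\#\{\mathbf x\in(\mathbb Z/n\mathbb Z)^\ell: F(\mathbf x)\equiv 0 \bmod n\},\qquad S_F(q)=\frac1q\sum_{\substack{a\bmod q\\(a,q)=1}}\ \sum_{\mathbf h\in(\mathbb Z/q\mathbb Z)^\ell}e^{2\pi i aF(\mathbf h)/q}.$$ Let $p$ denote primes, let $\left(\frac{\cdot}{p}\right)$ be the Legendre symbol, and define $$L(s,F)=\begin{cases}\displaystyle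 f(s,F)\,\frac{\zeta(2s-\ell)}{\zeta(2s+1-\ell)}\prod_{p>2}\left(1+\left(\frac{\mathcal H_F}{p}\right)\frac{(1-p^{-1})p^{\frac{\ell}{2}-s}}{1-p^{\ell-2s-1}}\right)&\text{if }\mathcal R_F=0,\\[2ex]\displaystyle h(s,F)\prod_{p\nmid 2\Delta_F\mathcal R_F}\left(1+\frac{\left(\frac{\mathcal O_F}{p}\right)}{p^{s-(\ell-1)/2}}\right)\left(1-\frac{\left(\frac{\mathcal H_F}{p}\right)}{p^{s-(\ell-2)/2}}\right)&\text{if }\mathcal R_F\ne 0,\end{cases}$$ where $$f(s,F)=\prod_{p\mid 2\Delta_F}\frac{(1-p^{\ell-2s})(1-p^{\ell-s-1})}{1-p^{\ell-2s-1}}\sum_{m\ge 0}\frac{\varrho_F(p^m)}{p^{ms}},\qquad h(s,F)=\prod_{p\mid 2\Delta_F\mathcal R_F}(1-p^{\ell-s-1})\sum_{m\ge 0}\frac{\varrho_F(p^m)}{p^{ms}}.$$ (1) For every complex $s$ with $\mathrm{Re}\,s>\ell-1$, the series $\sum_{q\ge1}S_F(q)q^{-s}$, the series $\sum_{m\ge0}\varrho_F(p^m)p^{-ms}$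 for every prime $p$, and the infinite product in the definition of $L(s,F)$ converge unconditionally (independently of the order of terms or factors), and $L(s,F)=\sum_{q\ge1}S_F(q)q^{-s}$. Moreover $L(\cdot,F)$ is complex differentiable at $s=\ell$ and $L(\ell,F)\ne0$. (2) For every $\varepsilon>0$ there is a constant $C=C(F,\varepsilon)$ such that, for every real $X\ge 3$ for which $F(\mathbf x)>0$ on $[1,X]^\ell\subset\mathbb R^\ell$, the integral $$I_{FL}=\int_{[0,1]^\ell}\log\left|F(\mathbf t,X)\right|\,d\mathbf t,\qquad F(\mathbf t,X)=\mathbf t^tQ\mathbf t+\frac{\mathbf b^t}{X}\mathbf t+\frac{c}{X^2},$$ converges absolutely, and $$\left|\ \sum_{\mathbf x\in[1,X]^\ell\cap\mathbb Z^\ell}\tau(F(\mathbf x))-2L(\ell,F)X^\ell\log X-\left(\gamma+\tfrac12I_{FL}+\frac{L'(\ell,F)}{L(\ell,F)}\right)2L(\ell,F)X^\ell\right|\le C\,X^{\ell-\frac{\ell-2}{\ell+2}+\varepsilon},$$ where $\tau(n)$ is the number of positive divisors of $n$, $\gamma$ is Euler's constant and $L'$ is the derivative in $s$. -/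

import Mathlib

open MeasureTheory

/-- The data of an integer quadratic polynomial `F(x) = xᵗ Q x + bᵗ x + c` in `l` variables. -/
structure IntQuadPoly (l : ℕ) where
  Q : Matrix (Fin l) (Fin l) ℤ
  b : Fin l → ℤ
  c : ℤ

noncomputable section

namespace IntQuadPoly

variable {l : ℕ} (F : IntQuadPoly l)

/-- The value `F(x) = xᵗ Q x + bᵗ x + c` at a point of `R^l`, for a commutative ring `R`. -/
def eval {R : Type*} [CommRing R] (x : Fin l → R) : R :=
  ∑ i, ∑ j, x i * (F.Q i j : R) * x j + ∑ i, (F.b i : R) * x i + (F.c : R)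

/-- The symmetric matrix `Q_S = Qᵗ + Q`. -/
def QS : Matrix (Fin l) (Fin l) ℤ := F.Q.transpose + F.Q

/-- The first discriminant `Δ_F = det (Qᵗ + Q)`. -/
def discr : ℤ := F.QS.det

/-- The second discriminant `H_F`. -/
def discr₂ : ℤ := if Even l then (-1) ^ (l / 2) * F.discr else 0

/-- The first `Q`-root `R_F = 2 c Δ_F - bᵗ adj(Q_S) b`. -/
def root : ℤ := 2 * F.c * F.discr - dotProduct F.b (F.QS.adjugate.mulVec F.b)

/-- The second `Q`-root `O_F`. -/
def root₂ : ℤ := if Even l then 0 else (-1) ^ ((l + 1) / 2) * F.root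

/-- `ϱ_F(n)`, the number of `x` in `(ℤ/nℤ)^l` with `F(x) = 0` in `ℤ/nℤ` (used for `n ≥ 1`). -/
def rho (n : ℕ) : ℕ := Nat.card {x : Fin l → ZMod n // F.eval x = 0}

/-- `S_F(q) = q⁻¹ ∑_{a mod q, (a,q)=1} ∑_{h mod q} e(a F(h) / q)`, `e(z) = exp(2πiz)`. -/
def gaussSum (q : ℕ) : ℂ :=
  (q : ℂ)⁻¹ * ∑ a ∈ (Finset.range q).filter (fun a => Nat.Coprime a q),
    ∑ h : Fin l → Fin q,
      Complex.exp (2 * Real.pi * Complex.I *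
        (((a : ℤ) * F.eval (fun i => ((h i : ℕ) : ℤ)) : ℤ) : ℂ) / (q : ℂ))

/-- The local series `∑_{m ≥ 0} ϱ_F(p^m) p^{-ms}`. -/
def localSeries (p : ℕ) (s : ℂ) : ℂ := ∑' m : ℕ, (F.rho (p ^ m) : ℂ) / (p : ℂ) ^ ((m : ℂ) * s)

/-- The finite product `f(s, F)` over the primes dividing `2 Δ_F`. -/
def fFactor (s : ℂ) : ℂ :=
  ∏ p ∈ (2 * F.discr).natAbs.primeFactors,
    ((1 - (p : ℂ) ^ ((l : ℂ) - 2 * s)) * (1 - (p : ℂ) ^ ((l : ℂ) - s - 1)) /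
      (1 - (p : ℂ) ^ ((l : ℂ) - 2 * s - 1))) * F.localSeries p s

/-- The finite product `h(s, F)` over the primes dividing `2 Δ_F R_F`. -/
def hFactor (s : ℂ) : ℂ :=
  ∏ p ∈ (2 * F.discr * F.root).natAbs.primeFactors,
    (1 - (p : ℂ) ^ ((l : ℂ) - s - 1)) * F.localSeries p s

/-- The factor at an odd prime `p` of the infinite product in the case `R_F = 0`. -/
def eulerFactor₀ (s : ℂ) (p : Nat.Primes) : ℂ :=
  haveI : Fact (p : ℕ).Prime := ⟨p.2⟩
  1 + (legendreSym p F.discr₂ : ℂ) *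
    ((1 - (p : ℂ)⁻¹) * (p : ℂ) ^ ((l : ℂ) / 2 - s) / (1 - (p : ℂ) ^ ((l : ℂ) - 2 * s - 1)))

/-- The factor at a prime `p ∤ 2 Δ_F R_F` of the infinite product in the case `R_F ≠ 0`. -/
def eulerFactor₁ (s : ℂ) (p : Nat.Primes) : ℂ :=
  haveI : Fact (p : ℕ).Prime := ⟨p.2⟩
  (1 + (legendreSym p F.root₂ : ℂ) / (p : ℂ) ^ (s - ((l : ℂ) - 1) / 2)) *
    (1 - (legendreSym p F.discr₂ : ℂ) / (p : ℂ) ^ (s - ((l : ℂ) - 2) / 2))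

/-- The odd primes. -/
abbrev OddPrimes : Type := {p : Nat.Primes // 2 < (p : ℕ)}

/-- The primes not dividing `2 Δ_F R_F`. -/
abbrev GoodPrimes : Type := {p : Nat.Primes // ¬ ((p : ℕ) : ℤ) ∣ 2 * F.discr * F.root}

/-- The function `L(s, F)`, given by its explicit Euler product. -/
def L (s : ℂ) : ℂ :=
  if F.root = 0 then
    F.fFactor s * (riemannZeta (2 * s - l) / riemannZeta (2 * s + 1 - l)) *
      ∏' p : OddPrimes, F.eulerFactor₀ s p
  else
    F.hFactor s * ∏' p : F.GoodPrimes, F.eulerFactor₁ s p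

/-- The rescaled polynomial `F(t, X) = tᵗ Q t + (bᵗ / X) t + c / X²`. -/
def scaled (X : ℝ) (t : Fin l → ℝ) : ℝ :=
  ∑ i, ∑ j, t i * (F.Q i j : ℝ) * t j + ∑ i, (F.b i : ℝ) / X * t i + (F.c : ℝ) / X ^ 2

/-- `I_FL`, the integral over `[0,1]^l` of `log |F(t, X)|`; `Real.log x` is `log |x|` for
`x ≠ 0`, and the absolute value matters only where some coordinate of `t` is below `1 / X`. -/
def logIntegral (X : ℝ) : ℝ :=
  ∫ t in Set.Icc (0 : Fin l → ℝ) 1, Real.log (F.scaled X t)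

/-- The sum of `τ(F(x))` over the integer points `x` of `[1,X]^l`; here `τ(n)` is the number of
positive divisors of `n`, and `F` is positive on `[1,X]^l` wherever this is used. -/
def divisorSum (X : ℝ) : ℕ :=
  ∑ x ∈ Fintype.piFinset (fun _ : Fin l => Finset.Icc (1 : ℤ) ⌊X⌋),
    (Nat.divisors (F.eval x).toNat).card

end IntQuadPoly

end

/-! ### Ramanujan sums and divisor counts. -/

section RamanujanSum

open Finset ArithmeticFunction

/-! The number of divisors of n up to M equals the sum over q ≤ M of c_q(n)/q · H(⌊M/q⌋), with
Ramanujan sums c_q and harmonic numbers H (`card_dvd_eq_sum_ramanujanSum`). By the hyperbola method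
τ(n) counts the divisors up to N = ⌊X⌋ together with the cofactors up to about n/N. At a modulus q
the two harmonic weights add up to nearly log n + 2γ − 2 log q, while c_q(F(x))/q has mean
S_F(q)/q^l over residues (`gaussSum_eq`). Summed over q this gives L(l,F) and, from −2 log q,
L'(l,F). The sum of log F(x) over the box is X^l (2 log X + I_FL) up to a small error.

The moduli are split at k. For q ≤ k the periodicity of c_q(F(x)) is used directly, at a cost of
about k X^(l−1). For q > k there is cancellation over cells of side k: in the mean square over t mod
q of the sum of e(aF(t+u)/q) over u, the quadratic part in t cancels, and only pairs u, v with equal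
gradient survive, at most |Δ_F|^l for each u (`sum_norm_sq_expSum_le`). This costs about X^(l+1)
k^(−l/2), and the two costs balance at k = X^(4/(l+2)). The harmonic weight has to be constant on a
cell, so the cofactor cutoff is frozen there and τ is enclosed between two frozen counts
(`BoxControl.card_divisors_bounds`). Freezing is inaccurate where F is small. Such points are rare,
because |F|^(−s) is integrable for s < 1 (`exists_lintegral_enorm_eval_rpow_le`); the same fact
makes log |F| integrable.

For L(s,F), the mean square with a full cell gives |S_F(q)| ≪ q^(l/2), and S_F is multiplicative. At
good primes S_F(p) follows by diagonalising F and evaluating quadratic Gauss sums. At higher powers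
only points critical modulo p contribute: S_F(p^m) = 0 for m ≥ 2 if p ∤ R_F, and S_F(p^(m+2)) = p^l
S_F(p^m) for m ≥ 1 if R_F = 0. These values give the Euler factors and the convergence for Re s > l
− 1. At s = l every local factor is positive, so L(l,F) ≠ 0. -/

/-- The Ramanujan sum `c_q(n)`, in its divisor-sum form. -/
def ramanujanSum (q : ℕ) (n : ℤ) : ℤ :=
  ∑ x ∈ q.divisorsAntidiagonal, moebius x.1 * (if (x.2 : ℤ) ∣ n then (x.2 : ℤ) else 0)

/-- Möbius inversion of the divisor-sum form. The identity determines c_q, and it is what expands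
the condition d ∣ n over the divisors of d. -/
theorem sum_divisors_ramanujanSum (n : ℤ) {d : ℕ} (hd : 0 < d) :
    ∑ q ∈ d.divisors, ramanujanSum q n = if (d : ℤ) ∣ n then (d : ℤ) else 0 := by
  have := (ArithmeticFunction.sum_eq_iff_sum_mul_moebius_eq (R := ℤ)
    (f := fun q => ramanujanSum q n) (g := fun d => if (d : ℤ) ∣ n then (d : ℤ) else 0)).2
    (fun m _ => by simp [ramanujanSum])
  exact this d hd

theorem ramanujanSum_congr {q : ℕ} {m n : ℤ} (h : (q : ℤ) ∣ m - n) :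
    ramanujanSum q m = ramanujanSum q n := by
  refine Finset.sum_congr rfl fun x hx => ?_
  have hx2 : ((x.2 : ℕ) : ℤ) ∣ (q : ℤ) := by
    have := (Nat.mem_divisorsAntidiagonal.1 hx).1
    exact Int.natCast_dvd_natCast.2 ⟨x.1, by rw [← this, mul_comm]⟩
  rw [if_congr ((Int.dvd_iff_dvd_of_dvd_sub (hx2.trans h))) rfl rfl]

theorem ramanujanSum_one (n : ℤ) : ramanujanSum 1 n = 1 := by
  simp [ramanujanSum]

theorem abs_ramanujanSum_le (q : ℕ) (n : ℤ) :
    |ramanujanSum q n| ≤ ∑ g ∈ q.divisors, if (g : ℤ) ∣ n then (g : ℤ) else 0 := by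
  rw [← Nat.sum_divisorsAntidiagonal' (f := fun _ g => if (g : ℤ) ∣ n then (g : ℤ) else 0)]
  refine (abs_sum_le_sum_abs _ _).trans (Finset.sum_le_sum fun x _ => ?_)
  rw [abs_mul]
  have h1 : |moebius x.1| ≤ 1 := abs_moebius_le_one
  have h2 : |if (x.2 : ℤ) ∣ n then (x.2 : ℤ) else 0| = if (x.2 : ℤ) ∣ n then (x.2 : ℤ) else 0 :=
    abs_of_nonneg (by split_ifs <;> positivity)
  rw [h2]
  calc _ ≤ 1 * _ := mul_le_mul_of_nonneg_right h1 (by split_ifs <;> positivity)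
    _ = _ := one_mul _

/-- The Ramanujan sum as an exponential sum over reduced residues. -/
theorem ramanujanSum_eq_sum_exp {q : ℕ} (hq : 0 < q) (n : ℤ) :
    (ramanujanSum q n : ℂ) = ∑ a ∈ (range q).filter (fun a => Nat.Coprime a q),
      Complex.exp (2 * Real.pi * Complex.I * (((a : ℤ) * n : ℤ) : ℂ) / (q : ℂ)) := by
  set E : ℕ → ℂ := fun q => ∑ a ∈ (range q).filter (fun a => Nat.Coprime a q),
      Complex.exp (2 * Real.pi * Complex.I * (((a : ℤ) * n : ℤ) : ℂ) / (q : ℂ)) with hE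
  -- The exponential sum satisfies the divisor identity that determines c_q, so Möbius inversion
  -- identifies the two. Its divisor sum runs over all fractions b/d, sorted by their reduced
  -- denominator q = d / gcd(b, d).
  have key : ∀ d : ℕ, d > 0 → ∑ q ∈ d.divisors, E q = if (d : ℤ) ∣ n then (d : ℂ) else 0 := by
    intro d hd
    have : NeZero d := ⟨hd.ne'⟩
    have h1 : ∑ b ∈ range d,
        Complex.exp (2 * Real.pi * Complex.I * (((b : ℤ) * n : ℤ) : ℂ) / (d : ℂ)) =
        if (d : ℤ) ∣ n then (d : ℂ) else 0 := by
      have := AddChar.sum_mulShift (R := ZMod d) (n : ZMod d) (ZMod.isPrimitive_stdAddChar d)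
      rw [ZMod.card] at this
      simp only [ZMod.intCast_zmod_eq_zero_iff_dvd, Nat.cast_ite, Nat.cast_zero] at this
      rw [← this]
      refine Finset.sum_bij (fun b _ => (b : ZMod d)) (by simp) ?_ ?_ ?_
      · intro a ha b hb hab
        rw [mem_range] at ha hb
        have := (ZMod.natCast_eq_natCast_iff' a b d).1 hab
        rwa [Nat.mod_eq_of_lt ha, Nat.mod_eq_of_lt hb] at this
      · intro b _
        exact ⟨b.val, by simpa using ZMod.val_lt b, by simp⟩
      · intro b _
        have := ZMod.stdAddChar_coe (N := d) ((b : ℤ) * n)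
        rw [← this]; push_cast; rfl
    rw [← h1]
    rw [← Finset.sum_fiberwise_of_maps_to (s := range d) (t := d.divisors)
      (g := fun b => d / Nat.gcd b d)]
    · refine Finset.sum_congr rfl fun q hq => ?_
      obtain ⟨e, he⟩ := Nat.dvd_of_mem_divisors hq
      have hq0 : 0 < q := Nat.pos_of_mem_divisors hq
      have he0 : 0 < e := Nat.pos_of_ne_zero (by rintro rfl; simp at he; omega)
      refine Finset.sum_bij (fun a _ => a * e) ?_ ?_ ?_ ?_
      · intro a ha
        simp only [mem_filter, mem_range] at ha ⊢
        refine ⟨by rw [he]; exact Nat.mul_lt_mul_of_pos_right ha.1 he0, ?_⟩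
        rw [he, Nat.gcd_mul_right, ha.2, one_mul, Nat.mul_div_cancel _ he0]
      · intro a _ b _ hab
        exact Nat.eq_of_mul_eq_mul_right he0 hab
      · intro b hb
        simp only [mem_filter, mem_range] at hb
        have hg : Nat.gcd b d = e := by
          have h2 : d / Nat.gcd b d * Nat.gcd b d = d := Nat.div_mul_cancel (Nat.gcd_dvd_right b d)
          rw [hb.2] at h2
          exact Nat.eq_of_mul_eq_mul_left hq0 (h2.trans he)
        obtain ⟨a, ha⟩ : e ∣ b := hg ▸ Nat.gcd_dvd_left b d
        rw [mul_comm] at ha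
        refine ⟨a, ?_, ha.symm⟩
        simp only [mem_filter, mem_range]
        refine ⟨?_, ?_⟩
        · have := hb.1
          rw [ha, he] at this
          exact Nat.lt_of_mul_lt_mul_right this
        · rw [ha, he, Nat.gcd_mul_right] at hg
          exact Nat.eq_of_mul_eq_mul_right he0 (by rw [hg, one_mul])
      · intro a _
        congr 1
        have : (e : ℂ) ≠ 0 := by exact_mod_cast he0.ne'
        have : (q : ℂ) ≠ 0 := by exact_mod_cast hq0.ne'
        rw [he]; push_cast
        field_simp
    · intro b _
      exact Nat.mem_divisors.2 ⟨Nat.div_dvd_of_dvd (Nat.gcd_dvd_right b d), hd.ne'⟩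
  have h3 := ArithmeticFunction.sum_eq_iff_sum_mul_moebius_eq.1 key q hq
  refine Eq.trans ?_ h3
  simp [ramanujanSum]

/-- The divisors of p^(m+1) are those of p^m and p^(m+1) itself, so subtracting two instances of the
divisor identity isolates one Ramanujan sum. -/
theorem ramanujanSum_prime_pow {p : ℕ} (hp : p.Prime) (m : ℕ) (n : ℤ) :
    ramanujanSum (p ^ (m + 1)) n = (if ((p ^ (m + 1) : ℕ) : ℤ) ∣ n then ((p ^ (m + 1) : ℕ) : ℤ) else 0)
      - if ((p ^ m : ℕ) : ℤ) ∣ n then ((p ^ m : ℕ) : ℤ) else 0 := by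
  rw [← sum_divisors_ramanujanSum n (pow_pos hp.pos (m + 1)),
    ← sum_divisors_ramanujanSum n (pow_pos hp.pos m), Nat.divisors_prime_pow hp,
    Nat.divisors_prime_pow hp, sum_map, sum_map, sum_range_succ (n := m + 1)]
  simp

/-- As a function of q this is the Dirichlet convolution of μ with the multiplicative function d ↦
d·1[d ∣ n]. -/
theorem ramanujanSum_mul {q r : ℕ} (h : Nat.Coprime q r) (n : ℤ) :
    ramanujanSum (q * r) n = ramanujanSum q n * ramanujanSum r n := by
  let g : ArithmeticFunction ℤ := ⟨fun d => if (d : ℤ) ∣ n then (d : ℤ) else 0, by simp⟩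
  have hg : g.IsMultiplicative := by
    refine ⟨by simp [g], fun {a b} hab => ?_⟩
    simp only [g, coe_mk]
    have : ((a * b : ℕ) : ℤ) ∣ n ↔ (a : ℤ) ∣ n ∧ (b : ℤ) ∣ n := by
      push_cast
      exact ⟨fun h => ⟨(dvd_mul_right _ _).trans h, (dvd_mul_left _ _).trans h⟩,
        fun h => (Nat.isCoprime_iff_coprime.2 hab).mul_dvd h.1 h.2⟩
    simp only [this]
    by_cases h1 : (a : ℤ) ∣ n <;> by_cases h2 : (b : ℤ) ∣ n <;> simp [h1, h2]
  exact (isMultiplicative_moebius.mul hg).map_mul_of_coprime h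

/-- Write 1[d ∣ n] as d⁻¹ times the sum of c_q(n) over q ∣ d and put d = q m; summing 1/m over m ≤
M/q produces the harmonic number. The expansion is exact, so the moduli can later be split at any
point. -/
theorem card_dvd_eq_sum_ramanujanSum (M : ℕ) (n : ℤ) :
    (#((Icc 1 M).filter fun d : ℕ => (d : ℤ) ∣ n) : ℝ) =
      ∑ q ∈ Icc 1 M, (ramanujanSum q n : ℝ) / q * (harmonic (M / q) : ℝ) := by
  have h1 : ∀ d ∈ Icc 1 M, (if (d : ℤ) ∣ n then (1 : ℝ) else 0) =
      ∑ q ∈ Icc 1 M, if q ∣ d then (ramanujanSum q n : ℝ) / d else 0 := by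
    intro d hd
    rw [mem_Icc] at hd
    have hs := congrArg (fun z : ℤ => (z : ℝ) / d) (sum_divisors_ramanujanSum n hd.1)
    have hd0 : (d : ℝ) ≠ 0 := by exact_mod_cast (by omega : d ≠ 0)
    simp only [Int.cast_sum, Int.cast_ite, Int.cast_natCast, Int.cast_zero, Finset.sum_div] at hs
    rw [← Finset.sum_filter]
    have : (Icc 1 M).filter (fun q => q ∣ d) = d.divisors := by
      ext q
      simp only [mem_filter, mem_Icc, Nat.mem_divisors]
      exact ⟨fun h => ⟨h.2, by omega⟩, fun h =>
        ⟨⟨Nat.pos_of_dvd_of_pos h.1 hd.1, (Nat.le_of_dvd hd.1 h.1).trans hd.2⟩, h.1⟩⟩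
    rw [this, hs]
    split_ifs <;> simp [hd0]
  rw [Finset.card_filter]; push_cast
  rw [Finset.sum_congr rfl h1, Finset.sum_comm]
  refine Finset.sum_congr rfl fun q hq => ?_
  have hq0 : 0 < q := (mem_Icc.1 hq).1
  rw [← Finset.sum_filter, harmonic_eq_sum_Icc]
  push_cast
  rw [Finset.mul_sum]
  symm
  refine Finset.sum_bij (fun m _ => q * m) ?_ ?_ ?_ ?_
  · intro m hm
    rw [mem_Icc, Nat.le_div_iff_mul_le hq0] at hm
    simp only [mem_filter, mem_Icc, dvd_mul_right, and_true]
    exact ⟨Nat.mul_pos hq0 hm.1, by rw [mul_comm]; exact hm.2⟩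
  · intro a _ b _ h
    exact Nat.eq_of_mul_eq_mul_left hq0 h
  · intro d hd
    simp only [mem_filter, mem_Icc] at hd
    obtain ⟨m, rfl⟩ := hd.2
    exact ⟨m, by rw [mem_Icc, Nat.le_div_iff_mul_le hq0, mul_comm m]
                 exact ⟨Nat.pos_of_mul_pos_left hd.1.1, hd.1.2⟩, rfl⟩
  · intro m _
    push_cast
    rw [div_mul_eq_div_div, ← div_eq_mul_inv]

theorem sum_Icc_inv_le {M k : ℕ} (h : M ≤ k) :
    ∑ m ∈ Icc 1 M, (m : ℝ)⁻¹ ≤ 1 + Real.log k := by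
  have h2 : ∑ m ∈ Icc 1 M, (m : ℝ)⁻¹ ≤ ∑ m ∈ Icc 1 k, (m : ℝ)⁻¹ :=
    sum_le_sum_of_subset_of_nonneg (Icc_subset_Icc_right h) fun _ _ _ => by positivity
  have h3 := harmonic_le_one_add_log k
  rw [harmonic_eq_sum_Icc] at h3
  push_cast at h3
  exact h2.trans h3

/-- |c_q(n)| is at most the sum of the common divisors g of q and n, and for each g ∣ n the
multiples q of g contribute a harmonic sum. So |c_q(n)|/q is small on average over q, although a
single c_q(n) can be as large as φ(q). -/
theorem sum_abs_ramanujanSum_div_le {n : ℕ} (hn : 0 < n) (k : ℕ) :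
    ∑ q ∈ Icc 1 k, |(ramanujanSum q n : ℝ)| / q ≤ #n.divisors * (1 + Real.log k) := by
  have h1 : ∀ q ∈ Icc 1 k, |(ramanujanSum q n : ℝ)| / q ≤
      ∑ g ∈ n.divisors, if g ∣ q then (g : ℝ) / q else 0 := by
    intro q hq
    have hq0 : 0 < q := (mem_Icc.1 hq).1
    have h := abs_ramanujanSum_le q n
    have h' : |(ramanujanSum q n : ℝ)| ≤ ∑ g ∈ q.divisors, if (g : ℤ) ∣ n then (g : ℝ) else 0 := by
      have := (Int.cast_le (R := ℝ)).2 h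
      push_cast at this
      exact this
    have h2 : ∑ g ∈ q.divisors, (if (g : ℤ) ∣ n then (g : ℝ) else 0) =
        ∑ g ∈ n.divisors, if g ∣ q then (g : ℝ) else 0 := by
      rw [← Finset.sum_filter, ← Finset.sum_filter]
      refine Finset.sum_congr ?_ fun _ _ => rfl
      ext g
      simp only [mem_filter, Nat.mem_divisors, Int.natCast_dvd_natCast]
      constructor
      · rintro ⟨⟨a, _⟩, b⟩; exact ⟨⟨b, by omega⟩, a⟩
      · rintro ⟨⟨a, _⟩, b⟩; exact ⟨⟨b, by omega⟩, a⟩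
    rw [h2] at h'
    calc _ ≤ (∑ g ∈ n.divisors, if g ∣ q then (g : ℝ) else 0) / q := by gcongr
      _ = _ := by rw [Finset.sum_div]; refine Finset.sum_congr rfl fun g _ => ?_; split_ifs <;> simp
  refine (Finset.sum_le_sum h1).trans ?_
  rw [Finset.sum_comm, ← nsmul_eq_mul]
  refine Finset.sum_le_card_nsmul _ _ _ fun g hg => ?_
  have hg0 : 0 < g := Nat.pos_of_mem_divisors hg
  rw [← Finset.sum_filter]
  refine le_trans (le_of_eq ?_) (sum_Icc_inv_le (Nat.div_le_self k g))
  symm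
  refine Finset.sum_bij (fun m _ => g * m) ?_ ?_ ?_ ?_
  · intro m hm
    rw [mem_Icc, Nat.le_div_iff_mul_le hg0] at hm
    simp only [mem_filter, mem_Icc, dvd_mul_right, and_true]
    exact ⟨Nat.mul_pos hg0 hm.1, by rw [mul_comm]; exact hm.2⟩
  · intro a _ b _ h
    exact Nat.eq_of_mul_eq_mul_left hg0 h
  · intro d hd
    simp only [mem_filter, mem_Icc] at hd
    obtain ⟨m, rfl⟩ := hd.2
    exact ⟨m, by rw [mem_Icc, Nat.le_div_iff_mul_le hg0, mul_comm m]
                 exact ⟨Nat.pos_of_mul_pos_left hd.1.1, hd.1.2⟩, rfl⟩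
  · intro m _
    have : (g : ℝ) ≠ 0 := by exact_mod_cast hg0.ne'
    push_cast
    field_simp

end RamanujanSum

/-! ### Taylor expansion and critical points of F. -/

namespace IntQuadPoly

variable {l : ℕ} (F : IntQuadPoly l)

open Finset

/-- The homogeneous quadratic part of `F`. -/
def homog : IntQuadPoly l := ⟨F.Q, 0, 0⟩

/-- The gradient `Q_S x + b` of `F`. -/
def grad {R : Type*} [CommRing R] (x : Fin l → R) (i : Fin l) : R :=
  ∑ j, (F.QS i j : R) * x j + (F.b i : R)

theorem map_eval {R S : Type*} [CommRing R] [CommRing S] (φ : R →+* S) (x : Fin l → R) :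
    φ (F.eval x) = F.eval fun i => φ (x i) := by
  simp [eval]

theorem eval_intCast {R : Type*} [CommRing R] (x : Fin l → ℤ) :
    F.eval (fun i => (x i : R)) = ((F.eval x : ℤ) : R) :=
  (F.map_eval (Int.castRingHom R) x).symm

theorem map_grad {R S : Type*} [CommRing R] [CommRing S] (φ : R →+* S) (x : Fin l → R)
    (i : Fin l) : φ (F.grad x i) = F.grad (fun i => φ (x i)) i := by
  simp [grad]

/-- Taylor's formula, exact in degree two. Since the quadratic part does not involve x, it cancels
from differences F(u + t) − F(v + t), which are therefore linear in t. -/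
theorem eval_add {R : Type*} [CommRing R] (x h : Fin l → R) :
    F.eval (x + h) = F.eval x + ∑ i, h i * F.grad x i + F.homog.eval h := by
  have e1 : ∑ i, ∑ j, h i * ((F.Q j i : R) * x j) = ∑ i, ∑ j, x i * (F.Q i j : R) * h j := by
    rw [Finset.sum_comm]
    exact Finset.sum_congr rfl fun i _ => Finset.sum_congr rfl fun j _ => by ring
  have e2 : ∑ i, h i * F.grad x i = ∑ i, ∑ j, h i * (F.Q i j : R) * x j +
      ∑ i, ∑ j, x i * (F.Q i j : R) * h j + ∑ i, (F.b i : R) * h i := by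
    rw [← e1, ← Finset.sum_add_distrib, ← Finset.sum_add_distrib]
    refine Finset.sum_congr rfl fun i _ => ?_
    simp only [grad, QS, Matrix.add_apply, Matrix.transpose_apply, Int.cast_add]
    rw [mul_add, Finset.mul_sum, ← Finset.sum_add_distrib, mul_comm (h i) (F.b i : R)]
    congr 1
    exact Finset.sum_congr rfl fun j _ => by ring
  rw [e2]
  simp only [eval, homog, Pi.add_apply, Pi.zero_apply, Int.cast_zero, zero_mul, sum_const_zero,
    add_zero]
  have e3 : ∑ i, ∑ j, (x i + h i) * (F.Q i j : R) * (x j + h j) =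
      ∑ i, ∑ j, x i * (F.Q i j : R) * x j + ∑ i, ∑ j, h i * (F.Q i j : R) * x j +
      ∑ i, ∑ j, x i * (F.Q i j : R) * h j + ∑ i, ∑ j, h i * (F.Q i j : R) * h j := by
    simp only [← Finset.sum_add_distrib]
    exact Finset.sum_congr rfl fun i _ => Finset.sum_congr rfl fun j _ => by ring
  rw [e3]
  simp only [mul_add, Finset.sum_add_distrib]
  ring

theorem homog_smul {R : Type*} [CommRing R] (c : R) (x : Fin l → R) :
    F.homog.eval (fun i => c * x i) = c ^ 2 * F.homog.eval x := by
  simp only [eval, homog, Pi.zero_apply, Int.cast_zero, zero_mul, sum_const_zero, add_zero,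
    Finset.mul_sum]
  exact Finset.sum_congr rfl fun i _ => Finset.sum_congr rfl fun j _ => by ring

/-- At a critical point, `2 Δ_F F(x) = R_F`. -/
theorem two_discr_mul_eval {R : Type*} [CommRing R] {x : Fin l → R} (hx : ∀ i, F.grad x i = 0) :
    2 * (F.discr : R) * F.eval x = F.root := by
  -- The increment h = x gives F(2x) = F(x) + q at a critical point; hence 2q + b = 0 and 2F(x) = b
  -- + 2c, where q and b are the quadratic and the linear part of F at x.
  have key := F.eval_add x x
  simp only [hx, mul_zero, sum_const_zero, add_zero] at key
  -- Euler's relation for the quadratic and the linear part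
  set q : R := F.homog.eval x with hq
  set b : R := ∑ i, (F.b i : R) * x i with hb
  have h0 : F.eval x = q + b + F.c := by
    simp [eval, homog, hq, hb]
  have h1 : F.eval (x + x) = 4 * q + 2 * b + F.c := by
    have := F.homog_smul 2 x
    simp only [eval, homog, Pi.zero_apply, Int.cast_zero, zero_mul, sum_const_zero,
      add_zero] at this hq
    simp only [eval, Pi.add_apply, ← two_mul, this, hb]
    rw [← hq, Finset.mul_sum]
    congr 2
    · ring
    · exact Finset.sum_congr rfl fun j _ => by ring
  have h2 : 2 * F.eval x = b + 2 * F.c := by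
    rw [h1, h0] at key
    rw [h0]
    linear_combination key
  -- Multiplying Q_S x = −b by the adjugate avoids dividing by Δ_F, so the identity holds over every
  -- commutative ring.
  have h3 : ∀ i, (F.discr : R) * x i = - ∑ j, (F.QS.adjugate i j : R) * (F.b j : R) := by
    intro i
    have e : ∀ j, ∑ k, (F.QS j k : R) * x k = - (F.b j : R) := fun j =>
      eq_neg_of_add_eq_zero_left (hx j)
    have e2 : ∑ j, (F.QS.adjugate i j : R) * ∑ k, (F.QS j k : R) * x k = (F.discr : R) * x i := by
      simp only [Finset.mul_sum]
      rw [Finset.sum_comm]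
      have e3 : ∀ k, ∑ j, (F.QS.adjugate i j : R) * (F.QS j k : R) =
          if i = k then (F.discr : R) else 0 := by
        intro k
        have := congrFun (congrFun (Matrix.adjugate_mul F.QS) i) k
        rw [Matrix.mul_apply, Matrix.smul_apply, Matrix.one_apply] at this
        have := congrArg (Int.cast : ℤ → R) this
        push_cast at this
        rw [this, discr]
        split_ifs <;> simp
      simp only [← mul_assoc, ← Finset.sum_mul, e3, ite_mul, zero_mul]
      simp
    rw [← e2]
    simp [e]
  have h4 : (F.discr : R) * b = - ∑ i, (F.b i : R) * ∑ j, (F.QS.adjugate i j : R) * (F.b j : R) := by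
    rw [hb, Finset.mul_sum, ← Finset.sum_neg_distrib]
    refine Finset.sum_congr rfl fun i _ => ?_
    linear_combination (F.b i : R) * h3 i
  have h5 : (F.root : R) = 2 * F.c * F.discr -
      ∑ i, (F.b i : R) * ∑ j, (F.QS.adjugate i j : R) * (F.b j : R) := by
    simp [root, dotProduct, Matrix.mulVec]
  rw [h5]
  linear_combination (F.discr : R) * h2 + h4

end IntQuadPoly

/-! ### Complete sums: S_F as an average of Ramanujan sums. -/

/-- Summing over a finite group the pullback of a function under a surjective homomorphism. -/
theorem sum_comp_of_surjective {G H M : Type*} [AddGroup G] [AddGroup H] [Fintype G] [Fintype H]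
    [Field M] [CharZero M] (f : G →+ H) (hf : Function.Surjective f) (g : H → M) :
    ∑ x, g (f x) = (Fintype.card G : M) / Fintype.card H * ∑ y, g y := by
  classical
  have h1 : ∀ g : H → M, ∑ x, g (f x) = (Nat.card f.ker : M) * ∑ y, g y := by
    intro g
    rw [← Finset.sum_fiberwise (s := Finset.univ) (g := f), Finset.mul_sum]
    refine Finset.sum_congr rfl fun y _ => ?_
    rw [Finset.sum_congr rfl (g := fun _ => g y) (fun x hx => by rw [(Finset.mem_filter.1 hx).2]),
      Finset.sum_const, nsmul_eq_mul]
    congr 2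
    obtain ⟨x, rfl⟩ := hf y
    rw [Nat.card_eq_fintype_card, ← Fintype.card_coe]
    refine Fintype.card_congr ⟨fun z => ⟨-x + z.1, ?_⟩, fun z => ⟨x + z.1, ?_⟩, ?_, ?_⟩
    · have := (Finset.mem_filter.1 z.2).2
      simp [AddMonoidHom.mem_ker, this]
    · have := z.2
      rw [AddMonoidHom.mem_ker] at this
      simp [this]
    · intro z; simp
    · intro z; simp
  have h2 := h1 fun _ => 1
  simp only [Finset.sum_const, Finset.card_univ, nsmul_eq_mul, mul_one] at h2
  have : (Fintype.card H : M) ≠ 0 := by exact_mod_cast Fintype.card_ne_zero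
  rw [h1 g, h2, mul_div_assoc, div_self this, mul_one]

theorem ramanujanSum_zmod {q : ℕ} [NeZero q] (n : ℤ) :
    ramanujanSum q ((n : ZMod q).val : ℤ) = ramanujanSum q n :=
  ramanujanSum_congr (by rw [← ZMod.intCast_zmod_eq_zero_iff_dvd]; simp)

namespace IntQuadPoly

variable {l : ℕ} (F : IntQuadPoly l)

open Finset

theorem sum_piFinset_Ico_zmod {M : Type*} [AddCommMonoid M] {q : ℕ} [NeZero q] (t : Fin l → ℤ)
    (φ : (Fin l → ZMod q) → M) :
    ∑ u ∈ Fintype.piFinset (fun _ : Fin l => Ico (0 : ℤ) q),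
      φ (fun i => ((t i + u i : ℤ) : ZMod q)) = ∑ x, φ x := by
  refine Finset.sum_bij (fun u _ i => ((t i + u i : ℤ) : ZMod q)) (by simp) ?_ ?_ (by simp)
  · intro u hu v hv huv
    ext i
    have h := congrFun huv i
    have hu := mem_Ico.1 (Fintype.mem_piFinset.1 hu i)
    have hv := mem_Ico.1 (Fintype.mem_piFinset.1 hv i)
    push_cast at h
    have h := add_left_cancel h
    rw [ZMod.intCast_eq_intCast_iff_dvd_sub] at h
    have h1 := Int.eq_zero_of_abs_lt_dvd h (by rw [abs_lt]; omega)
    omega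
  · intro x _
    refine ⟨fun i => ((x i - t i : ZMod q).val : ℤ), ?_, ?_⟩
    · rw [Fintype.mem_piFinset]
      intro i
      rw [mem_Ico]
      exact ⟨by positivity, by exact_mod_cast ZMod.val_lt _⟩
    · ext i; simp

/-- Carrying out the sum over a first turns the exponentials into c_q. In this form S_F(q) is
visibly rational, and its recursion and multiplicativity can be read off from those of c_q. -/
theorem gaussSum_eq (q : ℕ) [NeZero q] :
    F.gaussSum q = (q : ℂ)⁻¹ * ∑ x : Fin l → ZMod q, (ramanujanSum q ((F.eval x).val : ℤ) : ℂ) := by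
  have hq : 0 < q := Nat.pos_of_ne_zero (NeZero.ne q)
  rw [gaussSum, Finset.sum_comm]
  simp only [← ramanujanSum_eq_sum_exp hq]
  congr 1
  refine Finset.sum_bij (fun h _ i => ((h i : ℕ) : ZMod q)) (by simp) ?_ ?_ ?_
  · intro u _ v _ huv
    ext i
    have h := congrFun huv i
    rw [ZMod.natCast_eq_natCast_iff', Nat.mod_eq_of_lt (u i).2, Nat.mod_eq_of_lt (v i).2] at h
    exact h
  · intro x _
    exact ⟨fun i => ⟨(x i).val, ZMod.val_lt _⟩, by simp, by ext i; simp⟩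
  · intro h _
    have := F.eval_intCast (R := ZMod q) (fun i => ((h i : ℕ) : ℤ))
    simp only [Int.cast_natCast] at this
    rw [this, ramanujanSum_zmod]

theorem gaussSum_zero : F.gaussSum 0 = 0 := by simp [gaussSum]

theorem gaussSum_one : F.gaussSum 1 = 1 := by
  rw [gaussSum_eq]; simp [ramanujanSum_one]

theorem rho_eq (n : ℕ) [NeZero n] :
    F.rho n = ∑ x : Fin l → ZMod n, if F.eval x = 0 then 1 else 0 := by
  classical
  rw [rho, Nat.card_eq_fintype_card, Fintype.card_subtype, Finset.card_filter]

theorem sum_castHom {M : Type*} [Field M] [CharZero M] {q n : ℕ} [NeZero q] [NeZero n] (h : q ∣ n)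
    (g : (Fin l → ZMod q) → M) :
    ∑ x : Fin l → ZMod n, g (fun i => ZMod.castHom h (ZMod q) (x i)) =
      ((n : M) / q) ^ l * ∑ x, g x := by
  have := sum_comp_of_surjective
    ((ZMod.castHom h (ZMod q)).toAddMonoidHom.compLeft (Fin l))
    (fun y => by
      choose x hx using fun i => ZMod.castHom_surjective h (y i)
      exact ⟨x, funext hx⟩) g
  refine Eq.trans ?_ (this.trans ?_)
  · rfl
  · simp [div_pow]

theorem natCast_dvd_val_iff {q n : ℕ} [NeZero n] (h : q ∣ n) (z : ZMod n) :
    ((q : ℕ) : ℤ) ∣ (z.val : ℤ) ↔ ZMod.castHom h (ZMod q) z = 0 := by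
  rw [← ZMod.intCast_zmod_eq_zero_iff_dvd]
  simp [ZMod.castHom_apply, ZMod.natCast_val]

/-- c_{p^(m+1)} is a difference of two divisibility indicators. The second depends on x modulo p^m
only; each class has p^l lifts, and the weight p^m / p^(m+1) turns this into p^(l−1). -/
theorem gaussSum_prime_pow {p : ℕ} (hp : p.Prime) (m : ℕ) :
    F.gaussSum (p ^ (m + 1)) = F.rho (p ^ (m + 1)) - (p : ℂ) ^ ((l : ℤ) - 1) * F.rho (p ^ m) := by
  have : NeZero p := ⟨hp.ne_zero⟩
  have hp0 : (p : ℂ) ≠ 0 := by exact_mod_cast hp.ne_zero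
  rw [gaussSum_eq]
  simp only [ramanujanSum_prime_pow hp]
  push_cast
  rw [Finset.sum_sub_distrib, mul_sub]
  congr 1
  · rw [rho_eq]
    push_cast
    rw [Finset.mul_sum]
    refine Finset.sum_congr rfl fun x _ => ?_
    have := natCast_dvd_val_iff (dvd_refl (p ^ (m + 1))) (F.eval x)
    push_cast at this
    simp only [this]
    rw [ZMod.castHom_self, RingHom.id_apply]
    split_ifs <;> simp [hp0]
  · have h1 := sum_castHom (l := l) (M := ℂ) (pow_dvd_pow p (Nat.le_succ m))
      (fun x => if F.eval x = 0 then 1 else 0)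
    rw [rho_eq]
    push_cast
    rw [zpow_sub₀ hp0, zpow_natCast, zpow_one]
    have h2 : ∀ x : Fin l → ZMod (p ^ (m + 1)),
        (if (p : ℤ) ^ m ∣ ((F.eval x).val : ℤ) then (p : ℂ) ^ m else 0) = (p : ℂ) ^ m *
        if F.eval (fun i => ZMod.castHom (pow_dvd_pow p (Nat.le_succ m)) (ZMod (p ^ m)) (x i)) = 0
          then 1 else 0 := by
      intro x
      have := natCast_dvd_val_iff (pow_dvd_pow p (Nat.le_succ m)) (F.eval x)
      push_cast at this
      rw [mul_ite, mul_one, mul_zero]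
      refine if_congr ?_ rfl rfl
      rw [this, map_eval]
    simp only [h2]
    rw [← Finset.mul_sum, h1]
    push_cast
    rw [pow_succ (p : ℂ) m, mul_div_cancel_left₀ _ (pow_ne_zero _ hp0)]
    field_simp

/-- The Chinese remainder isomorphism is a ring map, hence compatible with the integer polynomial F,
and c_{qr} = c_q c_r. -/
theorem gaussSum_mul {q r : ℕ} (h : Nat.Coprime q r) :
    F.gaussSum (q * r) = F.gaussSum q * F.gaussSum r := by
  rcases Nat.eq_zero_or_pos q with rfl | hq
  · simp [gaussSum_zero]
  rcases Nat.eq_zero_or_pos r with rfl | hr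
  · simp [gaussSum_zero]
  have : NeZero q := ⟨hq.ne'⟩
  have : NeZero r := ⟨hr.ne'⟩
  rw [gaussSum_eq, gaussSum_eq, gaussSum_eq]
  set e := ZMod.chineseRemainder h
  have h1 : ∑ x : Fin l → ZMod (q * r), (ramanujanSum (q * r) ((F.eval x).val : ℤ) : ℂ) =
      ∑ y : (Fin l → ZMod q) × (Fin l → ZMod r), (ramanujanSum q ((F.eval y.1).val : ℤ) : ℂ) *
        (ramanujanSum r ((F.eval y.2).val : ℤ) : ℂ) := by
    refine Fintype.sum_equiv ((Equiv.arrowCongr (Equiv.refl _) e.toEquiv).trans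
      (Equiv.arrowProdEquivProdArrow (Fin l) (fun _ => ZMod q) (fun _ => ZMod r))) _ _ fun x => ?_
    rw [ramanujanSum_mul h, Int.cast_mul]
    have a1 : ∀ z : ZMod (q * r), ramanujanSum q (((e z).1).val : ℤ) = ramanujanSum q (z.val : ℤ) := by
      intro z
      have : (e z).1 = ((z.val : ℤ) : ZMod q) := by
        refine (congrArg (fun w => (e w).1) (ZMod.natCast_zmod_val z).symm).trans ?_
        simp only [map_natCast, Prod.fst_natCast, Int.cast_natCast]
      rw [this, ramanujanSum_zmod]
    have a2 : ∀ z : ZMod (q * r), ramanujanSum r (((e z).2).val : ℤ) = ramanujanSum r (z.val : ℤ) := by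
      intro z
      have : (e z).2 = ((z.val : ℤ) : ZMod r) := by
        refine (congrArg (fun w => (e w).2) (ZMod.natCast_zmod_val z).symm).trans ?_
        simp only [map_natCast, Prod.snd_natCast, Int.cast_natCast]
      rw [this, ramanujanSum_zmod]
    rw [← a1, ← a2]
    have b1 := F.map_eval ((RingHom.fst (ZMod q) (ZMod r)).comp (e : ZMod (q * r) →+* _)) x
    have b2 := F.map_eval ((RingHom.snd (ZMod q) (ZMod r)).comp (e : ZMod (q * r) →+* _)) x
    simp only [RingHom.comp_apply, RingHom.coe_fst, RingHom.coe_snd, RingHom.coe_coe] at b1 b2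
    rw [b1, b2]
    rfl
  rw [h1, Fintype.sum_prod_type]
  dsimp only
  rw [← Finset.sum_mul_sum]
  push_cast
  rw [mul_inv]
  ring

end IntQuadPoly

/-! ### Mean squares and square-root cancellation. -/

namespace IntQuadPoly

variable {l : ℕ} (F : IntQuadPoly l)

open Finset

theorem card_mul_eq_zero_le {q : ℕ} [NeZero q] {d : ℤ} (hd : d ≠ 0) :
    #{z : ZMod q | (d : ZMod q) * z = 0} ≤ d.natAbs := by
  have := IsAddCyclic.card_nsmul_eq_zero_le (α := ZMod q) (n := d.natAbs) (Int.natAbs_pos.2 hd)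
  refine le_trans (le_of_eq (congrArg card (filter_congr fun z _ => ?_))) this
  rw [nsmul_eq_mul, ← neg_eq_zero (a := (d : ZMod q) * z)]
  rcases Int.natAbs_eq d with h | h
  · have : (d : ZMod q) = (d.natAbs : ZMod q) := by
      conv_lhs => rw [h]
      exact Int.cast_natCast _
    rw [this, neg_eq_zero]
  · have : (d : ZMod q) = -(d.natAbs : ZMod q) := by
      conv_lhs => rw [h]
      rw [Int.cast_neg, Int.cast_natCast]
    rw [this, neg_mul, neg_neg]

/-- Equal gradients mean Q_S (v − u) = 0. The adjugate turns this into Δ_F (v − u) = 0, and each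
coordinate then has at most |Δ_F| possibilities, uniformly in q. -/
theorem card_grad_eq_le (hF : F.discr ≠ 0) {q : ℕ} [NeZero q] (u : Fin l → ZMod q) :
    #{v : Fin l → ZMod q | ∀ i, F.grad u i = F.grad v i} ≤ F.discr.natAbs ^ l := by
  have h1 : #(Fintype.piFinset fun _ : Fin l => ({z : ZMod q | (F.discr : ZMod q) * z = 0} : Finset _))
      ≤ F.discr.natAbs ^ l := by
    rw [Fintype.card_piFinset]
    simpa using Nat.pow_le_pow_left (card_mul_eq_zero_le (q := q) hF) l
  refine le_trans (Finset.card_le_card_of_injOn (fun v => v - u) ?_ ?_) h1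
  · intro v hv
    have hv : ∀ i, F.grad u i = F.grad v i := by simpa using hv
    rw [mem_coe, Fintype.mem_piFinset]
    intro i
    simp only [mem_filter, mem_univ, true_and]
    have h2 : (F.QS.map (Int.cast : ℤ → ZMod q)).mulVec (v - u) = 0 := by
      ext i
      have := hv i
      simp only [grad, add_left_inj] at this
      simp [Matrix.mulVec, dotProduct, mul_sub, this]
    have h3 := congrArg (F.QS.map (Int.cast : ℤ → ZMod q)).adjugate.mulVec h2
    rw [Matrix.mulVec_mulVec, Matrix.adjugate_mul, Matrix.smul_mulVec, Matrix.one_mulVec,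
      Matrix.mulVec_zero] at h3
    have h4 : (F.QS.map (Int.cast : ℤ → ZMod q)).det = (F.discr : ZMod q) :=
      ((Int.castRingHom (ZMod q)).map_det F.QS).symm
    rw [h4] at h3
    exact congrFun h3 i
  · intro v _ w _ h
    exact sub_left_injective h

theorem _root_.AddChar.map_finsetSum {A M ι : Type*} [AddCommMonoid A] [CommMonoid M] (ψ : AddChar A M)
    (s : Finset ι) (f : ι → A) : ψ (∑ i ∈ s, f i) = ∏ i ∈ s, ψ (f i) := by
  classical
  induction s using Finset.induction_on with
  | empty => simp
  | insert a s ha ih => rw [sum_insert ha, prod_insert ha, AddChar.map_add_eq_mul, ih]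

theorem sum_stdAddChar_linear {q : ℕ} [NeZero q] (g : Fin l → ZMod q) :
    ∑ t : Fin l → ZMod q, ZMod.stdAddChar (∑ i, t i * g i) =
      if ∀ i, g i = 0 then (q : ℂ) ^ l else 0 := by
  simp only [AddChar.map_finsetSum]
  rw [← Fintype.prod_sum (fun i z => ZMod.stdAddChar (z * g i))]
  simp only [AddChar.sum_mulShift _ (ZMod.isPrimitive_stdAddChar q), ZMod.card]
  split_ifs with h
  · simp [h]
  · push Not at h
    obtain ⟨i, hi⟩ := h
    exact Finset.prod_eq_zero (mem_univ i) (by simp [hi])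

/-- Mean-square bound for the exponential sums of `F` over translates of a set of residues. -/
theorem sum_norm_sq_expSum_le (hF : F.discr ≠ 0) {q : ℕ} [NeZero q] {a : ZMod q} (ha : IsUnit a)
    (U : Finset (Fin l → ZMod q)) :
    ∑ t : Fin l → ZMod q, ‖∑ u ∈ U, ZMod.stdAddChar (a * F.eval (t + u))‖ ^ 2 ≤
      (q : ℝ) ^ l * #U * (F.discr.natAbs : ℝ) ^ l := by
  -- Expand the square. By `eval_add` the phase F(u + t) − F(v + t) is linear in t with slope the
  -- difference of the two gradients, so orthogonality in t keeps only the pairs with equal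
  -- gradients.
  have h1 : ((∑ t : Fin l → ZMod q, ‖∑ u ∈ U, ZMod.stdAddChar (a * F.eval (t + u))‖ ^ 2 : ℝ) : ℂ) =
      ∑ u ∈ U, ∑ v ∈ U, ZMod.stdAddChar (a * (F.eval u - F.eval v)) *
        if ∀ i, F.grad u i = F.grad v i then (q : ℂ) ^ l else 0 := by
    have e : ∀ u v : Fin l → ZMod q, (if ∀ i, F.grad u i = F.grad v i then (q : ℂ) ^ l else 0) =
        ∑ t : Fin l → ZMod q, ZMod.stdAddChar (∑ i, t i * (a * (F.grad u i - F.grad v i))) := by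
      intro u v
      rw [sum_stdAddChar_linear]
      simp only [ha.mul_right_eq_zero, sub_eq_zero]
    simp only [e, Finset.mul_sum]
    push_cast
    simp only [← Complex.mul_conj', map_sum, Finset.sum_mul_sum]
    rw [Finset.sum_comm]
    refine Finset.sum_congr rfl fun u _ => ?_
    rw [Finset.sum_comm]
    refine Finset.sum_congr rfl fun v _ => Finset.sum_congr rfl fun t _ => ?_
    rw [← AddChar.map_neg_eq_conj, ← AddChar.map_add_eq_mul, ← AddChar.map_add_eq_mul]
    congr 1
    rw [add_comm t u, add_comm t v, eval_add, eval_add]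
    have : ∑ i, t i * (a * (F.grad u i - F.grad v i)) =
        a * (∑ i, t i * F.grad u i - ∑ i, t i * F.grad v i) := by
      rw [← Finset.sum_sub_distrib, Finset.mul_sum]
      exact Finset.sum_congr rfl fun i _ => by ring
    rw [this]; ring
  have h2 : ∑ t : Fin l → ZMod q, ‖∑ u ∈ U, ZMod.stdAddChar (a * F.eval (t + u))‖ ^ 2 =
      ‖((∑ t : Fin l → ZMod q, ‖∑ u ∈ U, ZMod.stdAddChar (a * F.eval (t + u))‖ ^ 2 : ℝ) : ℂ)‖ := by
    rw [Complex.norm_real, Real.norm_of_nonneg (by positivity)]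
  rw [h2, h1]
  have h3 : ∀ u ∈ U, ‖∑ v ∈ U, ZMod.stdAddChar (a * (F.eval u - F.eval v)) *
      if ∀ i, F.grad u i = F.grad v i then (q : ℂ) ^ l else 0‖ ≤
      (q : ℝ) ^ l * (F.discr.natAbs : ℝ) ^ l := by
    intro u _
    have h4 : ∀ v ∈ U, ‖ZMod.stdAddChar (a * (F.eval u - F.eval v)) *
        (if ∀ i, F.grad u i = F.grad v i then (q : ℂ) ^ l else 0)‖ ≤
        if ∀ i, F.grad u i = F.grad v i then (q : ℝ) ^ l else 0 := by
      intro v _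
      rw [norm_mul, AddChar.norm_apply, one_mul]
      split_ifs <;> simp
    refine (norm_sum_le_of_le _ h4).trans ?_
    rw [← Finset.sum_filter, Finset.sum_const, nsmul_eq_mul, mul_comm]
    gcongr
    have := F.card_grad_eq_le hF u
    refine le_trans ?_ (Nat.cast_le.2 this |>.trans (by push_cast; rfl))
    exact Nat.cast_le.2 (card_le_card (filter_subset_filter _ (subset_univ U)))
  refine (norm_sum_le_of_le _ h3).trans (le_of_eq ?_)
  rw [Finset.sum_const, nsmul_eq_mul]; ring

/-- When U consists of all residues the inner sum does not depend on t, so the mean square bounds a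
single sum. -/
theorem norm_complete_expSum_le (hF : F.discr ≠ 0) {q : ℕ} [NeZero q] {a : ZMod q} (ha : IsUnit a) :
    ‖∑ u : Fin l → ZMod q, ZMod.stdAddChar (a * F.eval u)‖ ≤
      ((q : ℝ) * F.discr.natAbs) ^ ((l : ℝ) / 2) := by
  have h := F.sum_norm_sq_expSum_le hF ha univ
  have h1 : ∀ t : Fin l → ZMod q, ∑ u, ZMod.stdAddChar (a * F.eval (t + u)) =
      ∑ u, ZMod.stdAddChar (a * F.eval u) := fun t =>
    Fintype.sum_equiv (Equiv.addLeft t) _ _ fun u => rfl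
  simp only [h1, Finset.sum_const, Finset.card_univ, Fintype.card_fun, ZMod.card, Fintype.card_fin,
    nsmul_eq_mul, Nat.cast_pow] at h
  have hq : (0 : ℝ) < (q : ℝ) ^ l := pow_pos (by exact_mod_cast Nat.pos_of_ne_zero (NeZero.ne q)) l
  rw [mul_assoc] at h
  have h2 := le_of_mul_le_mul_left h hq
  rw [← mul_pow] at h2
  have h3 : (((q : ℝ) * F.discr.natAbs) ^ ((l : ℝ) / 2)) ^ 2 = ((q : ℝ) * F.discr.natAbs) ^ (l : ℝ) := by
    rw [← Real.rpow_natCast (_ ^ ((l : ℝ) / 2)), ← Real.rpow_mul (by positivity)]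
    congr 1
    push_cast; ring
  rw [Real.rpow_natCast] at h3
  rw [← h3] at h2
  exact (pow_le_pow_iff_left₀ (norm_nonneg _) (by positivity) two_ne_zero).1 h2

theorem ramanujanSum_eq_sum_stdAddChar {q : ℕ} [NeZero q] (z : ZMod q) :
    (ramanujanSum q (z.val : ℤ) : ℂ) = ∑ a ∈ (range q).filter (fun a => Nat.Coprime a q),
      ZMod.stdAddChar ((a : ZMod q) * z) := by
  rw [ramanujanSum_eq_sum_exp (Nat.pos_of_ne_zero (NeZero.ne q))]
  refine Finset.sum_congr rfl fun a _ => ?_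
  rw [← ZMod.stdAddChar_coe]
  simp

/-- The constant in the square-root bound for `S_F(q)`. -/
noncomputable def gaussBound : ℝ := (F.discr.natAbs : ℝ) ^ ((l : ℝ) / 2)

theorem gaussBound_nonneg : 0 ≤ F.gaussBound := by unfold gaussBound; positivity

/-- No cancellation in a is used: its at most q values offset the factor q⁻¹. The bound is enough
for convergence and tails at s = l because l/2 > 1. -/
theorem norm_gaussSum_le (hF : F.discr ≠ 0) (q : ℕ) :
    ‖F.gaussSum q‖ ≤ F.gaussBound * (q : ℝ) ^ ((l : ℝ) / 2) := by
  rcases Nat.eq_zero_or_pos q with rfl | hq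
  · rw [gaussSum_zero, norm_zero]
    have := F.gaussBound_nonneg
    positivity
  have : NeZero q := ⟨hq.ne'⟩
  rw [gaussSum_eq]
  simp only [ramanujanSum_eq_sum_stdAddChar]
  rw [Finset.sum_comm, norm_mul, norm_inv, Complex.norm_natCast]
  have h1 : ∀ a ∈ (range q).filter (fun a => Nat.Coprime a q),
      ‖∑ x : Fin l → ZMod q, ZMod.stdAddChar ((a : ZMod q) * F.eval x)‖ ≤
      ((q : ℝ) * F.discr.natAbs) ^ ((l : ℝ) / 2) := fun a ha =>
    F.norm_complete_expSum_le hF ((ZMod.isUnit_iff_coprime a q).2 (mem_filter.1 ha).2)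
  have h2 := norm_sum_le_of_le _ h1
  rw [Finset.sum_const, nsmul_eq_mul] at h2
  have h3 : (#((range q).filter (fun a => Nat.Coprime a q)) : ℝ) ≤ q := by
    exact_mod_cast (card_filter_le _ _).trans (by simp)
  have hq' : (0 : ℝ) < q := by exact_mod_cast hq
  calc _ ≤ (q : ℝ)⁻¹ * (q * ((q : ℝ) * F.discr.natAbs) ^ ((l : ℝ) / 2)) := by
        gcongr
        exact h2.trans (by gcongr)
    _ = _ := by
        rw [inv_mul_cancel_left₀ hq'.ne', Real.mul_rpow (by positivity) (by positivity), gaussBound,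
          mul_comm]

end IntQuadPoly

/-! ### Diagonalising F over a field. -/

section Diagonalization

open Finset

/-- A symmetric matrix over a field of characteristic not two is congruent to a diagonal one. -/
theorem Matrix.IsSymm.exists_congr_diagonal {K : Type*} [Field K] (h2 : (2 : K) ≠ 0) {l : ℕ}
    {S : Matrix (Fin l) (Fin l) K} (hS : S.IsSymm) :
    ∃ (A : Matrix (Fin l) (Fin l) K) (c : Fin l → K), A.det ≠ 0 ∧
      A.transpose * S * A = Matrix.diagonal c := by
  have : Invertible (2 : K) := invertibleOfNonzero h2
  have hB : LinearMap.IsSymm (Matrix.toBilin' S) := by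
    refine ⟨fun x y => ?_⟩
    rw [RingHom.id_apply, Matrix.toBilin'_apply', Matrix.toBilin'_apply', Matrix.dotProduct_mulVec,
      ← Matrix.mulVec_transpose, hS.eq, dotProduct_comm]
  obtain ⟨v', hv'⟩ := LinearMap.BilinForm.exists_orthogonal_basis hB
  -- The orthogonal basis comes indexed by `Fin (finrank K (Fin l → K))`; generalising that rank and
  -- substituting its value reindexes it by `Fin l`.
  obtain ⟨v, hv⟩ : ∃ v : Module.Basis (Fin l) K (Fin l → K), (Matrix.toBilin' S).IsOrthoᵢ v := by
    have hn : Module.finrank K (Fin l → K) = l := Module.finrank_fin_fun K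
    generalize Module.finrank K (Fin l → K) = n at *
    subst hn
    exact ⟨v', hv'⟩
  refine ⟨(Pi.basisFun K (Fin l)).toMatrix v, fun i => Matrix.toBilin' S (v i) (v i), ?_, ?_⟩
  · have := (Pi.basisFun K (Fin l)).invertibleToMatrix v
    exact (Matrix.isUnit_det_of_invertible _).ne_zero
  · ext i j
    have h1 : ((Pi.basisFun K (Fin l)).toMatrix v).transpose * S *
        (Pi.basisFun K (Fin l)).toMatrix v = fun i j => Matrix.toBilin' S (v i) (v j) := by
      ext i j
      rw [Matrix.toBilin'_apply', Matrix.dotProduct_mulVec, Matrix.mul_apply]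
      simp [dotProduct, Matrix.vecMul, Matrix.mul_apply, Module.Basis.toMatrix_apply]
    rw [h1, Matrix.diagonal_apply]
    split_ifs with hij
    · rw [hij]
    · exact hv hij

end Diagonalization

namespace IntQuadPoly

variable {l : ℕ} (F : IntQuadPoly l)

open Finset

theorem QS_isSymm : F.QS.IsSymm := by
  rw [QS, Matrix.IsSymm, Matrix.transpose_add, Matrix.transpose_transpose, add_comm]

theorem two_mul_homog_eval {R : Type*} [CommRing R] (x : Fin l → R) :
    2 * F.homog.eval x = dotProduct x ((F.QS.map (Int.cast : ℤ → R)).mulVec x) := by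
  have e1 : ∑ i, ∑ j, x i * ((F.Q j i : R) * x j) = ∑ i, ∑ j, x i * (F.Q i j : R) * x j := by
    rw [Finset.sum_comm]
    exact Finset.sum_congr rfl fun i _ => Finset.sum_congr rfl fun j _ => by ring
  have e2 : F.homog.eval x = ∑ i, ∑ j, x i * (F.Q i j : R) * x j := by simp [eval, homog]
  rw [e2, two_mul]
  nth_rewrite 1 [← e1]
  simp only [QS, dotProduct, Matrix.mulVec, Matrix.map_apply, Matrix.add_apply,
    Matrix.transpose_apply, Int.cast_add, ← Finset.sum_add_distrib, Finset.mul_sum]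
  exact Finset.sum_congr rfl fun i _ => Finset.sum_congr rfl fun j _ => by ring

theorem det_QS_map {R : Type*} [CommRing R] :
    (F.QS.map (Int.cast : ℤ → R)).det = (F.discr : R) :=
  ((Int.castRingHom R).map_det F.QS).symm

/-- Over a field in which `2 Δ_F` is invertible, `F` becomes a diagonal form plus a constant after
an affine change of variables. -/
theorem exists_diagonalization {K : Type*} [Field K] (h2 : (2 : K) ≠ 0) (hF : (F.discr : K) ≠ 0) :
    ∃ (A : Matrix (Fin l) (Fin l) K) (x₀ : Fin l → K) (c : Fin l → K) (κ : K), A.det ≠ 0 ∧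
      (F.discr : K) * A.det ^ 2 = ∏ i, c i ∧ 2 * (F.discr : K) * κ = F.root ∧
      ∀ w, F.eval (x₀ + A.mulVec w) = κ + ∑ i, c i / 2 * w i ^ 2 := by
  have hS : (F.QS.map (Int.cast : ℤ → K)).IsSymm := F.QS_isSymm.map _
  obtain ⟨A, c, hA, hAc⟩ := hS.exists_congr_diagonal h2
  set S := F.QS.map (Int.cast : ℤ → K) with hSdef
  have hdet : IsUnit S.det := by rw [hSdef, det_QS_map]; exact hF.isUnit
  -- The centre of the quadric, Q_S x₀ = −b: the gradient vanishes there, so translating to it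
  -- removes the linear term.
  let x₀ : Fin l → K := S⁻¹.mulVec fun i => -(F.b i : K)
  have hx : ∀ i, F.grad x₀ i = 0 := by
    intro i
    have := congrFun (show S.mulVec x₀ = fun i => -(F.b i : K) by
      simp only [x₀]
      rw [Matrix.mulVec_mulVec, Matrix.mul_nonsing_inv _ hdet, Matrix.one_mulVec]) i
    have h3 : F.grad x₀ i = S.mulVec x₀ i + F.b i := rfl
    rw [h3, this, neg_add_cancel]
  refine ⟨A, x₀, c, F.eval x₀, hA, ?_, F.two_discr_mul_eval hx, fun w => ?_⟩
  · have := congrArg Matrix.det hAc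
    rw [Matrix.det_mul, Matrix.det_mul, Matrix.det_transpose, Matrix.det_diagonal, hSdef,
      det_QS_map] at this
    rw [← this]; ring
  · rw [eval_add]
    simp only [hx, mul_zero, sum_const_zero, add_zero]
    congr 1
    have h3 := F.two_mul_homog_eval (A.mulVec w)
    have h4 : dotProduct (A.mulVec w) (S.mulVec (A.mulVec w)) = ∑ i, c i * w i ^ 2 := by
      have : dotProduct (A.mulVec w) (S.mulVec (A.mulVec w)) =
          dotProduct w ((A.transpose * S * A).mulVec w) := by
        rw [← Matrix.mulVec_mulVec, ← Matrix.mulVec_mulVec, Matrix.dotProduct_mulVec w,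
          Matrix.vecMul_transpose]
      rw [this, hAc]
      simp only [dotProduct, Matrix.mulVec_diagonal]
      exact Finset.sum_congr rfl fun i _ => by ring
    rw [h4] at h3
    have h5 : ∑ i, c i / 2 * w i ^ 2 = (∑ i, c i * w i ^ 2) / 2 := by
      rw [Finset.sum_div]
      exact Finset.sum_congr rfl fun i _ => by ring
    rw [h5, ← h3, mul_div_cancel_left₀ _ h2]

end IntQuadPoly

/-! ### Quadratic Gauss sums and the values S_F(p). -/

section PrimeModulus

open Finset

variable {p : ℕ} [Fact p.Prime]

/-- The quadratic character of `ℤ/p` with complex values. -/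
noncomputable def quadCharC (p : ℕ) [Fact p.Prime] : MulChar (ZMod p) ℂ :=
  (quadraticChar (ZMod p)).ringHomComp (Int.castRingHom ℂ)

theorem quadCharC_apply (a : ZMod p) : quadCharC p a = ((quadraticChar (ZMod p) a : ℤ) : ℂ) := rfl

theorem quadCharC_intCast (a : ℤ) : quadCharC p (a : ZMod p) = (legendreSym p a : ℂ) := rfl

theorem quadCharC_sq {a : ZMod p} (ha : a ≠ 0) : quadCharC p a ^ 2 = 1 := by
  rw [quadCharC_apply]
  exact_mod_cast congrArg (Int.cast : ℤ → ℂ) (quadraticChar_sq_one ha)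

theorem quadCharC_isQuadratic : (quadCharC p).IsQuadratic :=
  MulChar.IsQuadratic.comp (quadraticChar_isQuadratic (ZMod p)) _

theorem quadCharC_ne_one (hp : p ≠ 2) : quadCharC p ≠ 1 := by
  obtain ⟨a, ha⟩ := quadraticChar_exists_neg_one' (F := ZMod p) (by rwa [ZMod.ringChar_zmod_n])
  intro h
  have := congrArg (fun χ : MulChar (ZMod p) ℂ => χ a) h
  simp only [quadCharC_apply, ha, MulChar.one_apply a.isUnit] at this
  norm_num at this

theorem gaussSum_quadCharC_sq (hp : p ≠ 2) :
    gaussSum (quadCharC p) ZMod.stdAddChar ^ 2 = quadCharC p (-1) * p := by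
  have h : (quadCharC p).IsQuadratic := quadCharC_isQuadratic
  exact (gaussSum_sq (χ := quadCharC p) (quadCharC_ne_one hp) h
    (ZMod.isPrimitive_stdAddChar p)).trans (by rw [ZMod.card])

theorem sum_quadCharC_mul (hp : p ≠ 2) (a : ZMod p) :
    ∑ x : ZMod p, quadCharC p x * ZMod.stdAddChar (x * a) =
      quadCharC p a * gaussSum (quadCharC p) ZMod.stdAddChar := by
  by_cases ha : a = 0
  · simp only [ha, mul_zero, AddChar.map_zero_eq_one, mul_one, MulChar.map_zero, zero_mul]
    exact MulChar.sum_eq_zero_of_ne_one (quadCharC_ne_one hp)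
  · have h := gaussSum_mulShift (quadCharC p) ZMod.stdAddChar (Units.mk0 a ha)
    rw [Units.val_mk0] at h
    rw [← h, ← mul_assoc, ← pow_two, quadCharC_sq ha, one_mul]
    simp only [gaussSum, AddChar.mulShift_apply]
    exact Finset.sum_congr rfl fun x _ => by rw [mul_comm x a]

/-- A value y is a square in 1 + χ(y) ways, and the constant 1 contributes a complete additive sum,
which vanishes since a ≠ 0. -/
theorem sum_stdAddChar_mul_sq (hp : p ≠ 2) {a : ZMod p} (ha : a ≠ 0) :
    ∑ x : ZMod p, ZMod.stdAddChar (a * x ^ 2) =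
      quadCharC p a * gaussSum (quadCharC p) ZMod.stdAddChar := by
  rw [← sum_quadCharC_mul hp,
    ← Finset.sum_fiberwise (s := Finset.univ) (g := fun x : ZMod p => x ^ 2)]
  have h0 : ∑ x : ZMod p, ZMod.stdAddChar (x * a) = 0 := by
    rw [AddChar.sum_mulShift _ (ZMod.isPrimitive_stdAddChar p), if_neg ha, Nat.cast_zero]
  rw [← sub_zero (∑ x : ZMod p, quadCharC p x * _), ← neg_zero, ← h0, sub_neg_eq_add,
    ← Finset.sum_add_distrib]
  refine Finset.sum_congr rfl fun y _ => ?_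
  rw [Finset.sum_congr rfl (g := fun _ => ZMod.stdAddChar (y * a))
    (fun x hx => by rw [(Finset.mem_filter.1 hx).2, mul_comm]), Finset.sum_const, nsmul_eq_mul]
  have h1 := quadraticChar_card_sqrts (F := ZMod p) (by rwa [ZMod.ringChar_zmod_n]) y
  have h2 : (#{x : ZMod p | x ^ 2 = y} : ℂ) = quadCharC p y + 1 := by
    rw [quadCharC_apply, ← Int.cast_natCast, ← Int.cast_one, ← Int.cast_add, ← h1]
    congr 3
    ext x; simp
  rw [h2]; ring

end PrimeModulus

namespace IntQuadPoly

variable {l : ℕ} (F : IntQuadPoly l)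

open Finset

theorem mul_gaussSum_prime {p : ℕ} [Fact p.Prime] :
    (p : ℂ) * F.gaussSum p = ∑ a ∈ univ.erase (0 : ZMod p), ∑ x : Fin l → ZMod p,
      ZMod.stdAddChar (a * F.eval x) := by
  have hp0 : (p : ℂ) ≠ 0 := by exact_mod_cast (Fact.out : p.Prime).ne_zero
  rw [gaussSum_eq, mul_inv_cancel_left₀ hp0, Finset.sum_comm]
  refine Finset.sum_congr rfl fun x _ => ?_
  have h1 : ∑ a ∈ univ.erase (0 : ZMod p), ZMod.stdAddChar (a * F.eval x) =
      (if F.eval x = 0 then (p : ℂ) else 0) - 1 := by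
    have := AddChar.sum_mulShift (F.eval x) (ZMod.isPrimitive_stdAddChar p)
    rw [← Finset.add_sum_erase _ _ (mem_univ 0), zero_mul, AddChar.map_zero_eq_one, ZMod.card] at this
    rw [eq_sub_iff_add_eq, add_comm, this]
    split_ifs <;> simp
  have h2 := ramanujanSum_prime_pow (Fact.out : p.Prime) 0 ((F.eval x).val : ℤ)
  simp only [zero_add, pow_one, pow_zero, Nat.cast_one, one_dvd, if_true] at h2
  have h3 := natCast_dvd_val_iff (dvd_refl p) (F.eval x)
  rw [ZMod.castHom_self, RingHom.id_apply] at h3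
  rw [h1, h2]
  simp only [h3]
  push_cast
  rfl

/-- In diagonalising coordinates the sum is a product of l one-dimensional Gauss sums. Their
characters combine to χ(Δ_F) because ∏ c_i = Δ_F det(A)², and the value at the centre is the κ in
the phase. -/
theorem expSum_prime {p : ℕ} [Fact p.Prime] (hp : p ≠ 2) (hF : (F.discr : ZMod p) ≠ 0) :
    ∃ κ : ZMod p, 2 * (F.discr : ZMod p) * κ = F.root ∧ ∀ a : ZMod p, a ≠ 0 →
      ∑ x : Fin l → ZMod p, ZMod.stdAddChar (a * F.eval x) =
        ZMod.stdAddChar (a * κ) * (quadCharC p (2 * a) ^ l * quadCharC p F.discr *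
          _root_.gaussSum (quadCharC p) ZMod.stdAddChar ^ l) := by
  have h2 : (2 : ZMod p) ≠ 0 := by
    intro h
    have : ((2 : ℕ) : ZMod p) = 0 := by exact_mod_cast h
    rw [ZMod.natCast_eq_zero_iff] at this
    exact hp ((Nat.prime_dvd_prime_iff_eq Fact.out Nat.prime_two).1 this)
  obtain ⟨A, x₀, c, κ, hA, hdet, hκ, hw⟩ := F.exists_diagonalization h2 hF
  refine ⟨κ, hκ, fun a ha => ?_⟩
  have hc : ∀ i, c i ≠ 0 := fun i => by
    have : ∏ i, c i ≠ 0 := by rw [← hdet]; exact mul_ne_zero hF (pow_ne_zero _ hA)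
    exact Finset.prod_ne_zero_iff.1 this i (mem_univ i)
  have hbij : Function.Bijective fun w : Fin l → ZMod p => x₀ + A.mulVec w := by
    have : Function.Injective A.mulVec :=
      Matrix.mulVec_injective_iff_isUnit.2 ((Matrix.isUnit_iff_isUnit_det _).2 hA.isUnit)
    exact Finite.injective_iff_bijective.1 ((add_right_injective x₀).comp this)
  rw [← hbij.sum_comp]
  simp only [hw, mul_add, AddChar.map_add_eq_mul, Finset.mul_sum, AddChar.map_finsetSum]
  rw [← Finset.mul_sum, ← Fintype.prod_sum fun i (z : ZMod p) =>
    ZMod.stdAddChar (a * (c i / 2 * z ^ 2))]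
  congr 1
  have h3 : ∀ i, ∑ z : ZMod p, ZMod.stdAddChar (a * (c i / 2 * z ^ 2)) =
      quadCharC p (2 * a) * quadCharC p (c i) * _root_.gaussSum (quadCharC p) ZMod.stdAddChar := by
    intro i
    have h4 := sum_stdAddChar_mul_sq hp (a := a * (c i / 2))
      (mul_ne_zero ha (div_ne_zero (hc i) h2))
    simp only [← mul_assoc] at h4 ⊢
    rw [h4]
    congr 1
    have h5 : 2 * a * c i = a * (c i / 2) * 2 ^ 2 := by field_simp
    rw [← map_mul, h5, map_mul _ _ ((2 : ZMod p) ^ 2), map_pow, quadCharC_sq h2, mul_one]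
  have h6 : ∏ i, quadCharC p (c i) = quadCharC p F.discr := by
    rw [← map_prod, ← hdet, map_mul, map_pow, quadCharC_sq hA, mul_one]
  simp only [h3]
  rw [Finset.prod_mul_distrib, Finset.prod_mul_distrib, h6]
  simp

/-- For odd l, χ(2a)^l = χ(2a), so the sum over a is one more Gauss sum, evaluated at κ. Then χ(2
Δ_F κ) = χ(R_F) and g^(l+1) = (χ(−1) p)^((l+1)/2) together form the symbol of O_F. -/
theorem gaussSum_prime_of_odd {p : ℕ} [Fact p.Prime] (hp : p ≠ 2) (hF : ¬ (p : ℤ) ∣ F.discr)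
    (hl : ¬ Even l) : (p : ℂ) * F.gaussSum p = legendreSym p F.root₂ * (p : ℂ) ^ ((l + 1) / 2) := by
  rw [← ZMod.intCast_zmod_eq_zero_iff_dvd] at hF
  obtain ⟨κ, hκ, hsum⟩ := F.expSum_prime hp hF
  obtain ⟨m, hm⟩ := Nat.not_even_iff_odd.1 hl
  rw [mul_gaussSum_prime, Finset.sum_congr rfl fun a ha => hsum a (Finset.ne_of_mem_erase ha)]
  have h2 : (2 : ZMod p) ≠ 0 := by
    intro h
    have : ((2 : ℕ) : ZMod p) = 0 := by exact_mod_cast h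
    rw [ZMod.natCast_eq_zero_iff] at this
    exact hp ((Nat.prime_dvd_prime_iff_eq Fact.out Nat.prime_two).1 this)
  set g := _root_.gaussSum (quadCharC p) ZMod.stdAddChar with hg
  have h3 : ∀ a ∈ univ.erase (0 : ZMod p), ZMod.stdAddChar (a * κ) *
      (quadCharC p (2 * a) ^ l * quadCharC p F.discr * g ^ l) =
      (quadCharC p 2 * quadCharC p F.discr * g ^ l) * (quadCharC p a * ZMod.stdAddChar (a * κ)) := by
    intro a ha
    have : quadCharC p (2 * a) ^ l = quadCharC p (2 * a) := by
      rw [hm, pow_succ, pow_mul, quadCharC_sq (mul_ne_zero h2 (Finset.ne_of_mem_erase ha)), one_pow,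
        one_mul]
    rw [this, map_mul (quadCharC p)]; ring
  rw [Finset.sum_congr rfl h3, ← Finset.mul_sum]
  have h4 := sum_quadCharC_mul hp κ
  rw [← Finset.add_sum_erase _ _ (mem_univ 0), MulChar.map_zero, zero_mul, zero_add] at h4
  rw [h4, ← hg]
  have h5 : g ^ l * g = (quadCharC p (-1) * p) ^ ((l + 1) / 2) := by
    rw [← gaussSum_quadCharC_sq hp, ← pow_mul, ← pow_succ]
    congr 1; omega
  have h6 : (F.root₂ : ZMod p) = (-1) ^ ((l + 1) / 2) * (2 * F.discr * κ) := by
    rw [hκ, root₂, if_neg hl]; push_cast; rfl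
  rw [← quadCharC_intCast, h6]
  simp only [map_mul, map_pow]
  calc _ = quadCharC p 2 * quadCharC p F.discr * quadCharC p κ * (g ^ l * g) := by ring
    _ = _ := by rw [h5, mul_pow]; ring

/-- For even l, χ(2a)^l = 1, so the sum over a is an additive sum lacking a = 0: it is p − 1 or −1
according to whether κ = 0, that is, p ∣ R_F. -/
theorem gaussSum_prime_of_even {p : ℕ} [Fact p.Prime] (hp : p ≠ 2) (hF : ¬ (p : ℤ) ∣ F.discr)
    (hl : Even l) : (p : ℂ) * F.gaussSum p =
      legendreSym p F.discr₂ * (p : ℂ) ^ (l / 2) * if (p : ℤ) ∣ F.root then (p : ℂ) - 1 else -1 := by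
  rw [← ZMod.intCast_zmod_eq_zero_iff_dvd] at hF
  obtain ⟨κ, hκ, hsum⟩ := F.expSum_prime hp hF
  obtain ⟨m, hm⟩ := hl.two_dvd
  rw [mul_gaussSum_prime, Finset.sum_congr rfl fun a ha => hsum a (Finset.ne_of_mem_erase ha)]
  have h2 : (2 : ZMod p) ≠ 0 := by
    intro h
    have : ((2 : ℕ) : ZMod p) = 0 := by exact_mod_cast h
    rw [ZMod.natCast_eq_zero_iff] at this
    exact hp ((Nat.prime_dvd_prime_iff_eq Fact.out Nat.prime_two).1 this)
  set g := _root_.gaussSum (quadCharC p) ZMod.stdAddChar with hg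
  have h3 : ∀ a ∈ univ.erase (0 : ZMod p), ZMod.stdAddChar (a * κ) *
      (quadCharC p (2 * a) ^ l * quadCharC p F.discr * g ^ l) =
      (quadCharC p F.discr * g ^ l) * ZMod.stdAddChar (a * κ) := by
    intro a ha
    have : quadCharC p (2 * a) ^ l = 1 := by
      rw [hm, pow_mul, quadCharC_sq (mul_ne_zero h2 (Finset.ne_of_mem_erase ha)), one_pow]
    rw [this]; ring
  rw [Finset.sum_congr rfl h3, ← Finset.mul_sum]
  have h4 := AddChar.sum_mulShift κ (ZMod.isPrimitive_stdAddChar p)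
  rw [← Finset.add_sum_erase _ _ (mem_univ 0), zero_mul, AddChar.map_zero_eq_one, ZMod.card] at h4
  have h5 : g ^ l = (quadCharC p (-1) * p) ^ (l / 2) := by
    rw [← gaussSum_quadCharC_sq hp, ← pow_mul]
    congr 1; omega
  have h6 : (F.discr₂ : ZMod p) = (-1) ^ (l / 2) * F.discr := by
    rw [discr₂, if_pos hl]; push_cast; rfl
  have h7 : (p : ℤ) ∣ F.root ↔ κ = 0 := by
    rw [← ZMod.intCast_zmod_eq_zero_iff_dvd, ← hκ]
    simp [h2, hF]
  have h8 : ∑ a ∈ univ.erase (0 : ZMod p), ZMod.stdAddChar (a * κ) =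
      if (p : ℤ) ∣ F.root then (p : ℂ) - 1 else -1 := by
    rw [if_congr h7 rfl rfl, eq_sub_of_add_eq' h4]
    split_ifs <;> simp
  rw [h8, ← quadCharC_intCast, h6, h5]
  simp only [map_mul, map_pow]
  rw [mul_pow]; ring

end IntQuadPoly

/-! ### S_F at higher powers of good primes. -/

namespace IntQuadPoly

variable {l : ℕ} (F : IntQuadPoly l)

open Finset

theorem homog_grad {R : Type*} [CommRing R] (x : Fin l → R) (i : Fin l) :
    F.homog.grad x i = ∑ j, (F.QS i j : R) * x j := by
  simp [grad, homog, QS]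

/-- Only residues that are critical modulo `p` contribute to `S_F(p^m)` when `m ≥ 2`. -/
theorem sum_ramanujanSum_prime_pow_critical {p m : ℕ} (hm : 1 ≤ m)
    [NeZero (p ^ (m + 1))] :
    ∑ x : Fin l → ZMod (p ^ (m + 1)), (ramanujanSum (p ^ (m + 1)) ((F.eval x).val : ℤ) : ℂ) =
      ∑ x : Fin l → ZMod (p ^ (m + 1)), if ∀ i, (p : ZMod (p ^ (m + 1))) ^ m * F.grad x i = 0 then
        (ramanujanSum (p ^ (m + 1)) ((F.eval x).val : ℤ) : ℂ) else 0 := by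
  set n := p ^ (m + 1) with hn
  have hn0 : ((n : ℂ) ^ l) ≠ 0 := pow_ne_zero _ (by exact_mod_cast (NeZero.ne n))
  simp only [ramanujanSum_eq_sum_stdAddChar, ← Finset.sum_filter]
  conv_lhs => rw [Finset.sum_comm]
  conv_rhs => rw [Finset.sum_comm]
  refine Finset.sum_congr rfl fun a ha => ?_
  have hau : IsUnit (a : ZMod n) := (ZMod.isUnit_iff_coprime a n).2 (mem_filter.1 ha).2
  have hpow : (p : ZMod n) ^ (2 * m) = 0 := by
    have : ((p ^ (2 * m) : ℕ) : ZMod n) = 0 := by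
      rw [ZMod.natCast_eq_zero_iff, hn]
      exact pow_dvd_pow p (by omega)
    exact_mod_cast this
  -- Translate x by p^m w. The quadratic part of the increment carries p^(2m), which is 0 modulo
  -- p^(m+1) because m ≥ 1. What is left is a character in w, and averaging over w removes every x
  -- with p^m times the gradient nonzero.
  have h1 : ∀ w : Fin l → ZMod n, ∑ x, ZMod.stdAddChar ((a : ZMod n) * F.eval x) =
      ∑ x, ZMod.stdAddChar ((a : ZMod n) * F.eval x) *
        ZMod.stdAddChar (∑ i, w i * ((a : ZMod n) * ((p : ZMod n) ^ m * F.grad x i))) := by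
    intro w
    rw [← Fintype.sum_equiv (Equiv.addRight fun i => (p : ZMod n) ^ m * w i)
      (fun x => ZMod.stdAddChar ((a : ZMod n) * F.eval (x + fun i => (p : ZMod n) ^ m * w i))) _
      (fun x => rfl)]
    refine Finset.sum_congr rfl fun x _ => ?_
    rw [← AddChar.map_add_eq_mul, eval_add, homog_smul, ← pow_mul, mul_comm m 2, hpow, zero_mul,
      add_zero, mul_add, Finset.mul_sum]
    congr 2
    exact Finset.sum_congr rfl fun i _ => by ring
  have h2 : (n : ℂ) ^ l * ∑ x, ZMod.stdAddChar ((a : ZMod n) * F.eval x) =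
      ∑ w : Fin l → ZMod n, ∑ x, ZMod.stdAddChar ((a : ZMod n) * F.eval x) *
        ZMod.stdAddChar (∑ i, w i * ((a : ZMod n) * ((p : ZMod n) ^ m * F.grad x i))) := by
    rw [← Finset.sum_congr rfl fun w _ => h1 w]
    simp
  rw [Finset.sum_comm] at h2
  simp only [← Finset.mul_sum, sum_stdAddChar_linear, hau.mul_right_eq_zero] at h2
  apply mul_left_cancel₀ hn0
  rw [h2, Finset.sum_filter, Finset.mul_sum]
  refine Finset.sum_congr rfl fun x _ => ?_
  split_ifs <;> ring

/-- A contributing x is critical modulo p, and there 2 Δ_F F(x) ≡ R_F is nonzero, so p ∤ F(x). As m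
≥ 2, both divisibility conditions in c_{p^m} then fail. -/
theorem gaussSum_prime_pow_eq_zero {p : ℕ} (hp : p.Prime) (hR : ¬ (p : ℤ) ∣ F.root) {m : ℕ}
    (hm : 2 ≤ m) : F.gaussSum (p ^ m) = 0 := by
  obtain ⟨m, rfl⟩ : ∃ k, m = k + 1 := ⟨m - 1, by omega⟩
  have : NeZero p := ⟨hp.ne_zero⟩
  rw [gaussSum_eq, F.sum_ramanujanSum_prime_pow_critical (by omega), Finset.sum_eq_zero, mul_zero]
  intro x _
  split_ifs with hx
  swap; · rfl
  rw [ramanujanSum_prime_pow hp]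
  have hdvd : p ∣ p ^ (m + 1) := dvd_pow_self p (by omega)
  have hg : ∀ i, F.grad (fun i => ZMod.castHom hdvd (ZMod p) (x i)) i = 0 := by
    intro i
    rw [← map_grad]
    have h1 := hx i
    have h2 : ((p : ZMod (p ^ (m + 1))) ^ m * F.grad x i) =
        ((p ^ m * (F.grad x i).val : ℕ) : ZMod (p ^ (m + 1))) := by
      push_cast; rw [ZMod.natCast_zmod_val]
    rw [h2, ZMod.natCast_eq_zero_iff] at h1
    have h3 := Nat.dvd_of_mul_dvd_mul_left (pow_pos hp.pos m) ((pow_succ p m).symm.dvd.trans h1)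
    rw [← natCast_dvd_val_iff]
    exact_mod_cast h3
  have h4 : ¬ ((p : ℕ) : ℤ) ∣ ((F.eval x).val : ℤ) := by
    rw [natCast_dvd_val_iff hdvd, map_eval]
    intro h5
    have h6 := F.two_discr_mul_eval hg
    rw [h5, mul_zero, eq_comm, ZMod.intCast_zmod_eq_zero_iff_dvd] at h6
    exact hR h6
  have h7 : ∀ k, 1 ≤ k → ¬ ((p ^ k : ℕ) : ℤ) ∣ ((F.eval x).val : ℤ) := fun k hk h =>
    h4 ((Int.natCast_dvd_natCast.2 (dvd_pow_self p (by omega))).trans h)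
  rw [if_neg (h7 _ (by omega)), if_neg (h7 _ (by omega))]
  simp

theorem isUnit_of_not_dvd {p : ℕ} (hp : p.Prime) {d : ℤ} (hd : ¬ (p : ℤ) ∣ d) (n : ℕ) :
    IsUnit (d : ZMod (p ^ n)) := by
  have h : IsCoprime d ((p ^ n : ℕ) : ℤ) := by
    push_cast
    exact (((Nat.prime_iff_prime_int.1 hp).coprime_iff_not_dvd.2 hd).symm).pow_right
  obtain ⟨a, b, hab⟩ := h
  refine IsUnit.of_mul_eq_one ((a : ZMod (p ^ n))) ?_
  have := congrArg (Int.cast : ℤ → ZMod (p ^ n)) hab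
  push_cast at this
  have h0 : (p : ZMod (p ^ n)) ^ n = 0 := by exact_mod_cast ZMod.natCast_self (p ^ n)
  rw [h0, mul_zero, add_zero] at this
  rw [mul_comm]; exact this

theorem not_dvd_of_not_dvd_two_mul {p : ℕ} {d : ℤ} (h : ¬ (p : ℤ) ∣ 2 * d) :
    ¬ (p : ℤ) ∣ d ∧ ¬ (p : ℤ) ∣ 2 :=
  ⟨fun h' => h (h'.mul_left 2), fun h' => h (h'.mul_right d)⟩

/-- When `R_F = 0`, completing the square removes the linear and the constant part of `F` modulo
powers of primes not dividing `2 Δ_F`. -/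
theorem exists_forall_eval_add_eq (hR : F.root = 0) {p : ℕ} (hp : p.Prime)
    (hd : ¬ (p : ℤ) ∣ 2 * F.discr) (n : ℕ) :
    ∃ x₀ : Fin l → ZMod (p ^ n), ∀ y, F.eval (x₀ + y) = F.homog.eval y := by
  have hu := isUnit_of_not_dvd hp (not_dvd_of_not_dvd_two_mul hd).1 n
  have hu2 := isUnit_of_not_dvd hp hd n
  set S := F.QS.map (Int.cast : ℤ → ZMod (p ^ n)) with hSdef
  have hdet : IsUnit S.det := by rw [hSdef, det_QS_map]; exact hu
  let x₀ : Fin l → ZMod (p ^ n) := S⁻¹.mulVec fun i => -(F.b i : ZMod (p ^ n))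
  have hx : ∀ i, F.grad x₀ i = 0 := by
    intro i
    have := congrFun (show S.mulVec x₀ = fun i => -(F.b i : ZMod (p ^ n)) by
      simp only [x₀]
      rw [Matrix.mulVec_mulVec, Matrix.mul_nonsing_inv _ hdet, Matrix.one_mulVec]) i
    have h3 : F.grad x₀ i = S.mulVec x₀ i + F.b i := rfl
    rw [h3, this, neg_add_cancel]
  have h0 : F.eval x₀ = 0 := by
    have := F.two_discr_mul_eval hx
    rw [hR, Int.cast_zero] at this
    push_cast at hu2
    exact hu2.mul_right_eq_zero.1 this
  exact ⟨x₀, fun y => by rw [eval_add, h0]; simp [hx]⟩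

theorem gaussSum_homog_prime_pow (hR : F.root = 0) {p : ℕ} (hp : p.Prime)
    (hd : ¬ (p : ℤ) ∣ 2 * F.discr) (n : ℕ) :
    F.gaussSum (p ^ n) = F.homog.gaussSum (p ^ n) := by
  have : NeZero p := ⟨hp.ne_zero⟩
  obtain ⟨x₀, hx₀⟩ := F.exists_forall_eval_add_eq hR hp hd n
  rw [gaussSum_eq, gaussSum_eq]
  congr 1
  exact (Fintype.sum_equiv (Equiv.addLeft x₀) _ _ fun y => by simp [hx₀]).symm

/-- Reduction of the critical sum of a homogeneous form modulo `p^(m+1)` to a sum modulo `p^m`. -/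
theorem homog_sum_ramanujanSum_prime_pow {p : ℕ} (hp : p.Prime) (hd : ¬ (p : ℤ) ∣ 2 * F.discr)
    {m : ℕ} (hm : 1 ≤ m) [NeZero p] :
    ∑ x : Fin l → ZMod (p ^ (m + 1)), (ramanujanSum (p ^ (m + 1)) ((F.homog.eval x).val : ℤ) : ℂ) =
      ∑ w : Fin l → ZMod (p ^ m), (ramanujanSum (p ^ (m + 1))
        ((p : ℤ) ^ 2 * F.homog.eval fun i => ((w i).val : ℤ)) : ℂ) := by
  rw [F.homog.sum_ramanujanSum_prime_pow_critical hm, ← Finset.sum_filter]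
  symm
  have hu := isUnit_of_not_dvd hp (not_dvd_of_not_dvd_two_mul hd).1 (m + 1)
  -- As Δ_F is a unit, p^m Q_S x = 0 forces p ∣ x_i for every i. The critical points are thus
  -- exactly x = p w with w modulo p^m, and homogeneity extracts p².
  refine Finset.sum_bij (fun w _ i => (((p : ℤ) * ((w i).val : ℤ) : ℤ) : ZMod (p ^ (m + 1)))) ?_ ?_ ?_ ?_
  · intro w _
    have h0 : (p : ZMod (p ^ (m + 1))) ^ m * p = 0 := by
      rw [← pow_succ]; exact_mod_cast ZMod.natCast_self (p ^ (m + 1))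
    simp only [mem_filter, mem_univ, true_and, homog_grad]
    intro i
    rw [Finset.mul_sum]
    refine Finset.sum_eq_zero fun j _ => ?_
    push_cast
    linear_combination ((F.QS i j : ZMod (p ^ (m + 1))) *
      ((w j).val : ZMod (p ^ (m + 1)))) * h0
  · intro v _ w _ h
    funext i
    have h1 := congrFun h i
    rw [ZMod.intCast_eq_intCast_iff_dvd_sub, ← mul_sub] at h1
    push_cast at h1
    rw [pow_succ'] at h1
    have h2 := Int.dvd_of_mul_dvd_mul_left (by exact_mod_cast hp.ne_zero) h1
    have h3 := ZMod.val_lt (v i)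
    have h4 := ZMod.val_lt (w i)
    have h5 := Int.eq_zero_of_abs_lt_dvd h2 (by
      have h3' : ((v i).val : ℤ) < (p : ℤ) ^ m := by exact_mod_cast h3
      have h4' : ((w i).val : ℤ) < (p : ℤ) ^ m := by exact_mod_cast h4
      rw [abs_lt]; constructor <;> linarith [Int.natCast_nonneg (v i).val, Int.natCast_nonneg (w i).val])
    have h6 : (v i).val = (w i).val := by omega
    exact ZMod.val_injective _ h6
  · intro x hx
    simp only [mem_filter, mem_univ, true_and] at hx
    have h1 : ∀ i, (p : ZMod (p ^ (m + 1))) ^ m * x i = 0 := by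
      have h2 : (F.QS.map (Int.cast : ℤ → ZMod (p ^ (m + 1)))).mulVec
          (fun i => (p : ZMod (p ^ (m + 1))) ^ m * x i) = 0 := by
        ext i
        have := hx i
        simp only [homog_grad, Finset.mul_sum] at this
        simp only [Matrix.mulVec, dotProduct, Matrix.map_apply, Pi.zero_apply]
        rw [← this]
        exact Finset.sum_congr rfl fun j _ => by ring
      have h3 := congrArg (F.QS.map (Int.cast : ℤ → ZMod (p ^ (m + 1)))).adjugate.mulVec h2
      rw [Matrix.mulVec_mulVec, Matrix.adjugate_mul, Matrix.smul_mulVec, Matrix.one_mulVec,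
        Matrix.mulVec_zero, det_QS_map] at h3
      intro i
      exact hu.mul_right_eq_zero.1 (congrFun h3 i)
    have h4 : ∀ i, p ∣ (x i).val := by
      intro i
      have h2 : ((p : ZMod (p ^ (m + 1))) ^ m * x i) =
          ((p ^ m * (x i).val : ℕ) : ZMod (p ^ (m + 1))) := by
        push_cast; rw [ZMod.natCast_zmod_val]
      have h1 := h1 i
      rw [h2, ZMod.natCast_eq_zero_iff] at h1
      exact Nat.dvd_of_mul_dvd_mul_left (pow_pos hp.pos m) ((pow_succ p m).symm.dvd.trans h1)
    choose y hy using h4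
    refine ⟨fun i => (y i : ZMod (p ^ m)), mem_univ _, ?_⟩
    ext i
    have h5 : y i < p ^ m := by
      have := ZMod.val_lt (x i)
      rw [hy i, pow_succ'] at this
      exact Nat.lt_of_mul_lt_mul_left this
    simp only
    rw [ZMod.val_natCast_of_lt h5]
    have : x i = ((p * y i : ℕ) : ZMod (p ^ (m + 1))) := by rw [← hy i, ZMod.natCast_zmod_val]
    rw [this]; push_cast; rfl
  · intro w _
    rw [eval_intCast, homog_smul, ramanujanSum_zmod]

/-- At each of the p^l critical points the form is divisible by p², so every term equals c_{p²}(0) =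
p² − p. -/
theorem gaussSum_homog_prime_sq {p : ℕ} (hp : p.Prime) (hd : ¬ (p : ℤ) ∣ 2 * F.discr) :
    F.homog.gaussSum (p ^ 2) = (p : ℂ) ^ l * (1 - (p : ℂ)⁻¹) := by
  have : NeZero p := ⟨hp.ne_zero⟩
  have hp0 : (p : ℂ) ≠ 0 := by exact_mod_cast hp.ne_zero
  rw [gaussSum_eq, F.homog_sum_ramanujanSum_prime_pow hp hd le_rfl]
  simp only [ramanujanSum_prime_pow hp]
  have h1 : ∀ n : ℤ, ((p ^ (1 + 1) : ℕ) : ℤ) ∣ (p : ℤ) ^ 2 * n := fun n =>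
    ⟨n, by push_cast; ring⟩
  have h2 : ∀ n : ℤ, ((p ^ 1 : ℕ) : ℤ) ∣ (p : ℤ) ^ 2 * n := fun n =>
    ⟨p * n, by push_cast; ring⟩
  simp only [h1, h2, if_true, Finset.sum_const, Finset.card_univ, Fintype.card_fun, ZMod.card,
    Fintype.card_fin, nsmul_eq_mul]
  push_cast
  field_simp

/-- The reason is c_{p^(m+2)}(p² n) = p² c_{p^m}(n). The factor p² is absorbed by the normalisation
q⁻¹, and the p^l lifts of w from p^m to p^(m+1) remain. -/
theorem gaussSum_homog_prime_pow_add_two {p : ℕ} (hp : p.Prime) (hd : ¬ (p : ℤ) ∣ 2 * F.discr)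
    {m : ℕ} (hm : 1 ≤ m) :
    F.homog.gaussSum (p ^ (m + 2)) = (p : ℂ) ^ l * F.homog.gaussSum (p ^ m) := by
  obtain ⟨m, rfl⟩ : ∃ k, m = k + 1 := ⟨m - 1, by omega⟩
  have : NeZero p := ⟨hp.ne_zero⟩
  have hp0 : (p : ℂ) ≠ 0 := by exact_mod_cast hp.ne_zero
  rw [gaussSum_eq, gaussSum_eq, F.homog_sum_ramanujanSum_prime_pow hp hd (m := m + 2) (by omega)]
  have h1 : ∀ n : ℤ, (ramanujanSum (p ^ (m + 2 + 1)) ((p : ℤ) ^ 2 * n) : ℂ) =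
      (p : ℂ) ^ 2 * ramanujanSum (p ^ (m + 1)) n := by
    intro n
    have h3 : ∀ k, ((p ^ (k + 2) : ℕ) : ℤ) ∣ (p : ℤ) ^ 2 * n ↔ ((p ^ k : ℕ) : ℤ) ∣ n := by
      intro k
      have hp1 : (p : ℤ) ^ 2 ≠ 0 := pow_ne_zero _ (by exact_mod_cast hp.ne_zero)
      push_cast
      rw [pow_add, mul_comm ((p : ℤ) ^ k)]
      exact Int.mul_dvd_mul_iff_left hp1
    rw [ramanujanSum_prime_pow hp, ramanujanSum_prime_pow hp]
    rw [show m + 2 + 1 = (m + 1) + 2 by ring]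
    simp only [h3]
    split_ifs <;> push_cast <;> ring
  simp only [h1]
  have h2 : ∀ w : Fin l → ZMod (p ^ (m + 2)), ramanujanSum (p ^ (m + 1))
      (F.homog.eval fun i => ((w i).val : ℤ)) = ramanujanSum (p ^ (m + 1))
      ((F.homog.eval fun i => ZMod.castHom (pow_dvd_pow p (Nat.le_succ (m + 1))) (ZMod (p ^ (m + 1)))
        (w i)).val : ℤ) := by
    intro w
    rw [← ramanujanSum_zmod, ← eval_intCast]
    congr 4
    ext i
    simp [ZMod.castHom_apply, ZMod.natCast_val]
  simp only [h2]
  rw [← Finset.mul_sum, sum_castHom (pow_dvd_pow p (Nat.le_succ (m + 1)))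
    (fun x => (ramanujanSum (p ^ (m + 1)) ((F.homog.eval x).val : ℤ) : ℂ))]
  have h4 : (((p ^ (m + 2) : ℕ) : ℂ) / ((p ^ (m + 1) : ℕ) : ℂ)) = p := by
    push_cast; field_simp; ring
  rw [h4]
  push_cast
  field_simp
  ring

theorem gaussSum_prime_pow_even (hR : F.root = 0) {p : ℕ} (hp : p.Prime)
    (hd : ¬ (p : ℤ) ∣ 2 * F.discr) (j : ℕ) :
    F.gaussSum (p ^ (2 * (j + 1))) = ((p : ℂ) ^ l) ^ (j + 1) * (1 - (p : ℂ)⁻¹) := by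
  rw [F.gaussSum_homog_prime_pow hR hp hd]
  induction j with
  | zero => simpa using F.gaussSum_homog_prime_sq hp hd
  | succ j ih =>
    rw [show 2 * (j + 1 + 1) = 2 * (j + 1) + 2 by ring,
      F.gaussSum_homog_prime_pow_add_two hp hd (by omega), ih]
    ring

theorem gaussSum_prime_pow_odd (hR : F.root = 0) {p : ℕ} (hp : p.Prime)
    (hd : ¬ (p : ℤ) ∣ 2 * F.discr) (j : ℕ) :
    F.gaussSum (p ^ (2 * j + 1)) = ((p : ℂ) ^ l) ^ j * F.gaussSum p := by
  have h1 := F.gaussSum_homog_prime_pow hR hp hd 1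
  rw [pow_one] at h1
  rw [F.gaussSum_homog_prime_pow hR hp hd, h1]
  induction j with
  | zero => simp
  | succ j ih =>
    rw [show 2 * (j + 1) + 1 = 2 * j + 1 + 2 by ring,
      F.gaussSum_homog_prime_pow_add_two hp hd (by omega), ih]
    ring

end IntQuadPoly

/-! ### Absolute convergence and the Euler product of the Dirichlet series. -/

/-- A function that is multiplicative on coprime arguments is absolutely summable as soon as its
values at the positive powers of primes are. -/
theorem summable_norm_of_multiplicative {f : ℕ → ℂ} (hf₁ : f 1 = 1) (hf₀ : f 0 = 0)
    (hmul : ∀ {m n}, Nat.Coprime m n → f (m * n) = f m * f n)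
    (hloc : ∀ {p : ℕ}, p.Prime → Summable fun m : ℕ => ‖f (p ^ m)‖) {a : ℕ → ℝ} (ha : Summable a)
    (ha0 : ∀ p, 0 ≤ a p) (hle : ∀ {p : ℕ}, p.Prime → ∑' m : ℕ, ‖f (p ^ (m + 1))‖ ≤ a p) :
    Summable fun n => ‖f n‖ := by
  have hf₁' : ‖f 1‖ = 1 := by simp [hf₁]
  have hmul' : ∀ {m n}, Nat.Coprime m n → ‖f (m * n)‖ = ‖f m‖ * ‖f n‖ := fun h => by
    rw [hmul h, norm_mul]
  refine summable_of_sum_range_le (c := Real.exp (∑' p, a p)) (fun _ => norm_nonneg _) fun N => ?_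
  obtain ⟨h1, h2⟩ := EulerProduct.summable_and_hasSum_smoothNumbers_prod_primesBelow_tsum
    (f := fun n => ‖f n‖) hf₁' hmul' (fun hp => by simpa using hloc hp) N
  -- Every positive n < N is N-smooth, so the partial sum is part of the expanded product over
  -- primes below N. Each factor of that product is at most 1 + a p ≤ exp (a p).
  have h3 : ∑ n ∈ Finset.range N, ‖f n‖ ≤ ∏ p ∈ N.primesBelow, ∑' m : ℕ, ‖f (p ^ m)‖ := by
    rw [← h2.tsum_eq]
    have hs : Summable fun m : N.smoothNumbers => ‖f m‖ := h2.summable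
    have h4 : ∑ n ∈ Finset.range N, ‖f n‖ =
        ∑ n ∈ (Finset.range N).filter (· ∈ N.smoothNumbers), ‖f n‖ := by
      rw [Finset.sum_filter]
      refine Finset.sum_congr rfl fun n hn => ?_
      rcases Nat.eq_zero_or_pos n with rfl | hn0
      · simp [hf₀]
      · rw [if_pos (Nat.mem_smoothNumbers_of_lt hn0 (Finset.mem_range.1 hn))]
    rw [h4, ← Finset.sum_subtype_of_mem (fun n => ‖f n‖) (p := (· ∈ N.smoothNumbers))
      (fun x hx => (Finset.mem_filter.1 hx).2)]
    exact hs.sum_le_tsum _ fun _ _ => norm_nonneg _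
  refine h3.trans ?_
  have h5 : ∀ p ∈ N.primesBelow, ∑' m : ℕ, ‖f (p ^ m)‖ ≤ Real.exp (a p) := by
    intro p hp
    have hp' := Nat.prime_of_mem_primesBelow hp
    rw [(hloc hp').tsum_eq_zero_add, pow_zero, hf₁']
    linarith [hle hp', Real.add_one_le_exp (a p)]
  refine (Finset.prod_le_prod (fun p _ => tsum_nonneg fun _ => norm_nonneg _) h5).trans ?_
  rw [← Real.exp_sum]
  exact Real.exp_le_exp.2 (ha.sum_le_tsum _ fun p _ => ha0 p)

namespace IntQuadPoly

variable {l : ℕ} (F : IntQuadPoly l)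

open Finset

theorem natCast_pow_cpow (p m : ℕ) (s : ℂ) : ((p ^ m : ℕ) : ℂ) ^ s = ((p : ℂ) ^ s) ^ m := by
  induction m with
  | zero => simp
  | succ m ih => rw [pow_succ, Nat.cast_mul, Complex.natCast_mul_natCast_cpow, ih, pow_succ]

theorem term_prime_pow {p : ℕ} (hp : p.Prime) (m : ℕ) (s : ℂ) :
    LSeries.term F.gaussSum s (p ^ m) = F.gaussSum (p ^ m) / ((p : ℂ) ^ s) ^ m := by
  rw [LSeries.term_of_ne_zero (pow_ne_zero _ hp.ne_zero), natCast_pow_cpow]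

theorem term_mul (s : ℂ) {m n : ℕ} (h : Nat.Coprime m n) :
    LSeries.term F.gaussSum s (m * n) = LSeries.term F.gaussSum s m * LSeries.term F.gaussSum s n := by
  rcases Nat.eq_zero_or_pos m with rfl | hm
  · simp
  rcases Nat.eq_zero_or_pos n with rfl | hn
  · simp
  rw [LSeries.term_of_ne_zero (by positivity), LSeries.term_of_ne_zero hm.ne',
    LSeries.term_of_ne_zero hn.ne', gaussSum_mul F h, Nat.cast_mul,
    Complex.natCast_mul_natCast_cpow]
  ring

theorem term_one (s : ℂ) : LSeries.term F.gaussSum s 1 = 1 := by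
  rw [LSeries.term_of_ne_zero one_ne_zero, gaussSum_one]; simp

theorem half_lt_of_lt_re (hl : 3 ≤ l) {s : ℂ} (hs : (l : ℝ) - 1 < s.re) : (l : ℝ) / 2 < s.re := by
  have : (3 : ℝ) ≤ l := by exact_mod_cast hl
  linarith

/-- The bound q^(l/2) for S_F(q) makes the terms geometric with ratio p^(l/2 − Re s). This covers
all primes, including those dividing 2 Δ_F R_F. -/
theorem summable_norm_term_prime_pow (hF : F.discr ≠ 0) {s : ℂ} (hs : (l : ℝ) / 2 < s.re)
    {p : ℕ} (hp : p.Prime) : Summable fun m : ℕ => ‖LSeries.term F.gaussSum s (p ^ m)‖ := by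
  have hp0 : (0 : ℝ) < p := by exact_mod_cast hp.pos
  have hr : (p : ℝ) ^ ((l : ℝ) / 2 - s.re) < 1 :=
    Real.rpow_lt_one_of_one_lt_of_neg (by exact_mod_cast hp.one_lt) (by linarith)
  refine Summable.of_nonneg_of_le (fun _ => norm_nonneg _) (fun m => ?_)
    ((summable_geometric_of_lt_one (by positivity) hr).mul_left F.gaussBound)
  rw [term_prime_pow F hp, norm_div, norm_pow, Complex.norm_natCast_cpow_of_pos hp.pos]
  have h := F.norm_gaussSum_le hF (p ^ m)
  rw [div_le_iff₀ (by positivity), mul_assoc, ← mul_pow, ← Real.rpow_add hp0]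
  refine h.trans (le_of_eq ?_)
  push_cast
  rw [sub_add_cancel, ← Real.rpow_natCast_mul hp0.le, mul_comm (m : ℝ), Real.rpow_mul hp0.le,
    Real.rpow_natCast]

/-- The two convergence statements and the closed form for the local factor. -/
theorem localSeries_spec (hl : 3 ≤ l) (hF : F.discr ≠ 0) {s : ℂ} (hs : (l : ℝ) - 1 < s.re)
    {p : ℕ} (hp : p.Prime) :
    Summable (fun m : ℕ => (F.rho (p ^ m) : ℂ) / (p : ℂ) ^ ((m : ℂ) * s)) ∧
    (1 - (p : ℂ) ^ ((l : ℂ) - s - 1)) * F.localSeries p s =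
      ∑' m : ℕ, LSeries.term F.gaussSum s (p ^ m) := by
  have hp0 : (0 : ℝ) < p := by exact_mod_cast hp.pos
  have hpc : (p : ℂ) ≠ 0 := by exact_mod_cast hp.ne_zero
  set Z := (p : ℂ) ^ s with hZ
  have hZ0 : Z ≠ 0 := by rw [hZ, Ne, Complex.cpow_eq_zero_iff]; simp [hpc]
  set w : ℂ := (p : ℂ) ^ ((l : ℂ) - s - 1) with hw
  have hwZ : w = (p : ℂ) ^ ((l : ℤ) - 1) / Z := by
    rw [hw, hZ, show (l : ℂ) - s - 1 = (((l : ℤ) - 1 : ℤ) : ℂ) - s by push_cast; ring,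
      Complex.cpow_sub _ _ hpc, Complex.cpow_intCast]
  have hwn : ‖w‖ < 1 := by
    rw [hw, Complex.norm_natCast_cpow_of_pos hp.pos]
    refine Real.rpow_lt_one_of_one_lt_of_neg (by exact_mod_cast hp.one_lt) ?_
    simp only [Complex.sub_re, Complex.natCast_re, Complex.one_re]; linarith
  have hg := summable_norm_geometric_of_norm_lt_one hwn
  have ht := F.summable_norm_term_prime_pow hF (half_lt_of_lt_re hl hs) hp
  -- Solving the recursion ρ(p^(m+1)) = S_F(p^(m+1)) + p^(l−1) ρ(p^m) presents the ρ-series as the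
  -- Cauchy product of the geometric series in w with the series of S_F(p^m).
  have hr : ∀ m : ℕ, (F.rho (p ^ m) : ℂ) / (p : ℂ) ^ ((m : ℂ) * s) =
      ∑ kl ∈ antidiagonal m, w ^ kl.1 * LSeries.term F.gaussSum s (p ^ kl.2) := by
    intro m
    rw [Complex.cpow_nat_mul, ← hZ]
    induction m with
    | zero =>
      have h1 : F.rho 1 = 1 := by
        rw [rho_eq]; simp [eq_iff_true_of_subsingleton]
      simp [h1, gaussSum_one]
    | succ m ih =>
      rw [Nat.sum_antidiagonal_succ]
      simp only [pow_succ' w, mul_assoc]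
      rw [← Finset.mul_sum, ← ih, term_prime_pow F hp, gaussSum_prime_pow F hp, hwZ, ← hZ]
      field_simp
      ring
  have h1 := summable_norm_sum_mul_antidiagonal_of_summable_norm hg ht
  have h2 := tsum_mul_tsum_eq_tsum_sum_antidiagonal_of_summable_norm hg ht
  constructor
  · rw [summable_congr hr]
    exact h1.of_norm
  · rw [localSeries, tsum_congr hr, ← h2, tsum_geometric_of_norm_lt_one hwn, ← mul_assoc,
      mul_inv_cancel₀, one_mul]
    intro h
    rw [sub_eq_zero] at h
    rw [← h, norm_one] at hwn
    exact lt_irrefl _ hwn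

theorem norm_legendreSym_le_one (p : ℕ) [Fact p.Prime] (a : ℤ) : ‖(legendreSym p a : ℂ)‖ ≤ 1 := by
  have h := quadraticChar_isQuadratic (ZMod p) (a : ZMod p)
  rw [legendreSym]
  rcases h with h | h | h <;> rw [h] <;> simp

/-- The primes at which the shape of the local factor is explicit. -/
def IsGoodPrime (p : ℕ) : Prop :=
  p.Prime ∧ ¬ (p : ℤ) ∣ 2 * F.discr ∧ (F.root = 0 ∨ ¬ (p : ℤ) ∣ F.root)

theorem IsGoodPrime.ne_two {F : IntQuadPoly l} {p : ℕ} (h : F.IsGoodPrime p) : p ≠ 2 := by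
  rintro rfl
  exact (not_dvd_of_not_dvd_two_mul h.2.1).2 (by norm_num)

/-- The general bound p^(l/2) is too weak for l = 3, where it would give convergence only for Re s >
5/2. The exact values at good primes yield p^(l−2), and the sum of p^(l−2−Re s) converges for Re s >
l − 1. -/
theorem norm_gaussSum_prime_le (hl : 3 ≤ l) {p : ℕ} (h : F.IsGoodPrime p) :
    ‖F.gaussSum p‖ ≤ (p : ℝ) ^ (l - 2) := by
  have : Fact p.Prime := ⟨h.1⟩
  have hp1 : (1 : ℝ) ≤ p := by exact_mod_cast h.1.one_lt.le
  have hd := (not_dvd_of_not_dvd_two_mul h.2.1).1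
  have key : ‖(p : ℂ) * F.gaussSum p‖ ≤ (p : ℝ) ^ (l - 1) := by
    by_cases he : Even l
    · rw [F.gaussSum_prime_of_even h.ne_two hd he, norm_mul, norm_mul, norm_pow,
        Complex.norm_natCast]
      have h1 := norm_legendreSym_le_one p F.discr₂
      have h2 : ‖if (p : ℤ) ∣ F.root then (p : ℂ) - 1 else -1‖ ≤ p := by
        split_ifs
        · rw [← Nat.cast_one, ← Nat.cast_sub h.1.one_lt.le, Complex.norm_natCast]
          exact_mod_cast Nat.sub_le _ _
        · simpa using hp1
      calc _ ≤ 1 * (p : ℝ) ^ (l / 2) * p := by gcongr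
        _ = (p : ℝ) ^ (l / 2 + 1) := by ring
        _ ≤ _ := by
          obtain ⟨k, hk⟩ := he
          exact pow_le_pow_right₀ hp1 (by omega)
    · rw [F.gaussSum_prime_of_odd h.ne_two hd he, norm_mul, norm_pow, Complex.norm_natCast]
      have h1 := norm_legendreSym_le_one p F.root₂
      calc _ ≤ 1 * (p : ℝ) ^ ((l + 1) / 2) := by gcongr
        _ ≤ _ := by
          rw [one_mul]
          exact pow_le_pow_right₀ hp1 (by omega)
  rw [norm_mul, Complex.norm_natCast, show l - 1 = (l - 2) + 1 by omega, pow_succ', ] at key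
  exact le_of_mul_le_mul_left key (by linarith)

/-- At good primes the terms of the local series decay geometrically. -/
theorem norm_term_good_le (hl : 3 ≤ l) {s : ℂ} (hs : (l : ℝ) - 1 < s.re)
    {p : ℕ} (h : F.IsGoodPrime p) (j : ℕ) :
    ‖LSeries.term F.gaussSum s (p ^ (2 * j + 1))‖ ≤ (p : ℝ) ^ ((l : ℝ) - 2 - s.re) * (1 / 2) ^ j ∧
    ‖LSeries.term F.gaussSum s (p ^ (2 * (j + 1)))‖ ≤ (p : ℝ) ^ ((l : ℝ) - 2 - s.re) * (1 / 2) ^ j := by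
  have hp := h.1
  have hp0 : (0 : ℝ) < p := by exact_mod_cast hp.pos
  have hp1 : (1 : ℝ) ≤ p := by exact_mod_cast hp.one_lt.le
  have hl' : (3 : ℝ) ≤ l := by exact_mod_cast hl
  have hS : ‖F.gaussSum p‖ / (p : ℝ) ^ s.re ≤ (p : ℝ) ^ ((l : ℝ) - 2 - s.re) := by
    rw [Real.rpow_sub hp0]
    gcongr
    have : (l : ℝ) - 2 = ((l - 2 : ℕ) : ℝ) := by push_cast [Nat.cast_sub (by omega : 2 ≤ l)]; ring
    rw [this, Real.rpow_natCast]
    exact F.norm_gaussSum_prime_le hl h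
  rcases h.2.2 with hR | hR
  -- If R_F = 0, raising the exponent by two multiplies the norm of the term by u = p^(l − 2 Re s),
  -- and 2 Re s − l > l − 2 ≥ 1 gives u ≤ 1/2.
  · set u : ℝ := (p : ℝ) ^ l / ((p : ℝ) ^ s.re) ^ 2 with hu
    have hu1 : u = (p : ℝ) ^ ((l : ℝ) - 2 * s.re) := by
      rw [hu, Real.rpow_sub hp0, Real.rpow_natCast, mul_comm, Real.rpow_mul hp0.le]
      norm_num
    have hu2 : u ≤ 1 / 2 := by
      rw [hu1]
      calc (p : ℝ) ^ ((l : ℝ) - 2 * s.re) ≤ (p : ℝ) ^ (-1 : ℝ) :=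
            Real.rpow_le_rpow_of_exponent_le hp1 (by linarith)
        _ ≤ 1 / 2 := by
            rw [Real.rpow_neg_one, one_div]
            exact inv_anti₀ (by norm_num) (by exact_mod_cast hp.two_le)
    have hu3 : u ≤ (p : ℝ) ^ ((l : ℝ) - 2 - s.re) := by
      rw [hu1]; exact Real.rpow_le_rpow_of_exponent_le hp1 (by linarith)
    have hu0 : 0 ≤ u := by positivity
    constructor
    · rw [term_prime_pow F hp, F.gaussSum_prime_pow_odd hR hp h.2.1, norm_div, norm_mul, norm_pow,
        norm_pow, norm_pow, Complex.norm_natCast, Complex.norm_natCast_cpow_of_pos hp.pos]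
      calc _ = ‖F.gaussSum p‖ / (p : ℝ) ^ s.re * u ^ j := by
            rw [hu, div_pow, pow_succ, pow_mul]; field_simp
        _ ≤ _ := by gcongr
    · rw [term_prime_pow F hp, F.gaussSum_prime_pow_even hR hp h.2.1, norm_div, norm_mul, norm_pow,
        norm_pow, norm_pow, Complex.norm_natCast, Complex.norm_natCast_cpow_of_pos hp.pos]
      have h1 : ‖1 - (p : ℂ)⁻¹‖ ≤ 1 := by
        rw [show (1 : ℂ) - (p : ℂ)⁻¹ = ((1 - (p : ℝ)⁻¹ : ℝ) : ℂ) by push_cast; rfl, Complex.norm_real,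
          Real.norm_eq_abs, abs_le]
        have : (p : ℝ)⁻¹ ≤ 1 := inv_le_one_of_one_le₀ hp1
        have : 0 ≤ (p : ℝ)⁻¹ := by positivity
        constructor <;> linarith
      calc _ = u * u ^ j * ‖1 - (p : ℂ)⁻¹‖ := by
            rw [hu, div_pow, pow_mul, pow_succ, pow_succ]; field_simp
        _ ≤ (p : ℝ) ^ ((l : ℝ) - 2 - s.re) * (1 / 2) ^ j * 1 := by gcongr
        _ = _ := mul_one _
  · have hz : ∀ m, 2 ≤ m → ‖LSeries.term F.gaussSum s (p ^ m)‖ = 0 := fun m hm => by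
      rw [term_prime_pow F hp, F.gaussSum_prime_pow_eq_zero hp hR hm]; simp
    constructor
    · rcases Nat.eq_zero_or_pos j with rfl | hj
      · rw [mul_zero, zero_add, term_prime_pow F hp, pow_one, pow_one, norm_div,
          Complex.norm_natCast_cpow_of_pos hp.pos]
        simpa using hS
      · rw [hz _ (by omega)]; positivity
    · rw [hz _ (by omega)]; positivity

theorem tsum_norm_term_good_le (hl : 3 ≤ l) {s : ℂ} (hs : (l : ℝ) - 1 < s.re)
    {p : ℕ} (h : F.IsGoodPrime p) :
    ∑' m : ℕ, ‖LSeries.term F.gaussSum s (p ^ (m + 1))‖ ≤ 4 * (p : ℝ) ^ ((l : ℝ) - 2 - s.re) := by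
  have hg : HasSum (fun j : ℕ => (p : ℝ) ^ ((l : ℝ) - 2 - s.re) * (1 / 2 : ℝ) ^ j)
      ((p : ℝ) ^ ((l : ℝ) - 2 - s.re) * 2) := hasSum_geometric_two.mul_left _
  have hle2 : ∀ j : ℕ, ‖LSeries.term F.gaussSum s (p ^ (2 * j + 1 + 1))‖ ≤
      (p : ℝ) ^ ((l : ℝ) - 2 - s.re) * (1 / 2) ^ j := fun j => by
    rw [show 2 * j + 1 + 1 = 2 * (j + 1) by ring]
    exact (F.norm_term_good_le hl hs h j).2
  have h1 : Summable fun j : ℕ => ‖LSeries.term F.gaussSum s (p ^ (2 * j + 1))‖ :=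
    Summable.of_nonneg_of_le (fun _ => norm_nonneg _)
      (fun j => (F.norm_term_good_le hl hs h j).1) hg.summable
  have h2 : Summable fun j : ℕ => ‖LSeries.term F.gaussSum s (p ^ (2 * j + 1 + 1))‖ :=
    Summable.of_nonneg_of_le (fun _ => norm_nonneg _) hle2 hg.summable
  rw [← tsum_even_add_odd (f := fun m => ‖LSeries.term F.gaussSum s (p ^ (m + 1))‖) h1 h2]
  have h3 := h1.tsum_le_tsum (fun j => (F.norm_term_good_le hl hs h j).1) hg.summable
  have h4 := h2.tsum_le_tsum hle2 hg.summable
  rw [hg.tsum_eq] at h3 h4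
  linarith

theorem isGoodPrime_of_lt {p : ℕ} (hp : p.Prime) (hF : F.discr ≠ 0)
    (h : (2 * F.discr).natAbs + F.root.natAbs < p) : F.IsGoodPrime p := by
  refine ⟨hp, fun h1 => ?_, ?_⟩
  · have := Nat.le_of_dvd (Int.natAbs_pos.2 (mul_ne_zero two_ne_zero hF)) (Int.natCast_dvd.1 h1)
    omega
  · by_cases hR : F.root = 0
    · exact Or.inl hR
    · refine Or.inr fun h1 => ?_
      have := Nat.le_of_dvd (Int.natAbs_pos.2 hR) (Int.natCast_dvd.1 h1)
      omega

/-- All but finitely many primes are good and contribute at most 4 p^(l−2−Re s), with exponent below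
−1. The remaining ones only need their own local series to converge. -/
theorem summable_norm_term_and_local (hl : 3 ≤ l) (hF : F.discr ≠ 0) {s : ℂ}
    (hs : (l : ℝ) - 1 < s.re) :
    (Summable fun n => ‖LSeries.term F.gaussSum s n‖) ∧
    Summable fun p : Nat.Primes => ∑' m : ℕ, ‖LSeries.term F.gaussSum s ((p : ℕ) ^ (m + 1))‖ := by
  set a : ℕ → ℝ := fun p => if p.Prime then
    ∑' m : ℕ, ‖LSeries.term F.gaussSum s (p ^ (m + 1))‖ else 0 with ha
  have ha0 : ∀ p, 0 ≤ a p := fun p => by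
    rw [ha]; dsimp only
    split_ifs
    · exact tsum_nonneg fun _ => norm_nonneg _
    · exact le_rfl
  have has : Summable a := by
    have hb : Summable fun p : ℕ => 4 * (p : ℝ) ^ ((l : ℝ) - 2 - s.re) :=
      (Real.summable_nat_rpow.2 (by linarith)).mul_left 4
    refine Summable.of_norm_bounded_eventually_nat hb ?_
    filter_upwards [Filter.eventually_gt_atTop ((2 * F.discr).natAbs + F.root.natAbs)] with p hp
    rw [Real.norm_of_nonneg (ha0 p), ha]
    dsimp only
    split_ifs with hpp
    · exact F.tsum_norm_term_good_le hl hs (F.isGoodPrime_of_lt hpp hF hp)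
    · positivity
  refine ⟨summable_norm_of_multiplicative (F.term_one s) (by simp) (F.term_mul s)
    (F.summable_norm_term_prime_pow hF (half_lt_of_lt_re hl hs)) has ha0
    (fun hp => by rw [ha]; simp [hp]), ?_⟩
  refine (has.comp_injective (i := fun p : Nat.Primes => (p : ℕ)) Nat.Primes.coe_nat_injective).congr
    fun p => ?_
  simp [ha, p.2]

theorem lSeriesSummable_gaussSum (hl : 3 ≤ l) (hF : F.discr ≠ 0) {s : ℂ}
    (hs : (l : ℝ) - 1 < s.re) : LSeriesSummable F.gaussSum s :=
  (F.summable_norm_term_and_local hl hF hs).1.of_norm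

theorem hasProd_local (hl : 3 ≤ l) (hF : F.discr ≠ 0) {s : ℂ} (hs : (l : ℝ) - 1 < s.re) :
    HasProd (fun p : Nat.Primes => ∑' m : ℕ, LSeries.term F.gaussSum s ((p : ℕ) ^ m))
      (LSeries F.gaussSum s) :=
  EulerProduct.eulerProduct_hasProd (F.term_one s) (F.term_mul s)
    (F.summable_norm_term_and_local hl hF hs).1 (by simp)

/-- The Dirichlet series of `S_F` does not vanish at `l`. -/
theorem lSeries_gaussSum_ne_zero (hl : 3 ≤ l) (hF : F.discr ≠ 0) : LSeries F.gaussSum l ≠ 0 := by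
  have hs : (l : ℝ) - 1 < ((l : ℕ) : ℂ).re := by simp
  rw [← (F.hasProd_local hl hF hs).tprod_eq]
  have hsplit : ∀ p : Nat.Primes, ∑' m : ℕ, LSeries.term F.gaussSum (l : ℂ) ((p : ℕ) ^ m) =
      1 + ∑' m : ℕ, LSeries.term F.gaussSum (l : ℂ) ((p : ℕ) ^ (m + 1)) := fun p => by
    rw [(F.summable_norm_term_prime_pow hF (half_lt_of_lt_re hl hs) p.2).of_norm.tsum_eq_zero_add,
      pow_zero, term_one]
  simp only [hsplit]
  -- An absolutely convergent product is nonzero once no factor vanishes. At s = l the factor at p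
  -- is 1 − 1/p times the ρ-series, whose terms are nonnegative reals beginning with 1.
  refine tprod_one_add_ne_zero_of_summable (fun p => ?_) ?_
  · rw [← hsplit, ← (F.localSeries_spec hl hF hs p.2).2]
    have hp0 : ((p : ℕ) : ℂ) ≠ 0 := by exact_mod_cast p.2.ne_zero
    refine mul_ne_zero ?_ ?_
    · rw [show (l : ℂ) - l - 1 = -1 by ring, Complex.cpow_neg_one, sub_ne_zero]
      intro h
      have : ((p : ℕ) : ℂ) = 1 := by rw [← inv_inv ((p : ℕ) : ℂ), ← h, inv_one]
      exact p.2.one_lt.ne' (by exact_mod_cast this)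
    · have hterm : ∀ m : ℕ, (F.rho ((p : ℕ) ^ m) : ℂ) / ((p : ℕ) : ℂ) ^ ((m : ℂ) * l) =
          (((F.rho ((p : ℕ) ^ m) : ℝ) / ((p : ℕ) : ℝ) ^ (m * l) : ℝ) : ℂ) := by
        intro m
        rw [← Nat.cast_mul, Complex.cpow_natCast]; push_cast; rfl
      have hsum := (F.localSeries_spec hl hF hs p.2).1
      rw [summable_congr hterm] at hsum
      have hsum' : Summable fun m : ℕ => (F.rho ((p : ℕ) ^ m) : ℝ) / ((p : ℕ) : ℝ) ^ (m * l) := by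
        exact_mod_cast hsum
      rw [localSeries, tsum_congr hterm, ← Complex.ofReal_tsum, Complex.ofReal_ne_zero]
      refine (hsum'.tsum_pos (fun m => by positivity) 0 ?_).ne'
      have h1 : F.rho 1 = 1 := by
        rw [rho_eq]; simp [eq_iff_true_of_subsingleton]
      simp [h1]
  · refine Summable.of_nonneg_of_le (fun _ => norm_nonneg _) (fun p => norm_tsum_le_tsum_norm ?_)
      (F.summable_norm_term_and_local hl hF hs).2
    exact (summable_nat_add_iff
      (f := fun m : ℕ => ‖LSeries.term F.gaussSum (l : ℂ) ((p : ℕ) ^ m)‖) 1).2 (F.summable_norm_term_prime_pow hF (half_lt_of_lt_re hl hs) p.2)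

end IntQuadPoly

/-! ### The explicit Euler factors and L(s, F). -/

namespace IntQuadPoly

variable {l : ℕ} (F : IntQuadPoly l)

open Finset

/-- The parity of l makes one of the two symbols zero, so only one factor is nontrivial. It records
S_F(p) = −(H_F/p) p^(l/2−1) for even l and S_F(p) = (O_F/p) p^((l−1)/2) for odd l. -/
theorem gaussSum_prime_div_eq {p : ℕ} [Fact p.Prime] (h : F.IsGoodPrime p) (hR : F.root ≠ 0) (s : ℂ) :
    1 + F.gaussSum p / (p : ℂ) ^ s =
      (1 + (legendreSym p F.root₂ : ℂ) / (p : ℂ) ^ (s - ((l : ℂ) - 1) / 2)) *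
      (1 - (legendreSym p F.discr₂ : ℂ) / (p : ℂ) ^ (s - ((l : ℂ) - 2) / 2)) := by
  have hp := h.1
  have hpc : (p : ℂ) ≠ 0 := by exact_mod_cast hp.ne_zero
  have hZ0 : (p : ℂ) ^ s ≠ 0 := by rw [Ne, Complex.cpow_eq_zero_iff]; simp [hpc]
  have hd := (not_dvd_of_not_dvd_two_mul h.2.1).1
  have hpR : ¬ (p : ℤ) ∣ F.root := h.2.2.resolve_left hR
  by_cases he : Even l
  · have h1 := F.gaussSum_prime_of_even h.ne_two hd he
    rw [if_neg hpR] at h1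
    obtain ⟨k, hk⟩ := he
    have h2 : F.root₂ = 0 := by rw [root₂, if_pos ⟨k, hk⟩]
    have h3 : s - ((l : ℂ) - 2) / 2 = s - ((k : ℤ) - 1 : ℤ) := by rw [hk]; push_cast; ring
    rw [h2, h3, Complex.cpow_sub s (((k : ℤ) - 1 : ℤ) : ℂ) hpc, Complex.cpow_intCast, zpow_sub₀ hpc, zpow_natCast, zpow_one]
    have h5 : F.gaussSum p = legendreSym p F.discr₂ * (p : ℂ) ^ (l / 2) * -1 / p := by
      rw [← h1, mul_div_cancel_left₀ _ hpc]
    rw [h5, show l / 2 = k by omega]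
    simp only [legendreSym.at_zero, Int.cast_zero, zero_div, add_zero, one_mul]
    field_simp
    ring
  · have h1 := F.gaussSum_prime_of_odd h.ne_two hd he
    obtain ⟨k, hk⟩ := Nat.not_even_iff_odd.1 he
    have h2 : F.discr₂ = 0 := by rw [discr₂, if_neg he]
    have h3 : s - ((l : ℂ) - 1) / 2 = s - (k : ℕ) := by rw [hk]; push_cast; ring
    rw [h2, h3, Complex.cpow_sub s ((k : ℕ) : ℂ) hpc, Complex.cpow_natCast]
    have h5 : F.gaussSum p = legendreSym p F.root₂ * (p : ℂ) ^ ((l + 1) / 2) / p := by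
      rw [← h1, mul_div_cancel_left₀ _ hpc]
    rw [h5, show (l + 1) / 2 = k + 1 by omega]
    simp only [legendreSym.at_zero, Int.cast_zero, zero_div, sub_zero, mul_one]
    field_simp
    ring

theorem gaussSum_prime_div_eq_of_root_eq_zero {p : ℕ} [Fact p.Prime] (h : F.IsGoodPrime p)
    (hR : F.root = 0) (s : ℂ) :
    F.gaussSum p / (p : ℂ) ^ s =
      (legendreSym p F.discr₂ : ℂ) * ((1 - (p : ℂ)⁻¹) * (p : ℂ) ^ ((l : ℂ) / 2 - s)) := by
  have hp := h.1
  have hpc : (p : ℂ) ≠ 0 := by exact_mod_cast hp.ne_zero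
  have hZ0 : (p : ℂ) ^ s ≠ 0 := by rw [Ne, Complex.cpow_eq_zero_iff]; simp [hpc]
  have hd := (not_dvd_of_not_dvd_two_mul h.2.1).1
  by_cases he : Even l
  · have h1 := F.gaussSum_prime_of_even h.ne_two hd he
    rw [if_pos (by rw [hR]; exact dvd_zero _)] at h1
    obtain ⟨k, hk⟩ := he
    have h3 : (l : ℂ) / 2 - s = (k : ℕ) - s := by rw [hk]; push_cast; ring
    have h5 : F.gaussSum p = legendreSym p F.discr₂ * (p : ℂ) ^ (l / 2) * ((p : ℂ) - 1) / p := by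
      rw [← h1, mul_div_cancel_left₀ _ hpc]
    rw [h5, h3, Complex.cpow_sub _ _ hpc, Complex.cpow_natCast, show l / 2 = k by omega]
    field_simp
  · have h1 := F.gaussSum_prime_of_odd h.ne_two hd he
    have h2 : F.discr₂ = 0 := by rw [discr₂, if_neg he]
    have h3 : F.root₂ = 0 := by rw [root₂, if_neg he, hR, mul_zero]
    rw [h3] at h1
    have h4 : F.gaussSum p = 0 := by simpa [hpc] using h1
    rw [h4, h2]; simp

theorem tsum_term_of_root_ne_zero {p : ℕ} (h : F.IsGoodPrime p) (hR : F.root ≠ 0) (s : ℂ) :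
    ∑' m : ℕ, LSeries.term F.gaussSum s (p ^ m) = 1 + F.gaussSum p / (p : ℂ) ^ s := by
  rw [tsum_eq_sum (s := range 2)]
  · rw [sum_range_succ, sum_range_one, pow_zero, term_one, term_prime_pow F h.1, pow_one, pow_one]
  · intro m hm
    rw [term_prime_pow F h.1, F.gaussSum_prime_pow_eq_zero h.1 (h.2.2.resolve_left hR)
      (by rw [mem_range] at hm; omega), zero_div]

/-- Even and odd exponents both form geometric series of ratio u = p^l / p^(2s). The even part, with
its first term 1, sums to (1 − u/p)/(1 − u), which is the Euler factor of the zeta quotient. -/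
theorem tsum_term_of_root_eq_zero {p : ℕ} (h : F.IsGoodPrime p) (hR : F.root = 0) {s : ℂ}
    (hu : ‖(p : ℂ) ^ l / ((p : ℂ) ^ s) ^ 2‖ < 1) :
    ∑' m : ℕ, LSeries.term F.gaussSum s (p ^ m) =
      (1 - (p : ℂ) ^ l / ((p : ℂ) ^ s) ^ 2 / p + F.gaussSum p / (p : ℂ) ^ s) /
        (1 - (p : ℂ) ^ l / ((p : ℂ) ^ s) ^ 2) := by
  have hp := h.1
  have hpc : (p : ℂ) ≠ 0 := by exact_mod_cast hp.ne_zero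
  have hZ0 : (p : ℂ) ^ s ≠ 0 := by rw [Ne, Complex.cpow_eq_zero_iff]; simp [hpc]
  set Z := (p : ℂ) ^ s with hZ
  set u := (p : ℂ) ^ l / Z ^ 2 with hudef
  have hg : HasSum (fun j : ℕ => u ^ j) (1 - u)⁻¹ := hasSum_geometric_of_norm_lt_one hu
  have hu1 : 1 - u ≠ 0 := by
    intro h0
    rw [sub_eq_zero] at h0
    rw [← h0, norm_one] at hu
    exact lt_irrefl _ hu
  have ho : HasSum (fun j : ℕ => LSeries.term F.gaussSum s (p ^ (2 * j + 1)))
      (F.gaussSum p / Z * (1 - u)⁻¹) := by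
    refine (hg.mul_left (F.gaussSum p / Z)).congr_fun fun j => ?_
    rw [term_prime_pow F hp, F.gaussSum_prime_pow_odd hR hp h.2.1, hudef, ← hZ, div_pow, pow_succ,
      pow_mul]
    field_simp
  have he : HasSum (fun j : ℕ => LSeries.term F.gaussSum s (p ^ (2 * j)))
      ((1 - (p : ℂ)⁻¹) * u * (1 - u)⁻¹ + 1) := by
    have h1 : HasSum (fun j : ℕ => LSeries.term F.gaussSum s (p ^ (2 * (j + 1))))
        ((1 - (p : ℂ)⁻¹) * u * (1 - u)⁻¹) := by
      refine (hg.mul_left ((1 - (p : ℂ)⁻¹) * u)).congr_fun fun j => ?_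
      rw [term_prime_pow F hp, F.gaussSum_prime_pow_even hR hp h.2.1, ← hZ, pow_mul Z 2, hudef,
        div_pow, pow_succ, pow_succ]
      field_simp
    rw [← hasSum_nat_add_iff' 1]
    simpa [gaussSum_one] using h1
  rw [(he.even_add_odd (f := fun m => LSeries.term F.gaussSum s (p ^ m)) ho).tsum_eq]
  field_simp
  ring

theorem summable_norm_term_primes (hl : 3 ≤ l) (hF : F.discr ≠ 0) {s : ℂ}
    (hs : (l : ℝ) - 1 < s.re) :
    Summable fun p : Nat.Primes => ‖F.gaussSum p / ((p : ℕ) : ℂ) ^ s‖ := by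
  refine Summable.of_nonneg_of_le (fun _ => norm_nonneg _) (fun p => ?_)
    (F.summable_norm_term_and_local hl hF hs).2
  have h1 := (summable_nat_add_iff
      (f := fun m : ℕ => ‖LSeries.term F.gaussSum s ((p : ℕ) ^ m)‖) 1).2
      (F.summable_norm_term_prime_pow hF (half_lt_of_lt_re hl hs) p.2)
  have h2 := h1.le_tsum 0 fun _ _ => norm_nonneg _
  rw [zero_add, term_prime_pow F p.2, pow_one, pow_one] at h2
  exact h2

theorem isGoodPrime_of_goodPrimes (p : F.GoodPrimes) : F.IsGoodPrime (p : Nat.Primes) :=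
  ⟨p.1.2, fun h => p.2 (h.mul_right _), Or.inr fun h => p.2 (h.mul_left _)⟩

theorem multipliable_eulerFactor₁ (hl : 3 ≤ l) (hF : F.discr ≠ 0) (hR : F.root ≠ 0) {s : ℂ}
    (hs : (l : ℝ) - 1 < s.re) : Multipliable fun p : F.GoodPrimes => F.eulerFactor₁ s p := by
  have h1 : ∀ p : F.GoodPrimes, F.eulerFactor₁ s p =
      1 + F.gaussSum (p : Nat.Primes) / (((p : Nat.Primes) : ℕ) : ℂ) ^ s := fun p => by
    have : Fact ((p : Nat.Primes) : ℕ).Prime := ⟨p.1.2⟩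
    rw [F.gaussSum_prime_div_eq (F.isGoodPrime_of_goodPrimes p) hR]
    rfl
  simp only [h1]
  exact multipliable_one_add_of_summable
    ((F.summable_norm_term_primes hl hF hs).comp_injective Subtype.val_injective)

theorem norm_cpow_lt_one {p : ℕ} (hp : p.Prime) {w : ℂ} (hw : w.re < 0) : ‖(p : ℂ) ^ w‖ < 1 := by
  rw [Complex.norm_natCast_cpow_of_pos hp.pos]
  exact Real.rpow_lt_one_of_one_lt_of_neg (by exact_mod_cast hp.one_lt) hw

theorem norm_cpow_le_half {p : ℕ} (hp : p.Prime) {w : ℂ} (hw : w.re ≤ -1) :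
    ‖(p : ℂ) ^ w‖ ≤ 1 / 2 := by
  have hp1 : (1 : ℝ) ≤ p := by exact_mod_cast hp.one_lt.le
  rw [Complex.norm_natCast_cpow_of_pos hp.pos]
  calc (p : ℝ) ^ w.re ≤ (p : ℝ) ^ (-1 : ℝ) := Real.rpow_le_rpow_of_exponent_le hp1 hw
    _ ≤ 1 / 2 := by
      rw [Real.rpow_neg_one, one_div]
      exact inv_anti₀ (by norm_num) (by exact_mod_cast hp.two_le)

theorem one_sub_ne_zero_of_norm_lt_one {w : ℂ} (hw : ‖w‖ < 1) : 1 - w ≠ 0 := by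
  intro h0
  rw [sub_eq_zero] at h0
  rw [← h0, norm_one] at hw
  exact lt_irrefl _ hw

/-- At an odd prime dividing Δ_F the symbol of H_F vanishes and the Euler factor is 1. The product
may thus run over all odd primes although those primes already occur in f(s, F). -/
theorem isGoodPrime_or_legendreSym_eq_zero (hR : F.root = 0) {p : ℕ} [hp : Fact p.Prime] (h2 : 2 < p) :
    F.IsGoodPrime p ∧ ¬ (p : ℤ) ∣ 2 * F.discr ∨
      (p : ℤ) ∣ 2 * F.discr ∧ legendreSym p F.discr₂ = 0 := by
  by_cases h : (p : ℤ) ∣ 2 * F.discr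
  · refine Or.inr ⟨h, ?_⟩
    have h3 : (p : ℤ) ∣ F.discr := by
      refine ((Nat.prime_iff_prime_int.1 hp.out).dvd_or_dvd h).resolve_left fun h4 => ?_
      have := Int.le_of_dvd (by norm_num) h4
      omega
    rw [legendreSym.eq_zero_iff, ZMod.intCast_zmod_eq_zero_iff_dvd, discr₂]
    split_ifs
    · exact h3.mul_left _
    · exact dvd_zero _
  · exact Or.inl ⟨⟨hp.out, h, Or.inl hR⟩, h⟩

theorem multipliable_eulerFactor₀ (hl : 3 ≤ l) (hF : F.discr ≠ 0) (hR : F.root = 0) {s : ℂ}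
    (hs : (l : ℝ) - 1 < s.re) : Multipliable fun p : OddPrimes => F.eulerFactor₀ s p := by
  have hl' : (3 : ℝ) ≤ l := by exact_mod_cast hl
  have hsum := ((F.summable_norm_term_primes hl hF hs).comp_injective
    (Subtype.val_injective (p := fun p : Nat.Primes => 2 < (p : ℕ)))).mul_left 2
  unfold eulerFactor₀
  refine multipliable_one_add_of_summable (Summable.of_nonneg_of_le (fun _ => norm_nonneg _)
    (fun p => ?_) hsum)
  have : Fact ((p : Nat.Primes) : ℕ).Prime := ⟨p.1.2⟩
  rcases F.isGoodPrime_or_legendreSym_eq_zero hR p.2 with ⟨h, _⟩ | ⟨_, h⟩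
  · have h1 := F.gaussSum_prime_div_eq_of_root_eq_zero h hR s
    rw [← mul_div_assoc, ← h1, norm_div, Function.comp_apply, div_eq_inv_mul]
    gcongr
    -- The denominator 1 − p^(l−2s−1) has modulus at least 1/2; this is the constant 2 in the
    -- comparison series.
    rw [inv_le_comm₀ ?_ two_pos]
    · have h2 := norm_cpow_le_half p.1.2 (w := (l : ℂ) - 2 * s - 1) (by simp; linarith)
      have h3 := norm_sub_norm_le (1 : ℂ) ((((p : Nat.Primes) : ℕ) : ℂ) ^ ((l : ℂ) - 2 * s - 1))
      rw [norm_one] at h3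
      linarith
    · exact norm_pos_iff.2 (one_sub_ne_zero_of_norm_lt_one
        (norm_cpow_lt_one p.1.2 (by simp; linarith)))
  · rw [h]
    simp only [Int.cast_zero, zero_mul, norm_zero, Function.comp_apply]
    positivity

/-- Extending a finite product by 1 to all primes allows the pieces of L(s, F) to be multiplied and
compared prime by prime. -/
theorem hasProd_primeFactors {D : ℕ} (g : ℕ → ℂ) :
    HasProd (fun p : Nat.Primes => if (p : ℕ) ∈ D.primeFactors then g p else 1)
      (∏ p ∈ D.primeFactors, g p) := by
  have h1 : ∏ p ∈ D.primeFactors, g p = ∏ p ∈ D.primeFactors.subtype Nat.Prime,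
      (fun p : Nat.Primes => if (p : ℕ) ∈ D.primeFactors then g p else 1) p := by
    rw [← Finset.prod_subtype_of_mem g (fun x hx => Nat.prime_of_mem_primeFactors hx)]
    refine Finset.prod_congr rfl fun p hp => ?_
    exact (if_pos (Finset.mem_subtype.1 hp)).symm
  rw [h1]
  refine hasProd_prod_of_ne_finset_one fun p hp => if_neg fun h => hp (Finset.mem_subtype.2 h)

/-- An unconditional product has only one value, so it suffices to match local factors at each
prime. If R_F = 0 the zeta quotient contributes (1 − u/p)/(1 − u), u = p^(l−2s), at every prime, and
f(s, F) cancels it at the primes dividing 2 Δ_F. -/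
theorem L_eq_lSeries (hl : 3 ≤ l) (hF : F.discr ≠ 0) {s : ℂ} (hs : (l : ℝ) - 1 < s.re) :
    F.L s = LSeries F.gaussSum s := by
  have hl' : (3 : ℝ) ≤ l := by exact_mod_cast hl
  refine HasProd.unique ?_ (F.hasProd_local hl hF hs)
  by_cases hR : F.root = 0
  · rw [L, if_pos hR]
    have h1 := hasProd_primeFactors (D := (2 * F.discr).natAbs) fun p : ℕ =>
      ((1 - (p : ℂ) ^ ((l : ℂ) - 2 * s)) * (1 - (p : ℂ) ^ ((l : ℂ) - s - 1)) /
      (1 - (p : ℂ) ^ ((l : ℂ) - 2 * s - 1))) * F.localSeries p s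
    have h2 := riemannZeta_eulerProduct_hasProd (s := 2 * s - l) (by simp; linarith)
    have hs3 : 1 < (2 * s + 1 - l).re := by simp; linarith
    have h3 := (riemannZeta_eulerProduct_hasProd hs3).inv₀ (riemannZeta_ne_zero_of_one_lt_re hs3)
    have h4 := (hasProd_subtype_iff_mulIndicator (s := {p : Nat.Primes | 2 < (p : ℕ)})
      (f := F.eulerFactor₀ s)).1 (F.multipliable_eulerFactor₀ hl hF hR hs).hasProd
    have h5 := (h1.mul (h2.mul h3)).mul h4
    rw [fFactor, div_eq_mul_inv (riemannZeta _)]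
    refine h5.congr_fun fun p => ?_
    have hp : Fact (p : ℕ).Prime := ⟨p.2⟩
    have hpc : ((p : ℕ) : ℂ) ≠ 0 := by exact_mod_cast p.2.ne_zero
    have hu2 : 1 - ((p : ℕ) : ℂ) ^ ((l : ℂ) - 2 * s) ≠ 0 :=
      one_sub_ne_zero_of_norm_lt_one (norm_cpow_lt_one p.2 (by simp; linarith))
    have hu3 : 1 - ((p : ℕ) : ℂ) ^ ((l : ℂ) - 2 * s - 1) ≠ 0 :=
      one_sub_ne_zero_of_norm_lt_one (norm_cpow_lt_one p.2 (by simp; linarith))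
    have hmem : (p : ℕ) ∈ (2 * F.discr).natAbs.primeFactors ↔ ((p : ℕ) : ℤ) ∣ 2 * F.discr := by
      rw [Nat.mem_primeFactors, Int.natCast_dvd]
      exact ⟨fun h => h.2.1, fun h => ⟨p.2, h, Int.natAbs_ne_zero.2 (mul_ne_zero two_ne_zero hF)⟩⟩
    rw [show -(2 * s - (l : ℂ)) = l - 2 * s by ring, show -(2 * s + 1 - (l : ℂ)) = l - 2 * s - 1 by ring,
      inv_inv, if_congr hmem rfl rfl]
    by_cases hd : ((p : ℕ) : ℤ) ∣ 2 * F.discr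
    · rw [if_pos hd, ← (F.localSeries_spec hl hF hs p.2).2]
      have he : Set.mulIndicator {p : Nat.Primes | 2 < (p : ℕ)} (F.eulerFactor₀ s) p = 1 := by
        rw [Set.mulIndicator_apply]
        split_ifs with h
        · rcases F.isGoodPrime_or_legendreSym_eq_zero hR (p := p) h with ⟨_, h⟩ | ⟨_, h⟩
          · exact absurd hd h
          · rw [eulerFactor₀, h]; simp
        · rfl
      rw [he, mul_one]
      generalize ((p : ℕ) : ℂ) ^ ((l : ℂ) - 2 * s) = u at hu2
      generalize ((p : ℕ) : ℂ) ^ ((l : ℂ) - 2 * s - 1) = v at hu3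
      field_simp
    · have hg : F.IsGoodPrime p := ⟨p.2, hd, Or.inl hR⟩
      have h2p : 2 < (p : ℕ) := lt_of_le_of_ne p.2.two_le (Ne.symm hg.ne_two)
      have e1 : ((p : ℕ) : ℂ) ^ l / (((p : ℕ) : ℂ) ^ s) ^ 2 = ((p : ℕ) : ℂ) ^ ((l : ℂ) - 2 * s) := by
        rw [Complex.cpow_sub _ _ hpc, Complex.cpow_natCast, ← Complex.cpow_nat_mul]
        norm_num
      have e2 : ((p : ℕ) : ℂ) ^ ((l : ℂ) - 2 * s) / (p : ℕ) =
          ((p : ℕ) : ℂ) ^ ((l : ℂ) - 2 * s - 1) := by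
        rw [Complex.cpow_sub _ 1 hpc, Complex.cpow_one]
      rw [if_neg hd, F.tsum_term_of_root_eq_zero hg hR
        (by rw [e1]; exact norm_cpow_lt_one p.2 (by simp; linarith)), e1, e2,
        Set.mulIndicator_of_mem (show p ∈ {p : Nat.Primes | 2 < (p : ℕ)} from h2p),
        F.gaussSum_prime_div_eq_of_root_eq_zero hg hR, eulerFactor₀]
      field_simp
  · rw [L, if_neg hR]
    have h1 := hasProd_primeFactors (D := (2 * F.discr * F.root).natAbs) fun p : ℕ =>
      (1 - (p : ℂ) ^ ((l : ℂ) - s - 1)) * F.localSeries p s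
    have h4 := (hasProd_subtype_iff_mulIndicator
      (s := {p : Nat.Primes | ¬ ((p : ℕ) : ℤ) ∣ 2 * F.discr * F.root})
      (f := F.eulerFactor₁ s)).1 (F.multipliable_eulerFactor₁ hl hF hR hs).hasProd
    rw [hFactor]
    refine (h1.mul h4).congr_fun fun p => ?_
    have hp : Fact (p : ℕ).Prime := ⟨p.2⟩
    have hmem : (p : ℕ) ∈ (2 * F.discr * F.root).natAbs.primeFactors ↔
        ((p : ℕ) : ℤ) ∣ 2 * F.discr * F.root := by
      rw [Nat.mem_primeFactors, Int.natCast_dvd]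
      exact ⟨fun h => h.2.1, fun h => ⟨p.2, h, Int.natAbs_ne_zero.2
        (mul_ne_zero (mul_ne_zero two_ne_zero hF) hR)⟩⟩
    rw [if_congr hmem rfl rfl]
    by_cases hd : ((p : ℕ) : ℤ) ∣ 2 * F.discr * F.root
    · rw [if_pos hd, Set.mulIndicator_of_notMem (fun h : ¬ _ => h hd), mul_one,
        (F.localSeries_spec hl hF hs p.2).2]
    · have hg := F.isGoodPrime_of_goodPrimes ⟨p, hd⟩
      rw [if_neg hd, one_mul, F.tsum_term_of_root_ne_zero hg hR, F.gaussSum_prime_div_eq hg hR,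
        Set.mulIndicator_of_mem
          (show p ∈ {p : Nat.Primes | ¬ ((p : ℕ) : ℤ) ∣ 2 * F.discr * F.root} from hd)]
      rfl

theorem abscissaOfAbsConv_gaussSum_le (hl : 3 ≤ l) (hF : F.discr ≠ 0) :
    LSeries.abscissaOfAbsConv F.gaussSum ≤ ((l : ℝ) - 1 : ℝ) :=
  LSeries.abscissaOfAbsConv_le_of_forall_lt_LSeriesSummable fun y hy =>
    F.lSeriesSummable_gaussSum hl hF (by simpa using hy)

/-- Near l the explicit product agrees with the Dirichlet series, and l lies inside the half-plane
of absolute convergence, where termwise differentiation is valid. -/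
theorem hasDerivAt_L (hl : 3 ≤ l) (hF : F.discr ≠ 0) :
    HasDerivAt F.L (-LSeries (LSeries.logMul F.gaussSum) l) l := by
  have h0 : LSeries.abscissaOfAbsConv F.gaussSum < ((l : ℂ).re : ℝ) := by
    refine (F.abscissaOfAbsConv_gaussSum_le hl hF).trans_lt ?_
    rw [EReal.coe_lt_coe_iff]; simp
  refine (LSeries_hasDerivAt h0).congr_of_eventuallyEq ?_
  have h1 : {s : ℂ | (l : ℝ) - 1 < s.re} ∈ nhds (l : ℂ) :=
    (isOpen_lt continuous_const Complex.continuous_re).mem_nhds (by simp)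
  filter_upwards [h1] with s hs
  exact F.L_eq_lSeries hl hF hs

theorem L_ne_zero (hl : 3 ≤ l) (hF : F.discr ≠ 0) : F.L l ≠ 0 := by
  rw [F.L_eq_lSeries hl hF (by simp)]
  exact F.lSeries_gaussSum_ne_zero hl hF

end IntQuadPoly

/-! ### The sublevel estimate: integrability of |F|^(−s) for s < 1. -/

open ENNReal in
/-- The integral of `|v - a|^(-s)` over `[-R, R]` is `O(R^(1-s))`, uniformly in `a`. -/
theorem lintegral_enorm_sub_rpow_le {s : ℝ} (hs0 : 0 < s) (hs1 : s < 1) {R : ℝ} (hR : 0 < R)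
    (a : ℝ) :
    ∫⁻ z in Set.Icc (-R) R, ‖z - a‖ₑ ^ (-s) ≤
      ENNReal.ofReal (2 + 2 / (1 - s)) * ENNReal.ofReal R ^ (1 - s) := by
  have hR0 : ENNReal.ofReal R ≠ 0 := by simpa using hR
  have hs : 0 < 1 - s := by linarith
  have half : ∫⁻ v in Set.Icc 0 R, ‖v‖ₑ ^ (-s) =
      ENNReal.ofReal (1 / (1 - s)) * ENNReal.ofReal R ^ (1 - s) := by
    rw [ENNReal.ofReal_rpow_of_pos hR, ← ENNReal.ofReal_mul (by positivity)]
    have h1 : ∫ v in (0 : ℝ)..R, v ^ (-s) = 1 / (1 - s) * R ^ (1 - s) := by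
      rw [integral_rpow (Or.inl (by linarith)), Real.zero_rpow (by linarith)]
      rw [show -s + 1 = 1 - s by ring]
      ring
    have h2 := intervalIntegral.intervalIntegrable_rpow' (a := 0) (b := R) (r := -s) (by linarith)
    rw [← h1, intervalIntegral.integral_of_le hR.le, ofReal_integral_eq_lintegral_ofReal h2.1
      ((ae_restrict_iff' measurableSet_Ioc).2 (ae_of_all _ fun v hv => Real.rpow_nonneg hv.1.le _)),
      setLIntegral_congr Ioc_ae_eq_Icc.symm]
    refine setLIntegral_congr_fun measurableSet_Ioc fun v hv => ?_
    rw [← ENNReal.ofReal_rpow_of_pos hv.1, Real.enorm_eq_ofReal hv.1.le]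
  have full : ∫⁻ v in Set.Icc (-R) R, ‖v‖ₑ ^ (-s) ≤
      ENNReal.ofReal (2 / (1 - s)) * ENNReal.ofReal R ^ (1 - s) := by
    have hneg : ∫⁻ v in Set.Icc (-R) 0, ‖v‖ₑ ^ (-s) = ∫⁻ v in Set.Icc 0 R, ‖v‖ₑ ^ (-s) := by
      rw [← (Measure.measurePreserving_neg (volume : Measure ℝ)).setLIntegral_comp_preimage_emb
        (Homeomorph.neg ℝ).measurableEmbedding _ (Set.Icc 0 R)]
      simp [enorm_neg]
    calc ∫⁻ v in Set.Icc (-R) R, ‖v‖ₑ ^ (-s)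
        ≤ ∫⁻ v in Set.Icc (-R) 0 ∪ Set.Icc 0 R, ‖v‖ₑ ^ (-s) := by
          rw [Set.Icc_union_Icc_eq_Icc (by linarith) hR.le]
      _ ≤ _ := lintegral_union_le _ _ _
      _ = _ := by
          rw [hneg, half, ← two_mul, ← mul_assoc, ← ENNReal.ofReal_ofNat,
            ← ENNReal.ofReal_mul (by norm_num)]
          congr 2
          ring
  calc ∫⁻ z in Set.Icc (-R) R, ‖z - a‖ₑ ^ (-s)
      ≤ ∫⁻ z in Set.Icc (-R) R, (ENNReal.ofReal R ^ (-s) +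
          (Set.Icc (-R) R).indicator (fun v => ‖v‖ₑ ^ (-s)) (z - a)) := by
        refine lintegral_mono fun z => ?_
        -- Where |z − a| > R the integrand is at most R^(−s); elsewhere the singularity is
        -- translated to 0.
        by_cases h : z - a ∈ Set.Icc (-R) R
        · rw [Set.indicator_of_mem h]
          exact le_add_self
        · rw [Set.indicator_of_notMem h, add_zero, ENNReal.rpow_neg, ENNReal.rpow_neg,
            ENNReal.inv_le_inv]
          refine ENNReal.rpow_le_rpow ?_ hs0.le
          rw [← ofReal_norm, Real.norm_eq_abs]
          refine ENNReal.ofReal_le_ofReal ?_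
          by_contra! h'
          exact h (abs_le.1 h'.le)
    _ = ENNReal.ofReal R ^ (-s) * ENNReal.ofReal (2 * R) + ∫⁻ z in Set.Icc (-R) R,
          (Set.Icc (-R) R).indicator (fun v => ‖v‖ₑ ^ (-s)) (z - a) := by
        rw [lintegral_add_left (by fun_prop), setLIntegral_const, Real.volume_Icc]
        congr 3
        ring
    _ ≤ ENNReal.ofReal R ^ (-s) * ENNReal.ofReal (2 * R) +
          ENNReal.ofReal (2 / (1 - s)) * ENNReal.ofReal R ^ (1 - s) := by
        gcongr
        refine (setLIntegral_le_lintegral _ _).trans ?_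
        rw [lintegral_sub_right_eq_self (fun z => (Set.Icc (-R) R).indicator
          (fun v => ‖v‖ₑ ^ (-s)) z) a, lintegral_indicator measurableSet_Icc]
        exact full
    _ = _ := by
        rw [ENNReal.ofReal_add (by norm_num) (by positivity), add_mul,
          ENNReal.ofReal_mul (by norm_num), sub_eq_neg_add 1 s,
          ENNReal.rpow_add _ _ hR0 ENNReal.ofReal_ne_top, ENNReal.rpow_one]
        ring

theorem enorm_rpow_neg_le {s x y : ℝ} (hs0 : 0 ≤ s) (h : |y| ≤ |x|) : ‖x‖ₑ ^ (-s) ≤ ‖y‖ₑ ^ (-s) := by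
  rw [ENNReal.rpow_neg, ENNReal.rpow_neg, ENNReal.inv_le_inv]
  refine ENNReal.rpow_le_rpow ?_ hs0
  rw [← ofReal_norm, ← ofReal_norm]
  exact ENNReal.ofReal_le_ofReal h

theorem lintegral_enorm_abs_sub_rpow_le {s : ℝ} (hs0 : 0 < s) (hs1 : s < 1) {R : ℝ} (hR : 0 < R)
    (a : ℝ) :
    ∫⁻ z in Set.Icc (-R) R, ‖|z| - a‖ₑ ^ (-s) ≤
      2 * ENNReal.ofReal (2 + 2 / (1 - s)) * ENNReal.ofReal R ^ (1 - s) := by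
  calc ∫⁻ z in Set.Icc (-R) R, ‖|z| - a‖ₑ ^ (-s)
      ≤ ∫⁻ z in Set.Icc (-R) R, (‖z - a‖ₑ ^ (-s) + ‖z - -a‖ₑ ^ (-s)) := by
        refine lintegral_mono fun z => ?_
        rcases abs_cases z with ⟨h, _⟩ | ⟨h, _⟩
        · rw [h]; exact le_self_add
        · rw [h, show -z - a = -(z - -a) by ring, enorm_neg]; exact le_add_self
    _ = _ := lintegral_add_left (by fun_prop) _
    _ ≤ _ := add_le_add (lintegral_enorm_sub_rpow_le hs0 hs1 hR a)
        (lintegral_enorm_sub_rpow_le hs0 hs1 hR (-a))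
    _ = _ := by ring

/-- With r = √|D|, |z² − D| ≥ ||z| − r| · r for either sign of D. The first factor is integrated in
z; the second survives as |D|^(−s/2), mild enough to be integrated in another variable. -/
theorem lintegral_enorm_sq_sub_rpow_le {s : ℝ} (hs0 : 0 < s) (hs1 : s < 1) {R : ℝ} (hR : 0 < R)
    (D : ℝ) :
    ∫⁻ z in Set.Icc (-R) R, ‖z ^ 2 - D‖ₑ ^ (-s) ≤
      2 * ENNReal.ofReal (2 + 2 / (1 - s)) * ENNReal.ofReal R ^ (1 - s) * ‖D‖ₑ ^ (-(s / 2)) := by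
  have key : ∀ z : ℝ, ‖z ^ 2 - D‖ₑ ^ (-s) ≤ ‖|z| - √|D|‖ₑ ^ (-s) * ‖D‖ₑ ^ (-(s / 2)) := by
    intro z
    have h1 : ‖D‖ₑ ^ (-(s / 2)) = ‖√|D|‖ₑ ^ (-s) := by
      rw [← Real.enorm_abs D]
      nth_rewrite 1 [← Real.sq_sqrt (abs_nonneg D)]
      rw [enorm_pow, ← ENNReal.rpow_natCast, ← ENNReal.rpow_mul]
      congr 1
      push_cast
      ring
    rw [h1, ← ENNReal.mul_rpow_of_ne_top (by simp) (by simp), ← enorm_mul]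
    refine enorm_rpow_neg_le hs0.le ?_
    have hr := Real.sqrt_nonneg |D|
    have hD := Real.sq_sqrt (abs_nonneg D)
    set r := √|D|
    have hz := abs_nonneg z
    rw [← sq_abs z]
    set w := |z|
    rw [abs_mul, abs_of_nonneg hr]
    rcases abs_cases D with ⟨h, _⟩ | ⟨h, _⟩
    · rw [h] at hD
      rw [← hD, show w ^ 2 - r ^ 2 = (w - r) * (w + r) by ring, abs_mul]
      refine mul_le_mul_of_nonneg_left ?_ (abs_nonneg _)
      rw [abs_of_nonneg (by linarith)]
      linarith
    · rw [h] at hD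
      rw [show w ^ 2 - D = w ^ 2 + r ^ 2 by linarith, abs_of_nonneg (show 0 ≤ w ^ 2 + r ^ 2 by positivity)]
      rcases abs_cases (w - r) with ⟨h', _⟩ | ⟨h', _⟩ <;> rw [h'] <;>
        nlinarith [mul_nonneg hz hr, sq_nonneg (w - r)]
  refine (lintegral_mono key).trans ?_
  rw [lintegral_mul_const _ (by fun_prop)]
  gcongr
  exact lintegral_enorm_abs_sub_rpow_le hs0 hs1 hR _

/-- Here |z² − D| ≥ (|z| − √|D|)² is used: halving the exponent makes the bound uniform in D. -/
theorem lintegral_enorm_sq_sub_rpow_half_le {s : ℝ} (hs0 : 0 < s) (hs1 : s < 1) {R : ℝ}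
    (hR : 0 < R) (D : ℝ) :
    ∫⁻ z in Set.Icc (-R) R, ‖z ^ 2 - D‖ₑ ^ (-(s / 2)) ≤
      2 * ENNReal.ofReal (2 + 2 / (1 - s)) * ENNReal.ofReal R ^ (1 - s) := by
  refine (lintegral_mono fun z => ?_).trans (lintegral_enorm_abs_sub_rpow_le hs0 hs1 hR √|D|)
  have h1 : ‖|z| - √|D|‖ₑ ^ (-s) = ‖(|z| - √|D|) ^ 2‖ₑ ^ (-(s / 2)) := by
    rw [enorm_pow, ← ENNReal.rpow_natCast, ← ENNReal.rpow_mul]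
    congr 1
    push_cast
    ring
  rw [h1]
  refine enorm_rpow_neg_le (by linarith) ?_
  have hr := Real.sqrt_nonneg |D|
  have hD := Real.sq_sqrt (abs_nonneg D)
  set r := √|D|
  have hz := abs_nonneg z
  rw [← sq_abs z]
  set w := |z|
  rw [abs_of_nonneg (sq_nonneg _)]
  rcases abs_cases D with ⟨h, _⟩ | ⟨h, _⟩
  · rw [h] at hD
    rw [← hD, show w ^ 2 - r ^ 2 = (w - r) * (w + r) by ring, abs_mul, sq, ← abs_mul_abs_self]
    refine mul_le_mul_of_nonneg_left ?_ (abs_nonneg _)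
    rw [abs_of_nonneg (show 0 ≤ w + r by linarith)]
    exact abs_le.2 ⟨by linarith, by linarith⟩
  · rw [h] at hD
    rw [show w ^ 2 - D = w ^ 2 + r ^ 2 by linarith, abs_of_nonneg (by positivity)]
    nlinarith [mul_nonneg hz hr]

/-- The two-dimensional sublevel estimate for a nondegenerate diagonal quadratic polynomial. -/
theorem lintegral_lintegral_enorm_diagonal_rpow_le {s : ℝ} (hs0 : 0 < s) (hs1 : s < 1) {R : ℝ}
    (hR : 0 < R) {a b : ℝ} (ha : a ≠ 0) (hb : b ≠ 0) (κ : ℝ) :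
    ∫⁻ y in Set.Icc (-R) R, ∫⁻ z in Set.Icc (-R) R, ‖a * z ^ 2 + (b * y ^ 2 + κ)‖ₑ ^ (-s) ≤
      ‖a‖ₑ ^ (-s) * ‖b / a‖ₑ ^ (-(s / 2)) *
        (2 * ENNReal.ofReal (2 + 2 / (1 - s)) * ENNReal.ofReal R ^ (1 - s)) ^ 2 := by
  set B := 2 * ENNReal.ofReal (2 + 2 / (1 - s)) * ENNReal.ofReal R ^ (1 - s)
  calc ∫⁻ y in Set.Icc (-R) R, ∫⁻ z in Set.Icc (-R) R, ‖a * z ^ 2 + (b * y ^ 2 + κ)‖ₑ ^ (-s)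
      ≤ ∫⁻ y in Set.Icc (-R) R, ‖a‖ₑ ^ (-s) * ‖b / a‖ₑ ^ (-(s / 2)) * B *
          ‖y ^ 2 - (-κ / b)‖ₑ ^ (-(s / 2)) := by
        refine lintegral_mono fun y => ?_
        -- In z the polynomial is a (z² − D) with D = −(b/a)(y² + κ/b). The z-integral leaves
        -- |D|^(−s/2), which the halved-exponent bound integrates in y. One variable alone would
        -- allow only s < 1/2 when D = 0.
        have h1 : ∀ z : ℝ, ‖a * z ^ 2 + (b * y ^ 2 + κ)‖ₑ ^ (-s) =
            ‖a‖ₑ ^ (-s) * ‖z ^ 2 - (-(b / a) * (y ^ 2 - (-κ / b)))‖ₑ ^ (-s) := by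
          intro z
          rw [← ENNReal.mul_rpow_of_ne_top (by simp) (by simp), ← enorm_mul]
          congr 2
          field_simp
          ring
        simp only [h1]
        rw [lintegral_const_mul _ (by fun_prop)]
        have h2 := lintegral_enorm_sq_sub_rpow_le hs0 hs1 hR (-(b / a) * (y ^ 2 - (-κ / b)))
        rw [enorm_mul, enorm_neg, ENNReal.mul_rpow_of_ne_top (by simp) (by simp)] at h2
        refine (mul_le_mul_right h2 _).trans (le_of_eq ?_)
        ring
    _ ≤ _ := by
        rw [lintegral_const_mul _ (by fun_prop)]
        refine (mul_le_mul_right (lintegral_enorm_sq_sub_rpow_half_le hs0 hs1 hR _) _).trans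
          (le_of_eq ?_)
        ring

/-- The integral of a nonnegative function over a box, bounded through two of the variables. -/
theorem lintegral_pi_le_of_two {ι : Type*} [Fintype ι] [DecidableEq ι] {f : (ι → ℝ) → ENNReal}
    (hf : Measurable f) {i j : ι} (hij : i ≠ j) {R : ℝ} (hR : 0 < R) {B : ENNReal}
    (h : ∀ x : ι → ℝ, ∫⁻ y in Set.Icc (-R) R, ∫⁻ z in Set.Icc (-R) R,
      f (Function.update (Function.update x j y) i z) ≤ B) :
    ∫⁻ x in Set.univ.pi fun _ : ι => Set.Icc (-R) R, f x ≤
      B * ENNReal.ofReal (2 * R) ^ ((Fintype.card ι : ℝ) - 2) := by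
  have hR0 : ENNReal.ofReal (2 * R) ≠ 0 := by simpa using hR
  have hRt : ENNReal.ofReal (2 * R) ≠ ⊤ := ENNReal.ofReal_ne_top
  have hvol : volume (Set.Icc (-R) R) = ENNReal.ofReal (2 * R) := by
    rw [Real.volume_Icc]; congr 1; ring
  rw [volume_pi, Measure.restrict_pi_pi]
  set μ : ι → Measure ℝ := fun _ => volume.restrict (Set.Icc (-R) R)
  -- The constant comparison function is normalised so that its integral over the two chosen
  -- variables is B; a bound for two-dimensional marginals then passes to the whole integral.
  have h1 := lintegral_le_of_lmarginal_le (μ := μ) {j, i} hf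
    (g := fun _ => B * ENNReal.ofReal (2 * R) ^ (-2 : ℝ)) measurable_const (fun x => by
      rw [lmarginal_insert _ hf (by simpa using hij.symm),
        lmarginal_insert _ measurable_const (by simpa using hij.symm)]
      simp only [lmarginal_singleton, lintegral_const, μ, Measure.restrict_apply_univ, hvol]
      refine (h x).trans (le_of_eq ?_)
      rw [mul_assoc, mul_assoc, ← sq, ← ENNReal.rpow_natCast, ← ENNReal.rpow_add _ _ hR0 hRt]
      norm_num)
  refine h1.trans (le_of_eq ?_)
  rw [lintegral_const, Measure.pi_univ]
  simp only [μ, Measure.restrict_apply_univ, hvol, Finset.prod_const, Finset.card_univ]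
  rw [mul_assoc, ← ENNReal.rpow_natCast, ← ENNReal.rpow_add _ _ hR0 hRt]
  congr 2
  ring

namespace IntQuadPoly

variable {l : ℕ} (F : IntQuadPoly l)

@[fun_prop]
theorem continuous_eval : Continuous fun y : Fin l → ℝ => F.eval y := by
  unfold eval
  fun_prop

open Finset in
/-- The sublevel estimate: negative powers of exponent above `-1` of a nondegenerate quadratic
polynomial are integrable over boxes. -/
theorem exists_lintegral_enorm_eval_rpow_le (hl : 2 ≤ l) (hF : F.discr ≠ 0) {s : ℝ} (hs0 : 0 < s)
    (hs1 : s < 1) :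
    ∃ C : ℝ, 0 < C ∧ ∀ R : ℝ, 1 ≤ R →
      ∫⁻ y in Set.univ.pi fun _ : Fin l => Set.Icc (-R) R, ‖F.eval y‖ₑ ^ (-s) ≤
        ENNReal.ofReal (C * R ^ ((l : ℝ) - 2 * s)) := by
  obtain ⟨A, x₀, c, κ, hA, hc, -, hev⟩ := F.exists_diagonalization (K := ℝ) two_ne_zero
    (by exact_mod_cast hF)
  have hci : ∀ i, c i / 2 ≠ 0 := by
    intro i
    have : ∏ i, c i ≠ 0 := by
      rw [← hc]
      have : (F.discr : ℝ) ≠ 0 := by exact_mod_cast hF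
      positivity
    exact div_ne_zero (Finset.prod_ne_zero_iff.1 this i (mem_univ i)) two_ne_zero
  set i₀ : Fin l := ⟨0, by omega⟩
  set i₁ : Fin l := ⟨1, by omega⟩
  have hi : i₀ ≠ i₁ := by simp [i₀, i₁]
  -- the box in the diagonalizing coordinates
  obtain ⟨C₁, hC₁, hbox⟩ : ∃ C₁ : ℝ, 0 < C₁ ∧ ∀ R : ℝ, 1 ≤ R → ∀ w : Fin l → ℝ,
      (∀ i, |(x₀ + A.mulVec w) i| ≤ R) → ∀ i, |w i| ≤ C₁ * R := by
    refine ⟨1 + ∑ i, ∑ j, |A⁻¹ i j| * (1 + |x₀ j|), by positivity, fun R hR w hw i => ?_⟩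
    have h1 : w = A⁻¹.mulVec (A.mulVec w) := by
      rw [Matrix.mulVec_mulVec, Matrix.nonsing_inv_mul _ hA.isUnit, Matrix.one_mulVec]
    have h2 : ∀ j, |A.mulVec w j| ≤ (1 + |x₀ j|) * R := by
      intro j
      have h3 := hw j
      rw [Pi.add_apply] at h3
      have h4 := abs_sub (x₀ j + A.mulVec w j) (x₀ j)
      rw [add_sub_cancel_left] at h4
      nlinarith [abs_nonneg (x₀ j)]
    calc |w i| = |∑ j, A⁻¹ i j * A.mulVec w j| := by
          conv_lhs => rw [h1]
          rfl
      _ ≤ ∑ j, |A⁻¹ i j| * ((1 + |x₀ j|) * R) := by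
          refine (abs_sum_le_sum_abs _ _).trans (sum_le_sum fun j _ => ?_)
          rw [abs_mul]
          exact mul_le_mul_of_nonneg_left (h2 j) (abs_nonneg _)
      _ = (∑ j, |A⁻¹ i j| * (1 + |x₀ j|)) * R := by
          rw [sum_mul]
          exact sum_congr rfl fun j _ => by ring
      _ ≤ _ := by
          refine mul_le_mul_of_nonneg_right ?_ (by linarith)
          have := single_le_sum (f := fun i => ∑ j, |A⁻¹ i j| * (1 + |x₀ j|))
            (fun i _ => by positivity) (mem_univ i)
          linarith
  set E : ENNReal := ENNReal.ofReal |A.det| * (‖c i₀ / 2‖ₑ ^ (-s) *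
    ‖c i₁ / 2 / (c i₀ / 2)‖ₑ ^ (-(s / 2)) * (2 * ENNReal.ofReal (2 + 2 / (1 - s)) *
      ENNReal.ofReal C₁ ^ (1 - s)) ^ 2 * ENNReal.ofReal (2 * C₁) ^ ((l : ℝ) - 2)) with hE
  have htop : ∀ x : ℝ, x ≠ 0 → ∀ r : ℝ, ‖x‖ₑ ^ r ≠ ⊤ := fun x hx r =>
    ENNReal.rpow_ne_top_of_ne_zero (by simpa using hx) (by simp)
  have htop' : ∀ x : ℝ, 0 < x → ∀ r : ℝ, ENNReal.ofReal x ^ r ≠ ⊤ := fun x hx r =>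
    ENNReal.rpow_ne_top_of_ne_zero (by simpa using hx) (by simp)
  have hEt : E ≠ ⊤ := by
    refine ENNReal.mul_ne_top (by simp) (ENNReal.mul_ne_top (ENNReal.mul_ne_top
      (ENNReal.mul_ne_top (htop _ (hci _) _) (htop _ (div_ne_zero (hci _) (hci _)) _))
      (ENNReal.pow_ne_top (ENNReal.mul_ne_top (ENNReal.mul_ne_top (by simp) (by simp))
        (htop' _ hC₁ _)))) (htop' _ (by positivity) _))
  refine ⟨E.toReal + 1, by positivity, fun R hR => ?_⟩
  have hR0 : 0 < R := by linarith
  rw [ENNReal.ofReal_mul (by positivity)]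
  refine le_trans ?_ (mul_le_mul_left (b := E) ?_ _)
  swap
  · rw [ENNReal.ofReal_add (by positivity) (by norm_num), ENNReal.ofReal_toReal hEt]
    exact le_self_add
  -- change of variables
  have hmeas : Measurable fun y : Fin l → ℝ => (Set.univ.pi fun _ : Fin l => Set.Icc (-R) R).indicator
      (fun y => ‖F.eval y‖ₑ ^ (-s)) y :=
    (Measurable.pow_const (by fun_prop) _).indicator
      (MeasurableSet.univ_pi fun _ => measurableSet_Icc)
  set g : (Fin l → ℝ) → ENNReal := (Set.univ.pi fun _ : Fin l => Set.Icc (-R) R).indicator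
      (fun y => ‖F.eval y‖ₑ ^ (-s)) with hg
  have hcv : ∫⁻ y, g y = ENNReal.ofReal |A.det| * ∫⁻ w, g (x₀ + A.mulVec w) := by
    have h1 := Real.map_matrix_volume_pi_eq_smul_volume_pi hA
    have h2 : ∫⁻ w, g (x₀ + A.mulVec w) = ENNReal.ofReal |A.det⁻¹| * ∫⁻ y, g y := by
      rw [← lintegral_add_left_eq_self g x₀, ← smul_eq_mul, ← lintegral_smul_measure, ← h1,
        lintegral_map (f := fun v => g (x₀ + v)) (hmeas.comp (measurable_const_add x₀))
          (LinearMap.continuous_of_finiteDimensional _).measurable]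
      rfl
    rw [h2, ← mul_assoc, ← ENNReal.ofReal_mul (abs_nonneg _), ← abs_mul, mul_inv_cancel₀ hA]
    simp
  rw [← lintegral_indicator (MeasurableSet.univ_pi fun _ => measurableSet_Icc), ← hg, hcv]
  have hle : ∫⁻ w, g (x₀ + A.mulVec w) ≤
      ∫⁻ w in Set.univ.pi fun _ : Fin l => Set.Icc (-(C₁ * R)) (C₁ * R),
        ‖κ + ∑ i, c i / 2 * w i ^ 2‖ₑ ^ (-s) := by
    rw [← lintegral_indicator (MeasurableSet.univ_pi fun _ => measurableSet_Icc)]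
    refine lintegral_mono fun w => ?_
    by_cases hw : x₀ + A.mulVec w ∈ Set.univ.pi fun _ : Fin l => Set.Icc (-R) R
    · have hw' : w ∈ Set.univ.pi fun _ : Fin l => Set.Icc (-(C₁ * R)) (C₁ * R) := fun i _ =>
        abs_le.1 (hbox R hR w (fun i => abs_le.2 (hw i (Set.mem_univ i))) i)
      rw [hg, Set.indicator_of_mem hw, Set.indicator_of_mem hw', hev]
    · rw [hg, Set.indicator_of_notMem hw]
      exact zero_le
  refine (mul_le_mul_right (hle.trans (lintegral_pi_le_of_two
    (B := ‖c i₀ / 2‖ₑ ^ (-s) * ‖c i₁ / 2 / (c i₀ / 2)‖ₑ ^ (-(s / 2)) *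
      (2 * ENNReal.ofReal (2 + 2 / (1 - s)) * ENNReal.ofReal (C₁ * R) ^ (1 - s)) ^ 2)
    (by fun_prop) hi (by positivity) fun x => ?_)) _).trans (le_of_eq ?_)
  · refine le_trans (le_of_eq ?_) (lintegral_lintegral_enorm_diagonal_rpow_le hs0 hs1
      (R := C₁ * R) (by positivity) (hci i₀) (hci i₁)
      (κ + ∑ i ∈ (univ.erase i₀).erase i₁, c i / 2 * x i ^ 2))
    refine lintegral_congr fun y => lintegral_congr fun z => ?_
    congr 2
    rw [← add_sum_erase univ _ (mem_univ i₀), ← add_sum_erase (univ.erase i₀) _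
      (mem_erase.2 ⟨hi.symm, mem_univ i₁⟩), Function.update_self,
      Function.update_of_ne hi.symm, Function.update_self]
    have : ∀ i ∈ (univ.erase i₀).erase i₁,
        c i / 2 * Function.update (Function.update x i₁ y) i₀ z i ^ 2 = c i / 2 * x i ^ 2 := by
      intro i h
      simp only [mem_erase] at h
      rw [Function.update_of_ne h.2.1, Function.update_of_ne h.1]
    rw [sum_congr rfl this]
    ring
  · have hRn : ENNReal.ofReal R ≠ 0 := by simpa using hR0
    -- The exponent is 2(1 − s) from the two singular variables plus l − 2 from the others.
    have e : ENNReal.ofReal (R ^ ((l : ℝ) - 2 * s)) =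
        (ENNReal.ofReal R ^ (1 - s)) ^ 2 * ENNReal.ofReal R ^ ((l : ℝ) - 2) := by
      rw [← ENNReal.ofReal_rpow_of_pos hR0, ← ENNReal.rpow_natCast, ← ENNReal.rpow_mul,
        ← ENNReal.rpow_add _ _ hRn ENNReal.ofReal_ne_top]
      congr 1
      push_cast
      ring
    rw [e, hE, Fintype.card_fin, ← mul_assoc 2 C₁ R, ENNReal.ofReal_mul hC₁.le,
      ENNReal.ofReal_mul (show 0 ≤ 2 * C₁ by positivity),
      ENNReal.mul_rpow_of_ne_top ENNReal.ofReal_ne_top ENNReal.ofReal_ne_top,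
      ENNReal.mul_rpow_of_ne_top (x := ENNReal.ofReal (2 * C₁)) ENNReal.ofReal_ne_top
        ENNReal.ofReal_ne_top]
    ring

end IntQuadPoly

/-! ### Unit cubes: from integrals to sums over lattice points. -/

namespace IntQuadPoly

variable {l : ℕ} (F : IntQuadPoly l)

open Finset

theorem abs_sum_mul_le {ι : Type*} (s : Finset ι) (a z : ι → ℝ) {r : ℝ} (hz : ∀ i, |z i| ≤ r) :
    |∑ i ∈ s, a i * z i| ≤ (∑ i ∈ s, |a i|) * r := by
  rw [sum_mul]
  refine (abs_sum_le_sum_abs _ _).trans (sum_le_sum fun i _ => ?_)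
  rw [abs_mul]
  exact mul_le_mul_of_nonneg_left (hz i) (abs_nonneg _)

theorem abs_quadratic_le (a : Matrix (Fin l) (Fin l) ℝ) (z : Fin l → ℝ) {r : ℝ} (hr : 0 ≤ r)
    (hz : ∀ i, |z i| ≤ r) : |∑ i, ∑ j, z i * a i j * z j| ≤ (∑ i, ∑ j, |a i j|) * r ^ 2 := by
  have h : ∀ i, |∑ j, a i j * z j| ≤ (∑ j, |a i j|) * r := fun i => abs_sum_mul_le _ _ _ hz
  rw [sum_mul]
  refine (abs_sum_le_sum_abs _ _).trans (sum_le_sum fun i _ => ?_)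
  simp only [mul_assoc]
  rw [← mul_sum, abs_mul, sq, ← mul_assoc, mul_comm]
  exact mul_le_mul (h i) (hz i) (abs_nonneg _) (by positivity)

/-- Size and variation of `F` on boxes. -/
theorem exists_eval_bounds : ∃ C : ℝ, 1 ≤ C ∧
    (∀ X : ℝ, 1 ≤ X → ∀ y h : Fin l → ℝ, ∀ r : ℝ, 0 ≤ r → r ≤ X → (∀ i, |y i| ≤ X) →
      (∀ i, |h i| ≤ r) → |F.eval (y + h) - F.eval y| ≤ C * X * r) ∧
    (∀ X : ℝ, 1 ≤ X → ∀ y : Fin l → ℝ, (∀ i, |y i| ≤ X) → |F.eval y| ≤ C * X ^ 2) := by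
  obtain ⟨A, hA⟩ : ∃ A : ℝ, A = ∑ i, ∑ j, |(F.Q i j : ℝ)| := ⟨_, rfl⟩
  obtain ⟨B, hB⟩ : ∃ B : ℝ, B = ∑ i, |(F.b i : ℝ)| := ⟨_, rfl⟩
  obtain ⟨G, hG⟩ : ∃ G : ℝ, G = ∑ i, (∑ j, |(F.QS i j : ℝ)| + |(F.b i : ℝ)|) := ⟨_, rfl⟩
  have hA0 : 0 ≤ A := by rw [hA]; positivity
  have hB0 : 0 ≤ B := by rw [hB]; positivity
  have hG0 : 0 ≤ G := by rw [hG]; positivity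
  have hc0 := abs_nonneg (F.c : ℝ)
  refine ⟨1 + A + B + G + |(F.c : ℝ)|, by linarith, ?_, ?_⟩
  · intro X hX y h r hr hrX hy hh
    have hX0 : 0 ≤ X := by linarith
    have hgrad : ∀ i, |F.grad y i| ≤ (∑ j, |(F.QS i j : ℝ)| + |(F.b i : ℝ)|) * X := by
      intro i
      rw [grad, add_mul]
      exact (abs_add_le _ _).trans (add_le_add (abs_sum_mul_le _ _ _ hy)
        (le_mul_of_one_le_right (abs_nonneg _) hX))
    have h3 : |∑ i, h i * F.grad y i| ≤ G * X * r := by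
      simp only [mul_comm (h _)]
      refine (abs_sum_mul_le _ _ _ hh).trans (mul_le_mul_of_nonneg_right ?_ hr)
      rw [hG, sum_mul]
      exact sum_le_sum fun i _ => hgrad i
    have h2 : |F.homog.eval h| ≤ A * r ^ 2 := by
      have := abs_quadratic_le (F.Q.map (Int.cast : ℤ → ℝ)) h hr hh
      rw [hA]
      simpa [eval, homog] using this
    have h4 : A * r ^ 2 ≤ A * X * r := by
      rw [sq, ← mul_assoc]
      gcongr
    rw [F.eval_add, add_assoc, add_sub_cancel_left]
    have h5 : 0 ≤ (1 + B + |(F.c : ℝ)|) * X * r := by positivity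
    calc _ ≤ G * X * r + A * X * r :=
          (abs_add_le _ _).trans (add_le_add h3 (h2.trans h4))
      _ ≤ (G * X * r + A * X * r) + (1 + B + |(F.c : ℝ)|) * X * r := by linarith
      _ = _ := by ring
  · intro X hX y hy
    have hX0 : 0 ≤ X := by linarith
    have h1 := abs_sum_mul_le univ (fun i => (F.b i : ℝ)) y hy
    rw [← hB] at h1
    have h2 := abs_quadratic_le (F.Q.map (Int.cast : ℤ → ℝ)) y hX0 hy
    simp only [Matrix.map_apply] at h2
    rw [← hA] at h2
    have h4 : X ≤ X ^ 2 := by nlinarith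
    have h5 : (1 : ℝ) ≤ X ^ 2 := by nlinarith
    have h6 : 0 ≤ (1 + G) * X ^ 2 := by positivity
    rw [eval]
    calc _ ≤ A * X ^ 2 + B * X + |(F.c : ℝ)| :=
          (abs_add_three _ _ _).trans (add_le_add_left (add_le_add h2 h1) _)
      _ ≤ A * X ^ 2 + B * X ^ 2 + |(F.c : ℝ)| * X ^ 2 + (1 + G) * X ^ 2 := by
          have := mul_le_mul_of_nonneg_left h4 hB0
          have := mul_le_mul_of_nonneg_left h5 hc0
          linarith
      _ = _ := by ring

/-- The integer points of `[1, N]^l`. -/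
noncomputable def box (l N : ℕ) : Finset (Fin l → ℤ) := Fintype.piFinset fun _ => Icc (1 : ℤ) N

theorem mem_box {N : ℕ} {x : Fin l → ℤ} : x ∈ box l N ↔ ∀ i, 1 ≤ x i ∧ x i ≤ N := by
  simp [box]

theorem card_box (N : ℕ) : #(box l N) = N ^ l := by
  simp [box]

/-- The unit cube with largest corner `x`. -/
def cube (x : Fin l → ℤ) : Set (Fin l → ℝ) := Set.univ.pi fun i => Set.Ico (x i - 1 : ℝ) (x i)

theorem measurableSet_cube (x : Fin l → ℤ) : MeasurableSet (cube x) :=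
  MeasurableSet.univ_pi fun _ => measurableSet_Ico

theorem volume_cube (x : Fin l → ℤ) : volume (cube x) = 1 := by
  rw [cube, Real.volume_pi_Ico]
  simp

theorem mem_cube_iff {x : Fin l → ℤ} {y : Fin l → ℝ} : y ∈ cube x ↔ ∀ i, x i = ⌊y i⌋ + 1 := by
  simp only [cube, Set.mem_univ_pi, Set.mem_Ico]
  refine forall_congr' fun i => ?_
  rw [← sub_eq_iff_eq_add, eq_comm, Int.floor_eq_iff]
  push_cast
  rw [sub_add_cancel]

theorem pairwiseDisjoint_cube (s : Set (Fin l → ℤ)) : s.PairwiseDisjoint cube := by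
  intro x _ z _ hxz
  refine Set.disjoint_left.2 fun y hx hz => hxz ?_
  ext i
  rw [mem_cube_iff.1 hx i, mem_cube_iff.1 hz i]

theorem biUnion_cube (N : ℕ) :
    ⋃ x ∈ box l N, cube x = Set.univ.pi fun _ : Fin l => Set.Ico (0 : ℝ) N := by
  ext y
  simp only [Set.mem_iUnion, exists_prop, mem_cube_iff, mem_box, Set.mem_univ_pi, Set.mem_Ico]
  constructor
  · rintro ⟨x, h1, h2⟩ i
    have h3 := h2 i
    obtain ⟨h4, h5⟩ := h1 i
    constructor
    · exact Int.floor_nonneg.1 (by omega)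
    · have := Int.lt_floor_add_one (y i)
      have h6 : (⌊y i⌋ : ℝ) + 1 ≤ N := by exact_mod_cast (show ⌊y i⌋ + 1 ≤ N by omega)
      linarith
  · intro h
    refine ⟨fun i => ⌊y i⌋ + 1, fun i => ⟨?_, ?_⟩, fun i => rfl⟩
    · have := Int.floor_nonneg.2 (h i).1
      show 1 ≤ ⌊y i⌋ + 1
      omega
    · have := Int.floor_lt.2 (show y i < ((N : ℤ) : ℝ) by exact_mod_cast (h i).2)
      show ⌊y i⌋ + 1 ≤ N
      omega

/-- A sum over integer points of functions bounded on the unit cubes by `f`. -/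
theorem sum_box_le_lintegral {N : ℕ} (f : (Fin l → ℝ) → ENNReal) {R : ℝ} (hN : (N : ℝ) ≤ R)
    (a : (Fin l → ℤ) → ENNReal) (h : ∀ x ∈ box l N, a x ≤ ∫⁻ y in cube x, f y) :
    ∑ x ∈ box l N, a x ≤ ∫⁻ y in Set.univ.pi fun _ : Fin l => Set.Icc (-R) R, f y := by
  refine (sum_le_sum h).trans ?_
  rw [← lintegral_biUnion_finset (pairwiseDisjoint_cube _) fun x _ => measurableSet_cube x,
    biUnion_cube]
  refine lintegral_mono_set (Set.pi_mono fun i _ y hy => ⟨?_, hy.2.le.trans hN⟩)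
  have : (0 : ℝ) ≤ N := by positivity
  linarith [hy.1]

theorem abs_sub_le_of_mem_cube {C : ℝ} (hC : ∀ X : ℝ, 1 ≤ X → ∀ y h : Fin l → ℝ, ∀ r : ℝ, 0 ≤ r →
      r ≤ X → (∀ i, |y i| ≤ X) → (∀ i, |h i| ≤ r) → |F.eval (y + h) - F.eval y| ≤ C * X * r)
    {X : ℝ} (hX : 1 ≤ X) {N : ℕ} (hN : (N : ℝ) ≤ X) {x : Fin l → ℤ} (hx : x ∈ box l N)
    {y : Fin l → ℝ} (hy : y ∈ cube x) : |F.eval y - (F.eval x : ℤ)| ≤ C * X := by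
  have h1 := hC X hX (fun i => (x i : ℝ)) (fun i => y i - x i) 1 zero_le_one hX ?_ ?_
  · rw [F.eval_intCast] at h1
    have : (fun i => (x i : ℝ)) + (fun i => y i - x i) = y := by ext i; simp
    rwa [this, mul_one] at h1
  · intro i
    have h2 := mem_box.1 hx i
    have h3 : (1 : ℝ) ≤ x i := by exact_mod_cast h2.1
    have h4 : (x i : ℝ) ≤ N := by exact_mod_cast h2.2
    rw [abs_of_nonneg (by linarith)]
    linarith
  · intro i
    have := hy i (Set.mem_univ i)
    rw [Set.mem_Ico] at this
    exact abs_le.2 ⟨by linarith, by linarith⟩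

theorem enorm_rpow_eq_ofReal {u : ℝ} (hu : u ≠ 0) (r : ℝ) : ‖u‖ₑ ^ r = ENNReal.ofReal (|u| ^ r) := by
  rw [← ofReal_norm, Real.norm_eq_abs, ENNReal.ofReal_rpow_of_pos (abs_pos.2 hu)]

/-- The discrete form of the sublevel estimate. -/
theorem exists_sum_min_le (hl : 2 ≤ l) (hF : F.discr ≠ 0) {δ : ℝ} (hδ : 0 < δ) (hδ1 : δ < 1) :
    ∃ C : ℝ, 0 < C ∧ ∀ X : ℝ, 1 ≤ X → ∀ N : ℕ, (N : ℝ) ≤ X →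
      (∀ x ∈ box l N, 0 < F.eval x) → ∀ K : ℝ, 1 ≤ K →
        ∑ x ∈ box l N, min 1 (K * X / (F.eval x : ℤ)) ≤ C * K * X ^ ((l : ℝ) - 1 + δ) := by
  obtain ⟨C₁, hC₁, hLip, -⟩ := F.exists_eval_bounds
  obtain ⟨C₂, hC₂, hint⟩ := F.exists_lintegral_enorm_eval_rpow_le hl hF (s := 1 - δ)
    (by linarith) (by linarith)
  refine ⟨(1 + C₁) * C₂, by positivity, fun X hX N hN hpos K hK => ?_⟩
  have hX0 : 0 < X := by linarith
  -- On the cube of x, F differs from n = F(x) by at most C₁ X, so min(1, K X / n) is at most ((1 +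
  -- C₁) K X / |F(y)|)^(1−δ) at every y of the cube. The exponent stays below 1 to be integrable, at
  -- the price of X^δ.
  set a : ℝ := ((1 + C₁) * K * X) ^ (1 - δ) with ha
  have ha0 : 0 < a := by positivity
  have key : ∀ x ∈ box l N, ∀ y ∈ cube x, ENNReal.ofReal (min 1 (K * X / (F.eval x : ℤ))) ≤
      ENNReal.ofReal a * ‖F.eval y‖ₑ ^ (-(1 - δ)) := by
    intro x hx y hy
    have hn : (0 : ℝ) < (F.eval x : ℤ) := by exact_mod_cast hpos x hx
    have hd := F.abs_sub_le_of_mem_cube hLip hX hN hx hy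
    generalize ((F.eval x : ℤ) : ℝ) = n at hn hd
    by_cases h0 : F.eval y = 0
    · rw [h0, enorm_zero, ENNReal.zero_rpow_of_neg (by linarith),
        ENNReal.mul_top (by simpa using ha0)]
      exact le_top
    generalize F.eval y = v at hd h0
    have hv : 0 < |v| := abs_pos.2 h0
    have hv2 : |v| ≤ n + C₁ * X := by
      have := abs_sub_abs_le_abs_sub v n
      rw [abs_of_pos hn] at this
      linarith
    rw [enorm_rpow_eq_ofReal h0, ← ENNReal.ofReal_mul ha0.le]
    refine ENNReal.ofReal_le_ofReal ?_
    rw [ha, Real.rpow_neg hv.le, ← div_eq_mul_inv, ← Real.div_rpow (by positivity) hv.le]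
    have hC0 : 0 < C₁ := by linarith
    rcases le_or_gt (K * X) n with h | h
    · have h1 : K * X / n ≤ 1 := (div_le_one hn).2 h
      have h2 : K * X / n ≤ (1 + C₁) * K * X / |v| := by
        rw [div_le_div_iff₀ hn hv]
        have h3 : |v| ≤ (1 + C₁) * n := by
          have := mul_le_mul_of_nonneg_left (show X ≤ n by nlinarith) hC0.le
          linarith
        have := mul_le_mul_of_nonneg_left h3 (show 0 ≤ K * X by positivity)
        linarith
      calc _ ≤ K * X / n := min_le_right _ _
        _ = (K * X / n) ^ (1 : ℝ) := (Real.rpow_one _).symm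
        _ ≤ (K * X / n) ^ (1 - δ) :=
            Real.rpow_le_rpow_of_exponent_ge (by positivity) h1 (by linarith)
        _ ≤ _ := Real.rpow_le_rpow (by positivity) h2 (by linarith)
    · refine (min_le_left _ _).trans (Real.one_le_rpow ?_ (by linarith))
      rw [one_le_div hv]
      nlinarith [mul_pos hC0 hX0]
  have hsum := sum_box_le_lintegral (fun y => ENNReal.ofReal a * ‖F.eval y‖ₑ ^ (-(1 - δ))) hN
    (fun x => ENNReal.ofReal (min 1 (K * X / (F.eval x : ℤ)))) (fun x hx => by
      calc _ = ∫⁻ y in cube x, ENNReal.ofReal (min 1 (K * X / (F.eval x : ℤ))) := by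
            rw [setLIntegral_const, volume_cube, mul_one]
        _ ≤ _ := setLIntegral_mono' (measurableSet_cube x) (key x hx))
  rw [lintegral_const_mul _ (by fun_prop)] at hsum
  have h1 := hsum.trans (mul_le_mul_right (hint X hX) _)
  rw [← ENNReal.ofReal_sum_of_nonneg, ← ENNReal.ofReal_mul ha0.le,
    ENNReal.ofReal_le_ofReal_iff (by positivity)] at h1
  swap
  · intro x hx
    have hn : (0 : ℝ) < (F.eval x : ℤ) := by exact_mod_cast hpos x hx
    positivity
  refine h1.trans ?_
  have e1 : a ≤ (1 + C₁) * K * X ^ (1 - δ) := by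
    rw [ha, Real.mul_rpow (by positivity) hX0.le]
    refine mul_le_mul_of_nonneg_right ?_ (by positivity)
    calc ((1 + C₁) * K) ^ (1 - δ) ≤ ((1 + C₁) * K) ^ (1 : ℝ) :=
          Real.rpow_le_rpow_of_exponent_le (by nlinarith) (by linarith)
      _ = _ := Real.rpow_one _
  calc a * (C₂ * X ^ ((l : ℝ) - 2 * (1 - δ)))
      ≤ (1 + C₁) * K * X ^ (1 - δ) * (C₂ * X ^ ((l : ℝ) - 2 * (1 - δ))) := by gcongr
    _ = (1 + C₁) * C₂ * K * (X ^ (1 - δ) * X ^ ((l : ℝ) - 2 * (1 - δ))) := by ring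
    _ = _ := by
        rw [← Real.rpow_add hX0]
        congr 2
        ring

end IntQuadPoly

/-! ### Sums of log F and the logarithmic integral. -/

theorem abs_log_le_two_mul {u : ℝ} (hu : |u - 1| ≤ 1 / 2) : |Real.log u| ≤ 2 * |u - 1| := by
  have h := abs_le.1 hu
  have hu0 : 0 < u := by linarith
  have h1 := Real.log_le_sub_one_of_pos hu0
  have h2 := Real.one_sub_inv_le_log_of_pos hu0
  have h3 : 1 - u⁻¹ = (u - 1) * u⁻¹ := by field_simp
  have h4 : u⁻¹ ≤ 2 := by
    rw [inv_le_comm₀ hu0 two_pos]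
    linarith
  have h5 : |1 - u⁻¹| ≤ 2 * |u - 1| := by
    rw [h3, abs_mul, abs_of_pos (inv_pos.2 hu0), mul_comm]
    exact mul_le_mul_of_nonneg_right h4 (abs_nonneg _)
  have h6 := (abs_le.1 h5).1
  rw [abs_le]
  constructor
  · linarith
  · linarith [le_abs_self (u - 1), abs_nonneg (u - 1)]

/-- Large |v| makes the logarithm O(X^δ); small |v| is covered by a negative power of |v| that the
sublevel estimate can integrate. -/
theorem abs_log_div_sq_le {δ : ℝ} (hδ : 0 < δ) (hδ1 : δ ≤ 1 / 2) {C X v : ℝ} (hC : 1 ≤ C)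
    (hX : 1 ≤ X) (hv : v ≠ 0) (hvX : |v| ≤ C * X ^ 2) :
    |Real.log (v / X ^ 2)| ≤ (C + 2 / δ) * X ^ δ + 2 * |v| ^ (-(1 - δ)) := by
  have hX0 : 0 < X := by linarith
  have hv0 : 0 < |v| := abs_pos.2 hv
  have hX1 : 1 ≤ X ^ δ := Real.one_le_rpow hX hδ.le
  have hlogX : Real.log X ≤ X ^ δ / δ := Real.log_le_rpow_div hX0.le hδ
  have h1 : Real.log (v / X ^ 2) = Real.log |v| - 2 * Real.log X := by
    rw [Real.log_div hv (by positivity), Real.log_abs, Real.log_pow]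
    norm_num
  have h2 : -Real.log |v| ≤ 2 * |v| ^ (-(1 - δ)) := by
    have := Real.log_le_rpow_div (x := |v|⁻¹) (ε := 1 - δ) (by positivity) (by linarith)
    rw [Real.log_inv, Real.inv_rpow hv0.le, ← Real.rpow_neg hv0.le] at this
    refine this.trans ?_
    rw [div_le_iff₀ (by linarith)]
    have : 0 ≤ |v| ^ (-(1 - δ)) := by positivity
    nlinarith
  have h3 : Real.log |v| ≤ C + 2 * Real.log X := by
    have h := Real.log_le_log hv0 hvX
    rw [Real.log_mul (by positivity) (by positivity), Real.log_pow] at h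
    have := Real.log_le_sub_one_of_pos (show 0 < C by linarith)
    push_cast at h
    linarith
  have h4 : 0 ≤ |v| ^ (-(1 - δ)) := by positivity
  have h5 : 2 * Real.log X ≤ 2 / δ * X ^ δ := by
    calc 2 * Real.log X ≤ 2 * (X ^ δ / δ) := by linarith
      _ = _ := by ring
  have h6 : C ≤ C * X ^ δ := le_mul_of_one_le_right (by linarith) hX1
  have h7 : 0 ≤ 2 / δ * X ^ δ := by positivity
  rw [h1, abs_le]
  constructor
  · linarith
  · linarith

/-- If n ≥ 2 C X, then v/n is within 1/2 of 1 and the difference is log(v/n) = O(X/n). Otherwise |v|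
≤ 3 C X, so X/|v| is bounded below and X^δ (X/|v|)^(1−δ) absorbs both logarithms separately. The
exponent δ + (1 − δ) is left unsimplified to show this splitting. -/
theorem abs_log_div_sq_sub_le {δ : ℝ} (hδ : 0 < δ) (hδ1 : δ ≤ 1 / 2) {C X v n : ℝ} (hC : 1 ≤ C)
    (hX : 1 ≤ X) (hv : v ≠ 0) (hvX : |v| ≤ C * X ^ 2) (hn : 1 ≤ n) (hnX : n ≤ C * X ^ 2)
    (hvn : |v - n| ≤ C * X) :
    |Real.log (v / X ^ 2) - (Real.log n - 2 * Real.log X)| ≤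
      (4 * C + 3 * C * (2 * C + 6 / δ) + 2) * X ^ (δ + (1 - δ)) * |v| ^ (-(1 - δ)) := by
  have hX0 : 0 < X := by linarith
  have hC0 : 0 < C := by linarith
  have hn0 : 0 < n := by linarith
  have hv0 : 0 < |v| := abs_pos.2 hv
  have hX1 : 1 ≤ X ^ δ := Real.one_le_rpow hX hδ.le
  have hlogX : Real.log X ≤ X ^ δ / δ := Real.log_le_rpow_div hX0.le hδ
  have hlogX0 : 0 ≤ Real.log X := Real.log_nonneg hX
  have hvn' : |v| ≤ n + C * X := by
    have := abs_sub_abs_le_abs_sub v n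
    rw [abs_of_pos hn0] at this
    linarith
  rw [Real.rpow_add hX0]
  have hW : X ^ (1 - δ) * |v| ^ (-(1 - δ)) = (X / |v|) ^ (1 - δ) := by
    rw [Real.rpow_neg hv0.le, Real.div_rpow hX0.le hv0.le, div_eq_mul_inv]
  have hWpos : 0 < (X / |v|) ^ (1 - δ) := by positivity
  have hRHS : (4 * C + 3 * C * (2 * C + 6 / δ) + 2) * (X ^ δ * X ^ (1 - δ)) * |v| ^ (-(1 - δ)) =
      4 * C * (X ^ δ * (X / |v|) ^ (1 - δ)) +
        3 * C * ((2 * C + 6 / δ) * X ^ δ * (X / |v|) ^ (1 - δ)) +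
        2 * (X ^ δ * (X / |v|) ^ (1 - δ)) := by
    rw [← hW]; ring
  rw [hRHS]
  have hXW : (X / |v|) ^ (1 - δ) ≤ X ^ δ * (X / |v|) ^ (1 - δ) :=
    le_mul_of_one_le_left hWpos.le hX1
  rcases le_or_gt (2 * C * X) n with h | h
  · have hu : |v / n - 1| ≤ C * X / n := by
      rw [div_sub_one hn0.ne', abs_div, abs_of_pos hn0]
      gcongr
    have hu2 : C * X / n ≤ 1 / 2 := by
      rw [div_le_div_iff₀ hn0 two_pos]
      linarith
    have h1 := abs_log_le_two_mul (hu.trans hu2)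
    have h2 : Real.log (v / X ^ 2) - (Real.log n - 2 * Real.log X) = Real.log (v / n) := by
      rw [Real.log_div hv (by positivity), Real.log_div hv hn0.ne', Real.log_pow]
      push_cast
      ring
    have h3 : X / n ≤ 1 := (div_le_one hn0).2 (by nlinarith)
    have h4 : X / n ≤ 2 * (X / |v|) := by
      rw [← mul_div_assoc, div_le_div_iff₀ hn0 hv0]
      nlinarith
    have h5 : X / n ≤ 2 * (X / |v|) ^ (1 - δ) := by
      calc X / n = (X / n) ^ (1 : ℝ) := (Real.rpow_one _).symm
        _ ≤ (X / n) ^ (1 - δ) :=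
            Real.rpow_le_rpow_of_exponent_ge (by positivity) h3 (by linarith)
        _ ≤ (2 * (X / |v|)) ^ (1 - δ) := Real.rpow_le_rpow (by positivity) h4 (by linarith)
        _ = (2 : ℝ) ^ (1 - δ) * (X / |v|) ^ (1 - δ) := Real.mul_rpow (by norm_num) (by positivity)
        _ ≤ (2 : ℝ) ^ (1 : ℝ) * (X / |v|) ^ (1 - δ) := by
            refine mul_le_mul_of_nonneg_right ?_ hWpos.le
            exact Real.rpow_le_rpow_of_exponent_le (by norm_num) (by linarith)
        _ = _ := by rw [Real.rpow_one]
    rw [h2]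
    have h6 : C * X / n ≤ C * (2 * (X / |v|) ^ (1 - δ)) := by
      rw [mul_div_assoc]
      exact mul_le_mul_of_nonneg_left h5 hC0.le
    have h7 := mul_le_mul_of_nonneg_left hXW hC0.le
    have : 0 ≤ 3 * C * ((2 * C + 6 / δ) * X ^ δ * (X / |v|) ^ (1 - δ)) := by positivity
    have : 0 ≤ 2 * (X ^ δ * (X / |v|) ^ (1 - δ)) := by positivity
    linarith
  · have h1 := abs_log_div_sq_le hδ hδ1 hC hX hv hvX
    have h2 : 0 ≤ Real.log n := Real.log_nonneg hn
    have h3 : Real.log n ≤ C + 2 * Real.log X := by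
      have h := Real.log_le_log hn0 hnX
      rw [Real.log_mul (by positivity) (by positivity), Real.log_pow] at h
      have := Real.log_le_sub_one_of_pos hC0
      push_cast at h
      linarith
    have h4 : |Real.log n - 2 * Real.log X| ≤ C + 4 * Real.log X := abs_le.2 ⟨by linarith, by linarith⟩
    have h5 : 4 * Real.log X ≤ 4 / δ * X ^ δ := by
      calc 4 * Real.log X ≤ 4 * (X ^ δ / δ) := by linarith
        _ = _ := by ring
    have h6 : C ≤ C * X ^ δ := le_mul_of_one_le_right hC0.le hX1
    have h7 : 1 ≤ 3 * C * (X / |v|) ^ (1 - δ) := by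
      have h8 : 1 / (3 * C) ≤ X / |v| := by
        rw [div_le_div_iff₀ (by positivity) hv0]
        linarith
      have h9 : 1 / (3 * C) ≤ (X / |v|) ^ (1 - δ) := by
        calc 1 / (3 * C) = (1 / (3 * C)) ^ (1 : ℝ) := (Real.rpow_one _).symm
          _ ≤ (1 / (3 * C)) ^ (1 - δ) := by
              refine Real.rpow_le_rpow_of_exponent_ge (by positivity) ?_ (by linarith)
              rw [div_le_one (by positivity)]
              linarith
          _ ≤ _ := Real.rpow_le_rpow (by positivity) h8 (by linarith)
      rw [div_le_iff₀ (by positivity)] at h9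
      linarith
    have h8 : |v| ^ (-(1 - δ)) ≤ (X / |v|) ^ (1 - δ) := by
      rw [← hW]
      exact le_mul_of_one_le_left (by positivity) (Real.one_le_rpow hX (by linarith))
    have h9 : (2 * C + 6 / δ) * X ^ δ ≤
        3 * C * ((2 * C + 6 / δ) * X ^ δ * (X / |v|) ^ (1 - δ)) := by
      calc _ ≤ (2 * C + 6 / δ) * X ^ δ * (3 * C * (X / |v|) ^ (1 - δ)) :=
            le_mul_of_one_le_right (by positivity) h7
        _ = _ := by ring
    have h10 := abs_sub (Real.log (v / X ^ 2)) (Real.log n - 2 * Real.log X)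
    have h11 : 0 ≤ 4 * C * (X ^ δ * (X / |v|) ^ (1 - δ)) := by positivity
    have h12 : (2 * C + 6 / δ) * X ^ δ =
      (C + 2 / δ) * X ^ δ + C * X ^ δ + 4 / δ * X ^ δ := by ring
    linarith

/-- Bernoulli's inequality for (N/X)^l. -/
theorem pow_sub_pow_le_mul {X N : ℝ} (hN : 0 ≤ N) (hX : 1 ≤ X) (hXN : X ≤ N + 1)
    (l : ℕ) : X ^ l - N ^ l ≤ l * X ^ ((l : ℝ) - 1) := by
  have hX0 : 0 < X := by linarith
  have h1 := one_add_mul_le_pow (a := N / X - 1) (by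
    have : 0 ≤ N / X := by positivity
    linarith) l
  rw [add_sub_cancel, div_pow] at h1
  have h2 : X ^ l * (1 + l * (N / X - 1)) ≤ N ^ l := by
    have := mul_le_mul_of_nonneg_left h1 (show 0 ≤ X ^ l by positivity)
    rwa [mul_div_cancel₀ _ (by positivity)] at this
  have h3 : X ^ ((l : ℝ) - 1) = X ^ l / X := by
    rw [Real.rpow_sub_one hX0.ne', Real.rpow_natCast]
  have h4 : X ^ l * (1 + l * (N / X - 1)) = X ^ l - l * (X ^ l / X) * (X - N) := by
    field_simp
    ring
  rw [h3]
  have h5 : (l : ℝ) * (X ^ l / X) * (X - N) ≤ l * (X ^ l / X) :=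
    mul_le_of_le_one_right (by positivity) (by linarith)
  linarith

namespace IntQuadPoly

variable {l : ℕ} (F : IntQuadPoly l)

open Finset

theorem volume_cubeSet_sdiff {N : ℕ} {X : ℝ} (hX : 1 ≤ X) (hN : (N : ℝ) ≤ X) (hXN : X ≤ N + 1) :
    volume ((Set.univ.pi fun _ : Fin l => Set.Icc (0 : ℝ) X) \
      (Set.univ.pi fun _ : Fin l => Set.Ico (0 : ℝ) N)) ≤
      ENNReal.ofReal (l * X ^ ((l : ℝ) - 1)) := by
  have hsub : (Set.univ.pi fun _ : Fin l => Set.Ico (0 : ℝ) N) ⊆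
      Set.univ.pi fun _ : Fin l => Set.Icc (0 : ℝ) X :=
    Set.pi_mono fun i _ y hy => ⟨hy.1, hy.2.le.trans hN⟩
  have h1 : volume (Set.univ.pi fun _ : Fin l => Set.Icc (0 : ℝ) X) = ENNReal.ofReal (X ^ l) := by
    rw [volume_pi_pi]
    simp [ENNReal.ofReal_pow (show 0 ≤ X by linarith)]
  have h2 : volume (Set.univ.pi fun _ : Fin l => Set.Ico (0 : ℝ) N) =
      ENNReal.ofReal ((N : ℝ) ^ l) := by
    rw [volume_pi_pi]
    simp
  rw [measure_sdiff hsub (MeasurableSet.univ_pi fun _ => measurableSet_Ico).nullMeasurableSet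
    (by rw [h2]; exact ENNReal.ofReal_ne_top), h1, h2, ← ENNReal.ofReal_sub _ (by positivity)]
  exact ENNReal.ofReal_le_ofReal (pow_sub_pow_le_mul (by positivity) hX hXN l)

/-- The cubes tile [0, N)^l, and on the cube of x the error of log F(x) is O(X |F(y)|^(−(1−δ))),
which integrates to O(X^(l−1+2δ)). The shell up to [0, X]^l has volume O(X^(l−1)). F may change sign
inside a cube: `Real.log` is then log |F|, and at zeros of F the bound is infinite. -/
theorem exists_sum_log_box (hl : 2 ≤ l) (hF : F.discr ≠ 0) {δ : ℝ} (hδ : 0 < δ)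
    (hδ1 : δ ≤ 1 / 2) :
    ∃ C : ℝ, 0 < C ∧ ∀ X : ℝ, 1 ≤ X → ∀ N : ℕ, (N : ℝ) ≤ X → X ≤ N + 1 →
      (∀ x ∈ box l N, 0 < F.eval x) →
        IntegrableOn (fun y : Fin l → ℝ => Real.log (F.eval y / X ^ 2))
          (Set.univ.pi fun _ => Set.Icc 0 X) ∧
        |∑ x ∈ box l N, (Real.log (F.eval x : ℤ) - 2 * Real.log X) -
          ∫ y in Set.univ.pi fun _ : Fin l => Set.Icc 0 X, Real.log (F.eval y / X ^ 2)| ≤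
            C * X ^ ((l : ℝ) - 1 + 2 * δ) := by
  obtain ⟨C₁, hC₁, hLip, hsize⟩ := F.exists_eval_bounds
  obtain ⟨C₂, hC₂, hint⟩ := F.exists_lintegral_enorm_eval_rpow_le hl hF (s := 1 - δ)
    (by linarith) (by linarith)
  obtain ⟨a, ha⟩ : ∃ a : ℝ, a = C₁ + 2 / δ := ⟨_, rfl⟩
  obtain ⟨b, hb⟩ : ∃ b : ℝ, b = 4 * C₁ + 3 * C₁ * (2 * C₁ + 6 / δ) + 2 := ⟨_, rfl⟩
  have ha0 : 0 < a := by rw [ha]; positivity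
  have hb0 : 0 < b := by rw [hb]; positivity
  refine ⟨b * C₂ + (a * l + 2 * C₂), by positivity, fun X hX N hN hXN hpos => ?_⟩
  have hX0 : 0 < X := by linarith
  set S : Set (Fin l → ℝ) := Set.univ.pi fun _ => Set.Icc 0 X with hS
  set U : Set (Fin l → ℝ) := Set.univ.pi fun _ => Set.Ico (0 : ℝ) N with hU
  have hSm : MeasurableSet S := MeasurableSet.univ_pi fun _ => measurableSet_Icc
  have hUm : MeasurableSet U := MeasurableSet.univ_pi fun _ => measurableSet_Ico
  have hUS : U ⊆ S := Set.pi_mono fun i _ y hy => ⟨hy.1, hy.2.le.trans hN⟩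
  have hSB : S ⊆ Set.univ.pi fun _ : Fin l => Set.Icc (-X) X :=
    Set.pi_mono fun i _ => Set.Icc_subset_Icc_left (by linarith)
  have hbd : ∀ y ∈ S, |F.eval y| ≤ C₁ * X ^ 2 := fun y hy => hsize X hX y fun i => by
    have := hy i (Set.mem_univ i)
    rw [abs_of_nonneg this.1]
    exact this.2
  set G : (Fin l → ℝ) → ℝ := fun y => Real.log (F.eval y / X ^ 2) with hG
  have hGm : Measurable G := Real.measurable_log.comp (by fun_prop)
  have hA : ∀ y ∈ S, ‖G y‖ₑ ≤ ENNReal.ofReal (a * X ^ δ) + 2 * ‖F.eval y‖ₑ ^ (-(1 - δ)) := by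
    intro y hy
    by_cases h0 : F.eval y = 0
    · rw [h0, enorm_zero, ENNReal.zero_rpow_of_neg (by linarith), ENNReal.mul_top (by simp),
        add_top]
      exact le_top
    rw [enorm_rpow_eq_ofReal h0, ← ENNReal.ofReal_ofNat, ← ENNReal.ofReal_mul (by norm_num),
      ← ENNReal.ofReal_add (by positivity) (by positivity), ← ofReal_norm, ha]
    exact ENNReal.ofReal_le_ofReal (abs_log_div_sq_le hδ hδ1 hC₁ hX h0 (hbd y hy))
  have hB : ∀ x ∈ box l N, ∀ y ∈ cube x,
      ‖G y - (Real.log (F.eval x : ℤ) - 2 * Real.log X)‖ₑ ≤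
        ENNReal.ofReal (b * X) * ‖F.eval y‖ₑ ^ (-(1 - δ)) := by
    intro x hx y hy
    have hyS : y ∈ S := hUS (by
      rw [hU, ← biUnion_cube]
      exact Set.mem_biUnion hx hy)
    by_cases h0 : F.eval y = 0
    · rw [h0, enorm_zero, ENNReal.zero_rpow_of_neg (by linarith),
        ENNReal.mul_top (by simpa using by positivity)]
      exact le_top
    rw [enorm_rpow_eq_ofReal h0, ← ENNReal.ofReal_mul (by positivity), ← ofReal_norm]
    refine ENNReal.ofReal_le_ofReal ?_
    have := abs_log_div_sq_sub_le hδ hδ1 hC₁ hX h0 (hbd y hyS) (n := (F.eval x : ℤ))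
      (by exact_mod_cast hpos x hx) ?_ (F.abs_sub_le_of_mem_cube hLip hX hN hx hy)
    · rw [← hb, add_sub_cancel, Real.rpow_one] at this
      exact this
    · have h := hsize X hX (fun i => (x i : ℝ)) fun i => by
        have h2 := mem_box.1 hx i
        have h3 : (1 : ℝ) ≤ x i := by exact_mod_cast h2.1
        have h4 : (x i : ℝ) ≤ N := by exact_mod_cast h2.2
        rw [abs_of_nonneg (by linarith)]
        linarith
      rw [F.eval_intCast] at h
      exact (le_abs_self _).trans h
  set W := ∫⁻ y in Set.univ.pi fun _ : Fin l => Set.Icc (-X) X, ‖F.eval y‖ₑ ^ (-(1 - δ)) with hW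
  have hWle : W ≤ ENNReal.ofReal (C₂ * X ^ ((l : ℝ) - 2 * (1 - δ))) := hint X hX
  have hrest : ∀ V ⊆ S, MeasurableSet V → ∫⁻ y in V, ‖G y‖ₑ ≤
      ENNReal.ofReal (a * X ^ δ) * volume V + 2 * W := by
    intro V hV hVm
    calc ∫⁻ y in V, ‖G y‖ₑ
        ≤ ∫⁻ y in V, (ENNReal.ofReal (a * X ^ δ) + 2 * ‖F.eval y‖ₑ ^ (-(1 - δ))) :=
          setLIntegral_mono' hVm fun y hy => hA y (hV hy)
      _ = ENNReal.ofReal (a * X ^ δ) * volume V + 2 * ∫⁻ y in V, ‖F.eval y‖ₑ ^ (-(1 - δ)) := by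
          rw [lintegral_add_left (by fun_prop), setLIntegral_const, lintegral_const_mul _
            (by fun_prop)]
      _ ≤ _ := by
          gcongr
          exact lintegral_mono_set (hV.trans hSB)
  have hSvol : volume S ≠ ⊤ := by
    rw [hS, volume_pi_pi]
    simp
  have hGint : IntegrableOn G S := by
    refine ⟨hGm.aestronglyMeasurable, ?_⟩
    refine (hrest S subset_rfl hSm).trans_lt ?_
    exact ENNReal.add_lt_top.2 ⟨ENNReal.mul_lt_top ENNReal.ofReal_lt_top hSvol.lt_top,
      ENNReal.mul_lt_top (by simp) (hWle.trans_lt ENNReal.ofReal_lt_top)⟩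
  refine ⟨hGint, ?_⟩
  have hcubeS : ∀ x ∈ box l N, cube x ⊆ S := fun x hx => by
    refine subset_trans ?_ hUS
    rw [hU, ← biUnion_cube]
    exact Set.subset_biUnion_of_mem hx
  have hsplit : ∑ x ∈ box l N, (Real.log (F.eval x : ℤ) - 2 * Real.log X) - ∫ y in S, G y =
      -((∑ x ∈ box l N, ∫ y in cube x, (G y - (Real.log (F.eval x : ℤ) - 2 * Real.log X))) +
        ∫ y in S \ U, G y) := by
    have h1 : ∫ y in U, G y = ∑ x ∈ box l N, ∫ y in cube x, G y := by
      rw [hU, ← biUnion_cube]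
      exact integral_biUnion_finset _ (fun x _ => measurableSet_cube x)
        (pairwiseDisjoint_cube _) fun x hx => hGint.mono_set (hcubeS x hx)
    have h2 : ∀ x ∈ box l N, ∫ y in cube x, (G y - (Real.log (F.eval x : ℤ) - 2 * Real.log X)) =
        (∫ y in cube x, G y) - (Real.log (F.eval x : ℤ) - 2 * Real.log X) := by
      intro x hx
      rw [integral_sub (hGint.mono_set (hcubeS x hx))
        (integrableOn_const (by simp [volume_cube]) (by simp)), setIntegral_const,
        measureReal_def, volume_cube]
      simp
    rw [sum_congr rfl h2, sum_sub_distrib (fun x => ∫ y in cube x, G y), ← h1, setIntegral_sdiff hUm hGint hUS]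
    ring
  rw [hsplit, abs_neg, ← ENNReal.ofReal_le_ofReal_iff (by positivity), ← Real.norm_eq_abs,
    ofReal_norm]
  calc _ ≤ (∑ x ∈ box l N, ‖∫ y in cube x, (G y - (Real.log (F.eval x : ℤ) - 2 * Real.log X))‖ₑ) +
        ‖∫ y in S \ U, G y‖ₑ :=
        (enorm_add_le _ _).trans (add_le_add_left (enorm_sum_le _ _) _)
    _ ≤ ENNReal.ofReal (b * X) * W + (ENNReal.ofReal (a * X ^ δ) *
          ENNReal.ofReal (l * X ^ ((l : ℝ) - 1)) + 2 * W) := by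
        refine add_le_add ?_ ?_
        · rw [hW, ← lintegral_const_mul _ (by fun_prop)]
          refine sum_box_le_lintegral _ hN _ fun x hx => ?_
          exact (enorm_integral_le_lintegral_enorm _).trans
            (setLIntegral_mono' (measurableSet_cube x) (hB x hx))
        · refine (enorm_integral_le_lintegral_enorm _).trans
            ((hrest _ Set.sdiff_subset (hSm.diff hUm)).trans ?_)
          gcongr
          exact volume_cubeSet_sdiff hX hN hXN
    _ ≤ ENNReal.ofReal (b * X) * ENNReal.ofReal (C₂ * X ^ ((l : ℝ) - 2 * (1 - δ))) +
          (ENNReal.ofReal (a * X ^ δ) * ENNReal.ofReal (l * X ^ ((l : ℝ) - 1)) +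
            ENNReal.ofReal 2 * ENNReal.ofReal (C₂ * X ^ ((l : ℝ) - 2 * (1 - δ)))) := by
        rw [ENNReal.ofReal_ofNat]
        gcongr
    _ = ENNReal.ofReal (b * X * (C₂ * X ^ ((l : ℝ) - 2 * (1 - δ))) +
          (a * X ^ δ * (l * X ^ ((l : ℝ) - 1)) + 2 * (C₂ * X ^ ((l : ℝ) - 2 * (1 - δ))))) := by
        rw [← ENNReal.ofReal_mul (by positivity), ← ENNReal.ofReal_mul (by positivity),
          ← ENNReal.ofReal_mul (by positivity), ← ENNReal.ofReal_add (by positivity)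
          (by positivity), ← ENNReal.ofReal_add (by positivity) (by positivity)]
    _ ≤ _ := by
        refine ENNReal.ofReal_le_ofReal ?_
        have e1 : X * X ^ ((l : ℝ) - 2 * (1 - δ)) = X ^ ((l : ℝ) - 1 + 2 * δ) := by
          nth_rewrite 1 [← Real.rpow_one X]
          rw [← Real.rpow_add hX0]
          congr 1
          ring
        have e2 : X ^ δ * X ^ ((l : ℝ) - 1) ≤ X ^ ((l : ℝ) - 1 + 2 * δ) := by
          rw [← Real.rpow_add hX0]
          exact Real.rpow_le_rpow_of_exponent_le hX (by linarith)
        have e3 : X ^ ((l : ℝ) - 2 * (1 - δ)) ≤ X ^ ((l : ℝ) - 1 + 2 * δ) :=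
          Real.rpow_le_rpow_of_exponent_le hX (by linarith)
        calc _ = b * C₂ * (X * X ^ ((l : ℝ) - 2 * (1 - δ))) +
              (a * l * (X ^ δ * X ^ ((l : ℝ) - 1)) + 2 * C₂ * X ^ ((l : ℝ) - 2 * (1 - δ))) := by
              ring
          _ ≤ b * C₂ * X ^ ((l : ℝ) - 1 + 2 * δ) + (a * l * X ^ ((l : ℝ) - 1 + 2 * δ) +
              2 * C₂ * X ^ ((l : ℝ) - 1 + 2 * δ)) := by
              rw [e1]
              gcongr
          _ = _ := by ring

theorem scaled_eq {X : ℝ} (hX : X ≠ 0) (t : Fin l → ℝ) : F.scaled X t = F.eval (X • t) / X ^ 2 := by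
  rw [eq_div_iff (pow_ne_zero 2 hX), scaled, eval, add_mul, add_mul, div_mul_cancel₀ _ (by positivity),
    sum_mul, sum_mul]
  congr 2
  · refine sum_congr rfl fun i _ => ?_
    rw [sum_mul]
    refine sum_congr rfl fun j _ => ?_
    simp only [Pi.smul_apply, smul_eq_mul]
    ring
  · refine sum_congr rfl fun i _ => ?_
    simp only [Pi.smul_apply, smul_eq_mul]
    field_simp

/-- The sum of `log F(x)` over a box in terms of the logarithmic integral. -/
theorem exists_sum_log (hl : 2 ≤ l) (hF : F.discr ≠ 0) {δ : ℝ} (hδ : 0 < δ) (hδ1 : δ ≤ 1 / 2) :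
    ∃ C : ℝ, 0 < C ∧ ∀ X : ℝ, 1 ≤ X → ∀ N : ℕ, (N : ℝ) ≤ X → X ≤ N + 1 →
      (∀ x ∈ box l N, 0 < F.eval x) →
        IntegrableOn (fun t => Real.log (F.scaled X t)) (Set.Icc (0 : Fin l → ℝ) 1) ∧
        |∑ x ∈ box l N, Real.log (F.eval x : ℤ) -
          (2 * (N : ℝ) ^ l * Real.log X + X ^ l * F.logIntegral X)| ≤
            C * X ^ ((l : ℝ) - 1 + 2 * δ) := by
  obtain ⟨C, hC, h⟩ := F.exists_sum_log_box hl hF hδ hδ1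
  refine ⟨C, hC, fun X hX N hN hXN hpos => ?_⟩
  have hX0 : 0 < X := by linarith
  obtain ⟨h1, h2⟩ := h X hX N hN hXN hpos
  set S : Set (Fin l → ℝ) := Set.univ.pi fun _ => Set.Icc 0 X with hS
  have hSm : MeasurableSet S := MeasurableSet.univ_pi fun _ => measurableSet_Icc
  have hmem : ∀ t : Fin l → ℝ, X • t ∈ S ↔ t ∈ Set.Icc (0 : Fin l → ℝ) 1 := by
    intro t
    simp only [hS, Set.mem_univ_pi, Set.mem_Icc, Pi.smul_apply, smul_eq_mul, Pi.le_def,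
      Pi.zero_apply, Pi.one_apply, ← forall_and]
    refine forall_congr' fun i => and_congr ?_ ?_
    · exact mul_nonneg_iff_of_pos_left hX0
    · exact mul_le_iff_le_one_right hX0
  have hind : ∀ t, S.indicator (fun y => Real.log (F.eval y / X ^ 2)) (X • t) =
      (Set.Icc (0 : Fin l → ℝ) 1).indicator (fun t => Real.log (F.scaled X t)) t := by
    intro t
    by_cases ht : t ∈ Set.Icc (0 : Fin l → ℝ) 1
    · rw [Set.indicator_of_mem ht, Set.indicator_of_mem ((hmem t).2 ht), F.scaled_eq hX0.ne']
    · rw [Set.indicator_of_notMem ht, Set.indicator_of_notMem (fun h => ht ((hmem t).1 h))]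
  have hm1 : MeasurableSet (Set.Icc (0 : Fin l → ℝ) 1) := measurableSet_Icc
  constructor
  · rw [← integrable_indicator_iff hm1]
    rw [← integrable_indicator_iff hSm] at h1
    simpa only [hind] using h1.comp_smul hX0.ne'
  · have hI : X ^ l * F.logIntegral X = ∫ y in S, Real.log (F.eval y / X ^ 2) := by
      rw [logIntegral, ← integral_indicator hm1, ← integral_indicator hSm]
      simp only [← hind]
      rw [Measure.integral_comp_smul]
      simp only [Module.finrank_fintype_fun_eq_card, Fintype.card_fin, smul_eq_mul]
      rw [abs_of_pos (by positivity), mul_inv_cancel_left₀ (by positivity)]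
    rw [hI]
    rw [sum_sub_distrib, sum_const, card_box] at h2
    refine le_of_eq_of_le ?_ h2
    congr 1
    simp only [nsmul_eq_mul]
    push_cast
    ring

end IntQuadPoly

/-! ### The divisor bound. -/

namespace Nat

open Finset

/-- The divisor bound. -/
theorem exists_card_divisors_le {δ : ℝ} (hδ : 0 < δ) :
    ∃ C : ℝ, 1 ≤ C ∧ ∀ n : ℕ, n ≠ 0 → (#n.divisors : ℝ) ≤ C * (n : ℝ) ^ δ := by
  obtain ⟨K, hK⟩ : ∃ K : ℝ, K = 1 + 1 / (δ * Real.log 2) := ⟨_, rfl⟩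
  have hlog : 0 < Real.log 2 := Real.log_pos one_lt_two
  have hK1 : 1 ≤ K := by
    rw [hK]
    have : 0 < 1 / (δ * Real.log 2) := by positivity
    linarith
  -- Primes p ≥ P have p^δ ≥ 2, so a + 1 ≤ 2^a ≤ p^(δa) without loss. Each smaller prime loses at
  -- most K, which is chosen so that a + 1 ≤ K (1 + a δ log 2) ≤ K p^(δa).
  obtain ⟨P, hP⟩ := exists_nat_ge ((2 : ℝ) ^ δ⁻¹)
  refine ⟨K ^ P, one_le_pow₀ hK1, fun n hn => ?_⟩
  have hlocal : ∀ p ∈ n.primeFactors, ((n.factorization p + 1 : ℕ) : ℝ) ≤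
      (if p < P then K else 1) * ((p ^ n.factorization p : ℕ) : ℝ) ^ δ := by
    intro p hp
    have hp2 : (2 : ℝ) ≤ p := by exact_mod_cast (Nat.prime_of_mem_primeFactors hp).two_le
    generalize n.factorization p = a
    have e : ((p ^ a : ℕ) : ℝ) ^ δ = ((p : ℝ) ^ δ) ^ a := by
      push_cast
      rw [← Real.rpow_natCast, ← Real.rpow_natCast, ← Real.rpow_mul (by positivity),
        ← Real.rpow_mul (by positivity), mul_comm]
    rw [e]
    split_ifs with h
    · have h1 : 1 + δ * Real.log 2 ≤ (p : ℝ) ^ δ := by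
        calc 1 + δ * Real.log 2 ≤ Real.exp (δ * Real.log 2) := by
              rw [add_comm]; exact Real.add_one_le_exp _
          _ = (2 : ℝ) ^ δ := by rw [Real.rpow_def_of_pos two_pos, mul_comm]
          _ ≤ _ := Real.rpow_le_rpow (by norm_num) hp2 hδ.le
      have hd : 0 < δ * Real.log 2 := by positivity
      have h2 : 1 + a * (δ * Real.log 2) ≤ ((p : ℝ) ^ δ) ^ a :=
        (one_add_mul_le_pow (by linarith) a).trans (by gcongr)
      have h3 : (a : ℝ) = 1 / (δ * Real.log 2) * (a * (δ * Real.log 2)) := by field_simp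
      have h4 : 0 < 1 / (δ * Real.log 2) := by positivity
      have h5 : 0 ≤ a * (δ * Real.log 2) := by positivity
      push_cast
      calc (a : ℝ) + 1 = 1 / (δ * Real.log 2) * (a * (δ * Real.log 2)) + 1 := by rw [← h3]
        _ ≤ K * (1 + a * (δ * Real.log 2)) := by
            rw [hK]
            nlinarith
        _ ≤ _ := mul_le_mul_of_nonneg_left h2 (by linarith)
    · have h1 : (2 : ℝ) ≤ (p : ℝ) ^ δ := by
        have hPp : (2 : ℝ) ^ δ⁻¹ ≤ p := hP.trans (by exact_mod_cast not_lt.1 h)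
        calc (2 : ℝ) = ((2 : ℝ) ^ δ⁻¹) ^ δ := by
              rw [← Real.rpow_mul (by norm_num), inv_mul_cancel₀ hδ.ne', Real.rpow_one]
          _ ≤ _ := Real.rpow_le_rpow (by positivity) hPp hδ.le
      rw [one_mul]
      calc ((a + 1 : ℕ) : ℝ) ≤ ((2 ^ a : ℕ) : ℝ) := by exact_mod_cast Nat.lt_two_pow_self
        _ = (2 : ℝ) ^ a := by push_cast; rfl
        _ ≤ _ := by gcongr
  rw [Nat.card_divisors hn]
  push_cast
  have hn' : (n : ℝ) ^ δ = ∏ p ∈ n.primeFactors, ((p ^ n.factorization p : ℕ) : ℝ) ^ δ := by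
    rw [Real.finsetProd_rpow _ _ (fun i _ => by positivity), ← Nat.cast_prod]
    congr 2
    exact (Nat.prod_factorization_pow_eq_self hn).symm
  calc ∏ p ∈ n.primeFactors, ((n.factorization p : ℝ) + 1)
      ≤ ∏ p ∈ n.primeFactors,
          ((if p < P then K else 1) * ((p ^ n.factorization p : ℕ) : ℝ) ^ δ) :=
        prod_le_prod (fun _ _ => by positivity) fun p hp => by exact_mod_cast hlocal p hp
    _ = (∏ p ∈ n.primeFactors, if p < P then K else 1) * (n : ℝ) ^ δ := by
        rw [prod_mul_distrib, ← hn']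
    _ ≤ _ := by
        refine mul_le_mul_of_nonneg_right ?_ (by positivity)
        rw [prod_ite, prod_const, prod_const_one, mul_one]
        refine pow_le_pow_right₀ hK1 ?_
        calc _ ≤ #(range P) := card_le_card fun p hp => by
              simpa using (mem_filter.1 hp).2
          _ = P := card_range P

end Nat

/-! ### Mean values over short cells and the large moduli. -/

namespace IntQuadPoly

variable {l : ℕ} (F : IntQuadPoly l)

open Finset

theorem card_Icc_filter_zmod_le {q : ℕ} (hq : 0 < q) (T : ℕ) (z : ZMod q) :
    (#((Icc (1 : ℤ) T).filter fun x : ℤ => (x : ZMod q) = z) : ℝ) ≤ (T : ℝ) / q + 1 := by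
  have hq' : (0 : ℤ) < q := by exact_mod_cast hq
  have h1 : (Icc (1 : ℤ) T).filter (fun x : ℤ => (x : ZMod q) = z) =
      (Ioc (0 : ℤ) T).filter fun x : ℤ => x ≡ z.cast [ZMOD q] := by
    ext x
    simp only [mem_filter, mem_Icc, mem_Ioc, ← ZMod.intCast_eq_intCast_iff, ZMod.intCast_cast,
      ZMod.cast_id', id]
    exact and_congr_left fun _ => Iff.rfl
  have h2 := Int.Ioc_filter_modEq_card 0 (T : ℤ) hq' (z.cast : ℤ)
  rw [h1]
  have h3 : (#((Ioc (0 : ℤ) T).filter fun x : ℤ => x ≡ z.cast [ZMOD q]) : ℝ) =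
      ((max (⌊((T : ℤ) - z.cast : ℤ) / (q : ℚ)⌋ - ⌊((0 : ℤ) - z.cast : ℤ) / (q : ℚ)⌋) 0 : ℤ) : ℝ) := by
    rw [← Int.cast_natCast]
    exact_mod_cast congrArg (Int.cast : ℤ → ℝ) h2
  rw [h3]
  have h4 : ((max (⌊((T : ℤ) - z.cast : ℤ) / (q : ℚ)⌋ - ⌊((0 : ℤ) - z.cast : ℤ) / (q : ℚ)⌋) 0 : ℤ) : ℚ)
      ≤ T / q + 1 := by
    rw [Int.cast_max, max_le_iff]
    constructor
    · have h5 := Int.floor_le ((((T : ℤ) - z.cast : ℤ) : ℚ) / (q : ℚ))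
      have h6 := Int.lt_floor_add_one ((((0 : ℤ) - z.cast : ℤ) : ℚ) / (q : ℚ))
      push_cast at h5 h6 ⊢
      have h7 : ((T : ℚ) - (z.cast : ℤ)) / q = T / q + (0 - (z.cast : ℤ)) / q := by ring
      rw [h7] at h5 ⊢
      linarith
    · push_cast
      positivity
  generalize max (⌊((T : ℤ) - z.cast : ℤ) / (q : ℚ)⌋ - ⌊((0 : ℤ) - z.cast : ℤ) / (q : ℚ)⌋) 0 = w at h4
  have h5 := (Rat.cast_le (K := ℝ)).2 h4
  push_cast at h5
  exact h5

/-- Each residue class modulo q meets [1, T]^l in at most (T/q + 1)^l points. -/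
theorem sum_box_zmod_le {q : ℕ} [NeZero q] (T : ℕ) (φ : (Fin l → ZMod q) → ℝ) (hφ : ∀ z, 0 ≤ φ z) :
    ∑ t ∈ box l T, φ (fun i => (t i : ZMod q)) ≤ ((T : ℝ) / q + 1) ^ l * ∑ z, φ z := by
  rw [← sum_fiberwise (s := box l T) (g := fun t i => (t i : ZMod q)), mul_sum]
  refine sum_le_sum fun z _ => ?_
  rw [sum_congr rfl (g := fun _ => φ z) fun t ht => by rw [(mem_filter.1 ht).2], sum_const,
    nsmul_eq_mul]
  refine mul_le_mul_of_nonneg_right ?_ (hφ z)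
  have h : (box l T).filter (fun t => (fun i => (t i : ZMod q)) = z) =
      Fintype.piFinset fun i => (Icc (1 : ℤ) T).filter fun x : ℤ => (x : ZMod q) = z i := by
    ext t
    simp only [box, mem_filter, Fintype.mem_piFinset, funext_iff, forall_and]
  rw [h, Fintype.card_piFinset]
  push_cast
  calc _ ≤ ∏ _i : Fin l, ((T : ℝ) / q + 1) := prod_le_prod (fun _ _ => by positivity) fun i _ =>
        card_Icc_filter_zmod_le (Nat.pos_of_ne_zero (NeZero.ne q)) T (z i)
    _ = _ := by simp

/-- The cell `[0, k)^l`. -/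
noncomputable def cell (l k : ℕ) : Finset (Fin l → ℤ) := Fintype.piFinset fun _ => Ico (0 : ℤ) k

theorem mem_cell {k : ℕ} {u : Fin l → ℤ} : u ∈ cell l k ↔ ∀ i, 0 ≤ u i ∧ u i < k := by
  simp [cell]

theorem card_cell (k : ℕ) : #(cell l k) = k ^ l := by simp [cell]

/-- The mean value of the sums of `c_q(F(t + u))` over short cells. -/
theorem sum_abs_sum_ramanujanSum_le (hF : F.discr ≠ 0) {q k : ℕ} (hk : k ≤ q) (hq : 0 < q)
    (T : ℕ) :
    ∑ t ∈ box l T, |∑ u ∈ cell l k, (ramanujanSum q (F.eval (t + u)) : ℝ)| ≤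
      q * √(((T : ℝ) * (T + q) * k * F.discr.natAbs) ^ l) := by
  have : NeZero q := ⟨hq.ne'⟩
  set U : Finset (Fin l → ZMod q) := (cell l k).image fun u i => (u i : ZMod q) with hU
  -- Since k ≤ q, the points of a cell stay distinct modulo q, so U has k^l elements.
  have hinj : Set.InjOn (fun (u : Fin l → ℤ) i => (u i : ZMod q)) (cell l k : Set (Fin l → ℤ)) := by
    intro u hu v hv huv
    ext i
    have h := congrFun huv i
    have hu := mem_cell.1 (mem_coe.1 hu) i
    have hv := mem_cell.1 (mem_coe.1 hv) i
    rw [ZMod.intCast_eq_intCast_iff_dvd_sub] at h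
    have h1 := Int.eq_zero_of_abs_lt_dvd h (by rw [abs_lt]; omega)
    omega
  have hUcard : #U = k ^ l := by rw [hU, card_image_of_injOn hinj, card_cell]
  set S : ZMod q → (Fin l → ZMod q) → ℝ := fun a t =>
    ‖∑ u ∈ U, ZMod.stdAddChar (a * F.eval (t + u))‖ with hS
  have hpt : ∀ t : Fin l → ℤ, |∑ u ∈ cell l k, (ramanujanSum q (F.eval (t + u)) : ℝ)| ≤
      ∑ a ∈ (range q).filter (fun a => Nat.Coprime a q), S a (fun i => (t i : ZMod q)) := by
    intro t
    have h1 : ((∑ u ∈ cell l k, (ramanujanSum q (F.eval (t + u)) : ℝ) : ℝ) : ℂ) =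
        ∑ a ∈ (range q).filter (fun a => Nat.Coprime a q), ∑ u ∈ U,
          ZMod.stdAddChar ((a : ZMod q) * F.eval ((fun i => (t i : ZMod q)) + u)) := by
      rw [sum_comm, hU, sum_image hinj]
      push_cast
      refine sum_congr rfl fun u _ => ?_
      rw [← ramanujanSum_eq_sum_stdAddChar]
      have h2 : F.eval ((fun i => (t i : ZMod q)) + fun i => (u i : ZMod q)) =
          ((F.eval (t + u) : ℤ) : ZMod q) := by
        rw [← F.eval_intCast]
        congr 1
        ext i
        simp
      rw [h2, ramanujanSum_zmod]
    rw [← Real.norm_eq_abs, ← Complex.norm_real, h1]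
    exact norm_sum_le _ _
  have hbound : ∀ a ∈ (range q).filter (fun a => Nat.Coprime a q),
      ∑ t ∈ box l T, S a (fun i => (t i : ZMod q)) ≤
        √(((T : ℝ) * (T + q) * k * F.discr.natAbs) ^ l) := by
    intro a ha
    refine Real.le_sqrt_of_sq_le ?_
    have hau : IsUnit (a : ZMod q) := (ZMod.isUnit_iff_coprime a q).2 (mem_filter.1 ha).2
    -- Cauchy–Schwarz in t, completion to all residues, then the mean-square bound: T^l (T/q + 1)^l
    -- q^l k^l = (T (T + q) k)^l.
    calc (∑ t ∈ box l T, S a (fun i => (t i : ZMod q))) ^ 2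
        ≤ #(box l T) * ∑ t ∈ box l T, S a (fun i => (t i : ZMod q)) ^ 2 :=
          sq_sum_le_card_mul_sum_sq
      _ ≤ (T : ℝ) ^ l * (((T : ℝ) / q + 1) ^ l * ∑ z, S a z ^ 2) := by
          rw [card_box]
          push_cast
          gcongr
          exact sum_box_zmod_le T (fun z => S a z ^ 2) fun z => sq_nonneg _
      _ ≤ (T : ℝ) ^ l * (((T : ℝ) / q + 1) ^ l *
            ((q : ℝ) ^ l * (k : ℝ) ^ l * (F.discr.natAbs : ℝ) ^ l)) := by
          gcongr
          have := F.sum_norm_sq_expSum_le hF hau U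
          rw [hUcard] at this
          push_cast at this
          exact this
      _ = _ := by
          rw [← mul_pow, ← mul_pow, ← mul_pow, ← mul_pow]
          congr 1
          field_simp
  calc _ ≤ ∑ t ∈ box l T, ∑ a ∈ (range q).filter (fun a => Nat.Coprime a q),
        S a (fun i => (t i : ZMod q)) := sum_le_sum fun t _ => hpt t
    _ = ∑ a ∈ (range q).filter (fun a => Nat.Coprime a q), ∑ t ∈ box l T,
        S a (fun i => (t i : ZMod q)) := sum_comm
    _ ≤ ∑ a ∈ (range q).filter (fun a => Nat.Coprime a q),
        √(((T : ℝ) * (T + q) * k * F.discr.natAbs) ^ l) := sum_le_sum hbound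
    _ ≤ _ := by
        rw [sum_const, nsmul_eq_mul]
        gcongr
        exact_mod_cast (card_filter_le _ _).trans (card_range q).le

theorem harmonic_cast_mono {m n : ℕ} (h : m ≤ n) : (harmonic m : ℝ) ≤ harmonic n := by
  rw [harmonic_eq_sum_Icc, harmonic_eq_sum_Icc]
  exact_mod_cast sum_le_sum_of_subset_of_nonneg (Icc_subset_Icc_right h) fun _ _ _ => by positivity

theorem harmonic_cast_nonneg (m : ℕ) : (0 : ℝ) ≤ harmonic m := by
  rw [harmonic_eq_sum_Icc]
  push_cast
  positivity

/-- The divisors up to `M_t` of the values `F(t + u)`, counted by the moduli `q ≤ k` alone. -/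
theorem abs_sum_card_dvd_sub_le (hF : F.discr ≠ 0) (k T Mm : ℕ) (M : (Fin l → ℤ) → ℕ)
    (hM : ∀ t ∈ box l T, M t ≤ Mm) :
    |∑ t ∈ box l T, ∑ u ∈ cell l k,
      ((#((Icc 1 (M t)).filter fun d : ℕ => (d : ℤ) ∣ F.eval (t + u)) : ℝ) -
        ∑ q ∈ Icc 1 k, (ramanujanSum q (F.eval (t + u)) : ℝ) / q * (harmonic (M t / q) : ℝ))| ≤
      Mm * (harmonic Mm : ℝ) * √(((T : ℝ) * (T + Mm) * k * F.discr.natAbs) ^ l) := by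
  have hpt : ∀ t ∈ box l T, ∀ u : Fin l → ℤ,
      (#((Icc 1 (M t)).filter fun d : ℕ => (d : ℤ) ∣ F.eval (t + u)) : ℝ) -
        ∑ q ∈ Icc 1 k, (ramanujanSum q (F.eval (t + u)) : ℝ) / q * (harmonic (M t / q) : ℝ) =
      ∑ q ∈ Ioc k Mm, (harmonic (M t / q) : ℝ) / q * (ramanujanSum q (F.eval (t + u)) : ℝ) := by
    intro t ht u
    -- H(⌊M/q⌋) = H(0) = 0 for q > M, so the sum extends to a range common to all t.
    have hext : ∀ m : ℕ, M t ≤ m → ∑ q ∈ Icc 1 m,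
        (ramanujanSum q (F.eval (t + u)) : ℝ) / q * (harmonic (M t / q) : ℝ) =
        ∑ q ∈ Icc 1 (M t), (ramanujanSum q (F.eval (t + u)) : ℝ) / q * (harmonic (M t / q) : ℝ) := by
      intro m hm
      refine (sum_subset (Icc_subset_Icc_right hm) fun q hq hq' => ?_).symm
      rw [mem_Icc] at hq hq'
      rw [Nat.div_eq_of_lt (by omega)]
      simp
    rw [card_dvd_eq_sum_ramanujanSum, ← hext (max k Mm) ((hM t ht).trans (le_max_right _ _))]
    have hsub : Icc 1 k ⊆ Icc 1 (max k Mm) := Icc_subset_Icc_right (le_max_left _ _)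
    rw [← sum_sdiff hsub, add_sub_cancel_right]
    have hset : Icc 1 (max k Mm) \ Icc 1 k = Ioc k Mm := by
      ext q
      simp only [mem_sdiff, mem_Icc, mem_Ioc, le_max_iff]
      omega
    rw [hset]
    exact sum_congr rfl fun q _ => by ring
  rw [sum_congr rfl fun t ht => sum_congr rfl fun u _ => hpt t ht u]
  -- The weight depends on t but not on u, so it leaves the cell sum. What remains are absolute
  -- values of cell sums of c_q, and q > k is the range where their mean is controlled.
  have hswap : ∑ t ∈ box l T, ∑ u ∈ cell l k, ∑ q ∈ Ioc k Mm,
      (harmonic (M t / q) : ℝ) / q * (ramanujanSum q (F.eval (t + u)) : ℝ) =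
      ∑ q ∈ Ioc k Mm, ∑ t ∈ box l T, (harmonic (M t / q) : ℝ) / q *
        ∑ u ∈ cell l k, (ramanujanSum q (F.eval (t + u)) : ℝ) := by
    rw [sum_comm (s := Ioc k Mm)]
    refine sum_congr rfl fun t _ => ?_
    rw [sum_comm]
    exact sum_congr rfl fun q _ => (mul_sum _ _ _).symm
  rw [hswap]
  calc _ ≤ ∑ q ∈ Ioc k Mm, ∑ t ∈ box l T, (harmonic Mm : ℝ) / q *
        |∑ u ∈ cell l k, (ramanujanSum q (F.eval (t + u)) : ℝ)| := by
        refine (abs_sum_le_sum_abs _ _).trans (sum_le_sum fun q _ =>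
          (abs_sum_le_sum_abs _ _).trans (sum_le_sum fun t ht => ?_))
        rw [abs_mul, abs_of_nonneg (div_nonneg (harmonic_cast_nonneg _) (by positivity))]
        exact mul_le_mul_of_nonneg_right (div_le_div_of_nonneg_right
          (harmonic_cast_mono ((Nat.div_le_self _ _).trans (hM t ht))) (by positivity))
          (abs_nonneg _)
    _ ≤ ∑ q ∈ Ioc k Mm, (harmonic Mm : ℝ) *
          √(((T : ℝ) * (T + Mm) * k * F.discr.natAbs) ^ l) := by
        refine sum_le_sum fun q hq => ?_
        rw [mem_Ioc] at hq
        have hq0 : 0 < q := by omega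
        rw [← mul_sum]
        have h1 := F.sum_abs_sum_ramanujanSum_le hF hq.1.le hq0 T
        have h2 : √(((T : ℝ) * (T + q) * k * F.discr.natAbs) ^ l) ≤
            √(((T : ℝ) * (T + Mm) * k * F.discr.natAbs) ^ l) := by
          refine Real.sqrt_le_sqrt ?_
          have : (q : ℝ) ≤ Mm := by exact_mod_cast hq.2
          gcongr
        have hH := harmonic_cast_nonneg Mm
        calc _ ≤ (harmonic Mm : ℝ) / q *
              (q * √(((T : ℝ) * (T + Mm) * k * F.discr.natAbs) ^ l)) := by
              refine mul_le_mul_of_nonneg_left (h1.trans ?_) (by positivity)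
              gcongr
          _ = _ := by field_simp
    _ ≤ _ := by
        rw [sum_const, nsmul_eq_mul, Nat.card_Ioc, ← mul_assoc]
        have hH := harmonic_cast_nonneg Mm
        gcongr
        exact Nat.sub_le _ _

end IntQuadPoly

/-! ### Averaging over cells and uniform control on the box. -/

namespace IntQuadPoly

variable {l : ℕ} (F : IntQuadPoly l)

open Finset

/-- The points of `[1, N]^l` with a coordinate at distance less than `k` from the boundary. -/
noncomputable def boundary (l k N : ℕ) : Finset (Fin l → ℤ) :=
  (box l N).filter fun x => ∃ i, x i < k ∨ (N : ℤ) + 1 < x i + k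

theorem boundary_subset_box (l k N : ℕ) : boundary l k N ⊆ box l N := filter_subset _ _

theorem boundary_mono {q k : ℕ} (h : q ≤ k) (N : ℕ) : boundary l q N ⊆ boundary l k N := by
  refine monotone_filter_right _ fun x => ?_
  rintro _ ⟨i, hi⟩
  exact ⟨i, by omega⟩

theorem card_boundary_le (l k N : ℕ) : #(boundary l k N) ≤ l * (2 * k * N ^ (l - 1)) := by
  set A : Finset ℤ := Ico 0 (k : ℤ) ∪ Ioc ((N : ℤ) + 1 - k) (N + 1) with hA
  have hAc : #A ≤ 2 * k := by
    refine (card_union_le _ _).trans ?_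
    simp only [Int.card_Ico, Int.card_Ioc]
    omega
  have hsub : boundary l k N ⊆ univ.biUnion fun i : Fin l =>
      Fintype.piFinset (Function.update (fun _ => Icc (1 : ℤ) N) i A) := by
    intro x hx
    obtain ⟨hx1, i, hi⟩ := mem_filter.1 hx
    have hx2 := mem_box.1 hx1
    refine mem_biUnion.2 ⟨i, mem_univ i, Fintype.mem_piFinset.2 fun j => ?_⟩
    by_cases hj : j = i
    · subst hj
      have := hx2 j
      rw [Function.update_self, hA, mem_union, mem_Ico, mem_Ioc]
      omega
    · rw [Function.update_of_ne hj, mem_Icc]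
      exact hx2 j
  calc #(boundary l k N) ≤ ∑ i : Fin l,
        #(Fintype.piFinset (Function.update (fun _ => Icc (1 : ℤ) N) i A)) :=
        (card_le_card hsub).trans card_biUnion_le
    _ ≤ ∑ _i : Fin l, 2 * k * N ^ (l - 1) := by
        refine sum_le_sum fun i _ => ?_
        rw [Fintype.card_piFinset, ← mul_prod_erase univ _ (mem_univ i), Function.update_self]
        refine Nat.mul_le_mul hAc (le_of_eq ?_)
        rw [prod_congr rfl (g := fun _ => N) fun j hj => by
          rw [Function.update_of_ne (ne_of_mem_erase hj)]; simp]
        simp [card_erase_of_mem]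
    _ = _ := by simp

/-- Shifts are at most k − 1, so T + k = N + 1 is an exact fit: T + (k − 1) = N. -/
theorem add_mem_box {k T N : ℕ} (hT : T + k = N + 1) {t u : Fin l → ℤ} (ht : t ∈ box l T)
    (hu : u ∈ cell l k) : t + u ∈ box l N := by
  rw [mem_box] at ht ⊢
  rw [mem_cell] at hu
  intro i
  have := ht i
  have := hu i
  rw [Pi.add_apply]
  omega

theorem box_sdiff_shift_subset {k T N : ℕ} (hT : T + k = N + 1) {u : Fin l → ℤ}
    (hu : u ∈ cell l k) :
    box l N \ (box l T).map (addRightEmbedding u) ⊆ boundary l k N := by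
  intro x hx
  obtain ⟨hx1, hx2⟩ := mem_sdiff.1 hx
  refine mem_filter.2 ⟨hx1, ?_⟩
  by_contra! h
  refine hx2 (mem_map.2 ⟨x - u, mem_box.2 fun i => ?_, by simp⟩)
  have h1 := h i
  have h2 := mem_cell.1 hu i
  rw [Pi.sub_apply]
  omega

theorem shift_subset_box {k T N : ℕ} (hT : T + k = N + 1) {u : Fin l → ℤ} (hu : u ∈ cell l k) :
    (box l T).map (addRightEmbedding u) ⊆ box l N := by
  intro x hx
  obtain ⟨t, ht, rfl⟩ := mem_map.1 hx
  exact add_mem_box hT ht hu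

theorem sum_shift_le {k T N : ℕ} (hT : T + k = N + 1) {g : (Fin l → ℤ) → ℝ}
    (hg : ∀ x ∈ box l N, 0 ≤ g x) {u : Fin l → ℤ} (hu : u ∈ cell l k) :
    ∑ t ∈ box l T, g (t + u) ≤ ∑ x ∈ box l N, g x := by
  calc ∑ t ∈ box l T, g (t + u) = ∑ x ∈ (box l T).map (addRightEmbedding u), g x := by
        rw [sum_map]; rfl
    _ ≤ _ := sum_le_sum_of_subset_of_nonneg (shift_subset_box hT hu) fun x hx _ => hg x hx

theorem sum_sum_shift_le {k T N : ℕ} (hT : T + k = N + 1) {g : (Fin l → ℤ) → ℝ}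
    (hg : ∀ x ∈ box l N, 0 ≤ g x) :
    ∑ t ∈ box l T, ∑ u ∈ cell l k, g (t + u) ≤ (k : ℝ) ^ l * ∑ x ∈ box l N, g x := by
  rw [sum_comm]
  refine (sum_le_sum fun u hu => sum_shift_le hT hg hu).trans (le_of_eq ?_)
  rw [sum_const, card_cell, nsmul_eq_mul]
  push_cast
  rfl

theorem abs_sum_box_sub_shift_le {k T N : ℕ} (hT : T + k = N + 1) (g : (Fin l → ℤ) → ℝ)
    {u : Fin l → ℤ} (hu : u ∈ cell l k) :
    |∑ x ∈ box l N, g x - ∑ t ∈ box l T, g (t + u)| ≤ ∑ x ∈ boundary l k N, |g x| := by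
  have h1 : ∑ t ∈ box l T, g (t + u) = ∑ x ∈ (box l T).map (addRightEmbedding u), g x := by
    rw [sum_map]; rfl
  rw [h1, ← sum_sdiff (shift_subset_box hT hu), add_sub_cancel_right]
  exact (abs_sum_le_sum_abs _ _).trans (sum_le_sum_of_subset_of_nonneg
    (box_sdiff_shift_subset hT hu) fun _ _ _ => abs_nonneg _)

/-- Averaging a sum over a box along short cells. -/
theorem abs_mul_sum_box_sub_le {k T N : ℕ} (hT : T + k = N + 1) (g : (Fin l → ℤ) → ℝ) :
    |(k : ℝ) ^ l * ∑ x ∈ box l N, g x - ∑ t ∈ box l T, ∑ u ∈ cell l k, g (t + u)| ≤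
      (k : ℝ) ^ l * ∑ x ∈ boundary l k N, |g x| := by
  have h1 : (k : ℝ) ^ l * ∑ x ∈ box l N, g x - ∑ t ∈ box l T, ∑ u ∈ cell l k, g (t + u) =
      ∑ u ∈ cell l k, (∑ x ∈ box l N, g x - ∑ t ∈ box l T, g (t + u)) := by
    rw [sum_comm (s := box l T), sum_sub_distrib, sum_const, card_cell, nsmul_eq_mul]
    push_cast
    rfl
  rw [h1]
  refine (abs_sum_le_sum_abs _ _).trans ((sum_le_sum fun u hu =>
    abs_sum_box_sub_shift_le hT g hu).trans (le_of_eq ?_))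
  rw [sum_const, card_cell, nsmul_eq_mul]
  push_cast
  rfl

/-- The real number `S_F(q)`. -/
noncomputable def realGaussSum (q : ℕ) : ℝ := (F.gaussSum q).re

theorem ofReal_realGaussSum (q : ℕ) : (F.realGaussSum q : ℂ) = F.gaussSum q := by
  rcases Nat.eq_zero_or_pos q with rfl | hq
  · simp [realGaussSum, gaussSum_zero]
  · have : NeZero q := ⟨hq.ne'⟩
    have h : F.gaussSum q = (((q : ℝ)⁻¹ * ∑ x : Fin l → ZMod q,
        (ramanujanSum q ((F.eval x).val : ℤ) : ℝ) : ℝ) : ℂ) := by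
      rw [gaussSum_eq]
      push_cast
      rfl
    rw [realGaussSum, h, Complex.ofReal_re]

/-- A cell of side exactly q is a complete residue system wherever it starts; this is the source of
the main term at the modulus q. -/
theorem sum_cell_ramanujanSum {q : ℕ} (hq : 0 < q) (t : Fin l → ℤ) :
    ∑ u ∈ cell l q, (ramanujanSum q (F.eval (t + u)) : ℝ) = q * F.realGaussSum q := by
  have : NeZero q := ⟨hq.ne'⟩
  have hq' : (q : ℂ) ≠ 0 := by exact_mod_cast hq.ne'
  apply Complex.ofReal_injective
  rw [Complex.ofReal_mul, ofReal_realGaussSum, gaussSum_eq, Complex.ofReal_natCast,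
    mul_inv_cancel_left₀ hq', ← sum_piFinset_Ico_zmod t]
  push_cast
  refine sum_congr rfl fun u _ => ?_
  rw [show (fun i => ((t i : ZMod q) + (u i : ZMod q))) = fun i => (((t + u) i : ℤ) : ZMod q) by
    ext i; simp, F.eval_intCast, ramanujanSum_zmod]

theorem abs_realGaussSum_le (hF : F.discr ≠ 0) (q : ℕ) :
    |F.realGaussSum q| ≤ F.gaussBound * (q : ℝ) ^ ((l : ℝ) / 2) := by
  rw [← Real.norm_eq_abs, ← Complex.norm_real, ofReal_realGaussSum]
  exact F.norm_gaussSum_le hF q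

/-- Uniform control of `F` and of the divisor function of its values on the box `[1, N]^l`. -/
structure BoxControl (C X Λ W : ℝ) (N : ℕ) : Prop where
  one_le_C : 1 ≤ C
  one_le_N : 1 ≤ N
  N_le : (N : ℝ) ≤ X
  le_N : X ≤ N + 1
  pos : ∀ x ∈ box l N, 0 < F.eval x
  le : ∀ x ∈ box l N, ((F.eval x : ℤ) : ℝ) ≤ C * X ^ 2
  lip : ∀ x ∈ box l N, ∀ k : ℕ, k ≤ N → ∀ u ∈ cell l k,
    |((F.eval (x + u) : ℤ) : ℝ) - (F.eval x : ℤ)| ≤ C * X * k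
  one_le_Λ : 1 ≤ Λ
  log_le : Real.log (C * X ^ 2) ≤ Λ
  divisors_le : ∀ x ∈ box l N, (#(F.eval x).toNat.divisors : ℝ) ≤ Λ
  -- Points with F(x) ≤ K X number at most K W. In the application W is X^(l−1+δ) up to a constant,
  -- and Λ absorbs logarithms and divisor counts.
  sum_min_le : ∀ K : ℝ, 1 ≤ K → ∑ x ∈ box l N, min 1 (K * X / (F.eval x : ℤ)) ≤ K * W
  pow_le : (N : ℝ) ^ (l - 1) ≤ W

namespace BoxControl

variable {F} {C X Λ W : ℝ} {N : ℕ} (h : F.BoxControl C X Λ W N)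

include h

theorem one_le_X : 1 ≤ X := le_trans (by exact_mod_cast h.one_le_N) h.N_le

theorem W_nonneg : 0 ≤ W := le_trans (by positivity) h.pow_le

theorem log_X_le : Real.log X ≤ Λ := by
  refine le_trans (Real.log_le_log (by linarith [h.one_le_X]) ?_) h.log_le
  have := h.one_le_X
  have := h.one_le_C
  nlinarith [mul_nonneg (sub_nonneg.2 h.one_le_C) (sq_nonneg X)]

theorem one_le_eval {x : Fin l → ℤ} (hx : x ∈ box l N) : (1 : ℝ) ≤ (F.eval x : ℤ) := by
  exact_mod_cast h.pos x hx

theorem log_eval_nonneg {x : Fin l → ℤ} (hx : x ∈ box l N) :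
    0 ≤ Real.log ((F.eval x : ℤ) : ℝ) := Real.log_nonneg (h.one_le_eval hx)

theorem log_eval_le {x : Fin l → ℤ} (hx : x ∈ box l N) :
    Real.log ((F.eval x : ℤ) : ℝ) ≤ Λ :=
  (Real.log_le_log (by linarith [h.one_le_eval hx]) (h.le x hx)).trans h.log_le

theorem log_nat_le {q : ℕ} (hq : 1 ≤ q) (hqN : q ≤ N) : Real.log q ≤ Λ := by
  refine (Real.log_le_log (by exact_mod_cast hq) ?_).trans h.log_X_le
  exact le_trans (by exact_mod_cast hqN) h.N_le

theorem card_boundary_le {k : ℕ} : (#(boundary l k N) : ℝ) ≤ 2 * l * k * W := by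
  have h1 : (#(boundary l k N) : ℝ) ≤ l * (2 * k * (N : ℝ) ^ (l - 1)) := by
    exact_mod_cast IntQuadPoly.card_boundary_le l k N
  refine h1.trans ?_
  have := mul_le_mul_of_nonneg_left h.pow_le (show (0 : ℝ) ≤ l * (2 * k) by positivity)
  linarith

theorem sum_abs_ramanujanSum_le {k : ℕ} (hk : 1 ≤ k) (hkN : k ≤ N) {x : Fin l → ℤ}
    (hx : x ∈ box l N) :
    ∑ q ∈ Icc 1 k, |(ramanujanSum q (F.eval x) : ℝ)| / q ≤ 2 * Λ ^ 2 := by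
  have h1 : (((F.eval x).toNat : ℕ) : ℤ) = F.eval x := Int.toNat_of_nonneg (h.pos x hx).le
  have h2 := sum_abs_ramanujanSum_div_le (n := (F.eval x).toNat) (by have := h.pos x hx; omega) k
  rw [h1] at h2
  refine h2.trans ?_
  have h3 := h.log_nat_le hk hkN
  have h4 : 0 ≤ Real.log k := Real.log_natCast_nonneg k
  have h5 := h.one_le_Λ
  calc _ ≤ Λ * (Λ + Λ) := by
        refine mul_le_mul (h.divisors_le x hx) (by linarith) (by linarith) (by linarith)
    _ = _ := by ring

/-- The variation of `log F` along a short shift. -/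
theorem abs_log_sub_le {m n : ℝ} (hm : 1 ≤ m) (hn : 1 ≤ n) (hmX : m ≤ C * X ^ 2)
    (hnX : n ≤ C * X ^ 2) {k : ℝ} (hk : 0 ≤ k) (hmn : |m - n| ≤ C * X * k) :
    |Real.log n - Real.log m| ≤ 2 * C * Λ * min 1 (k * X / n) := by
  have hC := h.one_le_C
  have hX := h.one_le_X
  have hΛ := h.one_le_Λ
  have hn0 : 0 < n := by linarith
  have hm0 : 0 < m := by linarith
  rw [mul_min_of_nonneg _ _ (by positivity), mul_one]
  -- If n ≥ 2 C X k the relative change is at most 1/2 and the logarithm is Lipschitz. Otherwise the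
  -- minimum is at least 1/(2C), and the trivial bound Λ suffices.
  rcases le_or_gt (2 * C * X * k) n with h1 | h1
  · have h2 : |m / n - 1| ≤ C * X * k / n := by
      rw [div_sub_one hn0.ne', abs_div, abs_of_pos hn0]
      gcongr
    have h3 : C * X * k / n ≤ 1 / 2 := by
      rw [div_le_div_iff₀ hn0 two_pos]
      linarith
    have h4 := abs_log_le_two_mul (h2.trans h3)
    rw [Real.log_div hm0.ne' hn0.ne', abs_sub_comm] at h4
    have h5 : 2 * |m / n - 1| ≤ 1 := by linarith
    refine le_min (h4.trans (h5.trans ?_)) (h4.trans ?_)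
    · nlinarith
    · calc 2 * |m / n - 1| ≤ 2 * (C * X * k / n) := by linarith
        _ = 2 * C * 1 * (k * X / n) := by ring
        _ ≤ _ := by gcongr
  · have h2 : Real.log n ≤ Λ := (Real.log_le_log hn0 hnX).trans h.log_le
    have h3 : Real.log m ≤ Λ := (Real.log_le_log hm0 hmX).trans h.log_le
    have h4 := Real.log_nonneg hm
    have h5 := Real.log_nonneg hn
    have h6 : |Real.log n - Real.log m| ≤ Λ := abs_le.2 ⟨by linarith, by linarith⟩
    refine le_min (h6.trans (by nlinarith)) (h6.trans ?_)
    have h7 : 1 ≤ 2 * C * (k * X / n) := by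
      rw [← mul_div_assoc, le_div_iff₀ hn0]
      linarith
    calc Λ ≤ Λ * (2 * C * (k * X / n)) := le_mul_of_one_le_right (by linarith) h7
      _ = _ := by ring

end BoxControl

/-- The local density of `log n + 2 γ` at the modulus `q`. -/
noncomputable def logDensity (q : ℕ) (n : ℝ) : ℝ :=
  Real.log n + 2 * Real.eulerMascheroniConstant - 2 * Real.log q

theorem BoxControl.abs_logDensity_le {F : IntQuadPoly l} {C X Λ W : ℝ} {N : ℕ}
    (h : F.BoxControl C X Λ W N) {q : ℕ} (hq : 1 ≤ q) (hqN : q ≤ N) {x : Fin l → ℤ}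
    (hx : x ∈ box l N) : |logDensity q (F.eval x : ℤ)| ≤ 5 * Λ := by
  have h1 := h.log_eval_nonneg hx
  have h2 := h.log_eval_le hx
  have h3 := h.log_nat_le hq hqN
  have h4 : 0 ≤ Real.log q := Real.log_natCast_nonneg q
  have h5 := h.one_le_Λ
  have h6 := Real.one_half_lt_eulerMascheroniConstant
  have h7 := Real.eulerMascheroniConstant_lt_two_thirds
  rw [logDensity, abs_le]
  constructor <;> linarith

end IntQuadPoly

/-! ### The main term from the moduli up to k. -/

namespace IntQuadPoly

variable {l : ℕ} {F : IntQuadPoly l}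

open Finset

theorem sum_min_mono {C X Λ W : ℝ} {N : ℕ} (h : F.BoxControl C X Λ W N) {q k : ℕ} (hqk : q ≤ k)
    {x : Fin l → ℤ} (hx : x ∈ box l N) :
    min 1 ((q : ℝ) * X / (F.eval x : ℤ)) ≤ min 1 ((k : ℝ) * X / (F.eval x : ℤ)) := by
  have := h.one_le_eval hx
  have hX := h.one_le_X
  refine min_le_min_left _ (div_le_div_of_nonneg_right (mul_le_mul_of_nonneg_right ?_ (by linarith))
    (by linarith))
  exact_mod_cast hqk

/-- The average of `c_q(F(x))` against the slowly varying weight `logDensity q (F x)`. -/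
theorem BoxControl.abs_sum_ramanujanSum_mul_sub_le {C X Λ W : ℝ} {N : ℕ}
    (h : F.BoxControl C X Λ W N) {q k : ℕ} (hq : 1 ≤ q) (hqk : q ≤ k) (hkN : k ≤ N) :
    |∑ x ∈ box l N, (ramanujanSum q (F.eval x) : ℝ) / q * logDensity q (F.eval x : ℤ) -
        F.realGaussSum q / (q : ℝ) ^ l * ∑ x ∈ box l N, logDensity q (F.eval x : ℤ)| ≤
      5 * Λ * ∑ x ∈ boundary l k N, |(ramanujanSum q (F.eval x) : ℝ)| / q +
      2 * C * Λ * ∑ x ∈ box l N, |(ramanujanSum q (F.eval x) : ℝ)| / q *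
        min 1 (k * X / (F.eval x : ℤ)) +
      |F.realGaussSum q| / (q : ℝ) ^ l * (5 * Λ * #(boundary l k N)) := by
  have hqN : q ≤ N := hqk.trans hkN
  have hq0 : (0 : ℝ) < q := by exact_mod_cast hq
  have hC := h.one_le_C
  have hΛ := h.one_le_Λ
  have hX := h.one_le_X
  -- The cells have side q here, a full period of c_q(F(x)); k enters only as an upper bound for q.
  obtain ⟨T, hT⟩ : ∃ T, T + q = N + 1 := ⟨N + 1 - q, by omega⟩
  set c : (Fin l → ℤ) → ℝ := fun x => (ramanujanSum q (F.eval x) : ℝ) / q with hc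
  set V : (Fin l → ℤ) → ℝ := fun x => logDensity q (F.eval x : ℤ) with hV
  have habs : ∀ x, |(ramanujanSum q (F.eval x) : ℝ)| / q = |c x| := fun x => by
    rw [hc]; simp only [abs_div, Nat.abs_cast]
  have hVle : ∀ x ∈ box l N, |V x| ≤ 5 * Λ := fun x hx => h.abs_logDensity_le hq hqN hx
  have h0cell : (0 : Fin l → ℤ) ∈ cell l q := mem_cell.2 fun i => by simp; omega
  -- averaging over cells
  have h1 := abs_mul_sum_box_sub_le (l := l) hT fun x => c x * V x
  -- freezing the weight
  have h2 : |∑ t ∈ box l T, ∑ u ∈ cell l q, c (t + u) * V (t + u) -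
      F.realGaussSum q * ∑ t ∈ box l T, V t| ≤
      (q : ℝ) ^ l * ∑ x ∈ box l N, |c x| * (2 * C * Λ * min 1 (k * X / (F.eval x : ℤ))) := by
    have e : F.realGaussSum q * ∑ t ∈ box l T, V t =
        ∑ t ∈ box l T, ∑ u ∈ cell l q, c (t + u) * V t := by
      rw [mul_sum]
      refine sum_congr rfl fun t _ => ?_
      rw [← sum_mul]
      congr 1
      rw [hc]
      simp only
      rw [← sum_div, F.sum_cell_ramanujanSum hq t, mul_div_cancel_left₀ _ hq0.ne']
    rw [e, ← sum_sub_distrib]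
    simp only [← sum_sub_distrib, ← mul_sub]
    refine le_trans ?_ (sum_sum_shift_le hT
      (g := fun x => |c x| * (2 * C * Λ * min 1 (k * X / (F.eval x : ℤ)))) fun x hx => ?_)
    · refine (abs_sum_le_sum_abs _ _).trans (sum_le_sum fun t ht =>
        (abs_sum_le_sum_abs _ _).trans (sum_le_sum fun u hu => ?_))
      rw [abs_mul]
      refine mul_le_mul_of_nonneg_left ?_ (abs_nonneg _)
      have ht' : t ∈ box l N := by
        have := add_mem_box hT ht h0cell
        rwa [add_zero] at this
      have htu := add_mem_box hT ht hu
      have h3 := h.abs_log_sub_le (h.one_le_eval ht') (h.one_le_eval htu) (h.le t ht')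
        (h.le _ htu) hq0.le (by rw [abs_sub_comm]; exact h.lip t ht' q hqN u hu)
      have h4 : V (t + u) - V t = Real.log ((F.eval (t + u) : ℤ) : ℝ) -
          Real.log ((F.eval t : ℤ) : ℝ) := by
        rw [hV]
        simp only [logDensity]
        ring
      rw [h4]
      exact h3.trans (mul_le_mul_of_nonneg_left (sum_min_mono h hqk htu) (by positivity))
    · have := h.one_le_eval hx
      positivity
  have h3 : |F.realGaussSum q * ∑ x ∈ box l N, V x - F.realGaussSum q * ∑ t ∈ box l T, V t| ≤
      |F.realGaussSum q| * (5 * Λ * #(boundary l k N)) := by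
    rw [← mul_sub, abs_mul]
    refine mul_le_mul_of_nonneg_left ?_ (abs_nonneg _)
    have := abs_sum_box_sub_shift_le hT V h0cell
    simp only [add_zero] at this
    calc _ ≤ ∑ x ∈ boundary l q N, |V x| := this
      _ ≤ ∑ x ∈ boundary l k N, |V x| :=
          sum_le_sum_of_subset_of_nonneg (boundary_mono hqk N) fun _ _ _ => abs_nonneg _
      _ ≤ ∑ x ∈ boundary l k N, 5 * Λ :=
          sum_le_sum fun x hx => hVle x (boundary_subset_box _ _ _ hx)
      _ = _ := by rw [sum_const, nsmul_eq_mul, mul_comm]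
  have h4 : ∑ x ∈ boundary l q N, |c x * V x| ≤ 5 * Λ * ∑ x ∈ boundary l k N, |c x| := by
    rw [mul_sum]
    calc _ ≤ ∑ x ∈ boundary l k N, |c x * V x| :=
          sum_le_sum_of_subset_of_nonneg (boundary_mono hqk N) fun _ _ _ => abs_nonneg _
      _ ≤ _ := sum_le_sum fun x hx => by
          rw [abs_mul, mul_comm]
          exact mul_le_mul_of_nonneg_right (hVle x (boundary_subset_box _ _ _ hx)) (abs_nonneg _)
  simp only [habs]
  have hql : (0 : ℝ) < (q : ℝ) ^ l := by positivity
  have h5 : |(q : ℝ) ^ l * ∑ x ∈ box l N, c x * V x - F.realGaussSum q * ∑ x ∈ box l N, V x| ≤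
      (q : ℝ) ^ l * (5 * Λ * ∑ x ∈ boundary l k N, |c x|) +
        (q : ℝ) ^ l * (∑ x ∈ box l N, |c x| * (2 * C * Λ * min 1 (k * X / (F.eval x : ℤ)))) +
        |F.realGaussSum q| * (5 * Λ * #(boundary l k N)) := by
    have h6 := mul_le_mul_of_nonneg_left h4 hql.le
    rw [abs_le] at h1 h2 h3 ⊢
    constructor <;> linarith [h1.1, h1.2, h2.1, h2.2, h3.1, h3.2]
  have h6 : ∑ x ∈ box l N, c x * V x - F.realGaussSum q / (q : ℝ) ^ l * ∑ x ∈ box l N, V x =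
      ((q : ℝ) ^ l * ∑ x ∈ box l N, c x * V x - F.realGaussSum q * ∑ x ∈ box l N, V x) /
        (q : ℝ) ^ l := by
    field_simp
  rw [h6, abs_div, abs_of_pos hql, div_le_iff₀ hql]
  refine h5.trans (le_of_eq ?_)
  have h7 : ∑ x ∈ box l N, |c x| * (2 * C * Λ * min 1 (k * X / (F.eval x : ℤ))) =
      2 * C * Λ * ∑ x ∈ box l N, |c x| * min 1 (k * X / (F.eval x : ℤ)) := by
    rw [mul_sum]
    exact sum_congr rfl fun x _ => by ring
  rw [h7]
  field_simp

/-- The main term at the moduli up to `k` of the divisor sum. -/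
noncomputable def smoothDivisor (F : IntQuadPoly l) (k : ℕ) (x : Fin l → ℤ) : ℝ :=
  ∑ q ∈ Icc 1 k, (ramanujanSum q (F.eval x) : ℝ) / q * logDensity q (F.eval x : ℤ)

/-- Summing the one-modulus estimate over q ≤ k, each point costs only Λ² through the average of
|c_q|/q, while boundary points and points with small F are O(k W) in number. The remaining factor is
harmless since |S_F(q)|/q^l ≪ q^(−l/2) ≤ 1/q. -/
theorem BoxControl.abs_sum_smoothDivisor_sub_le {C X Λ W : ℝ} {N : ℕ}
    (h : F.BoxControl C X Λ W N) (hl : 2 ≤ l) (hF : F.discr ≠ 0) {k : ℕ} (hk : 1 ≤ k)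
    (hkN : k ≤ N) :
    |∑ x ∈ box l N, smoothDivisor F k x -
        ∑ q ∈ Icc 1 k, F.realGaussSum q / (q : ℝ) ^ l *
          ∑ x ∈ box l N, logDensity q (F.eval x : ℤ)| ≤
      (20 * l + 4 * C + 20 * l * F.gaussBound) * Λ ^ 3 * k * W := by
  have hC := h.one_le_C
  have hΛ := h.one_le_Λ
  have hX := h.one_le_X
  have hW := h.W_nonneg
  have hB := h.card_boundary_le (k := k)
  have hG := F.gaussBound_nonneg
  have hk1 : (1 : ℝ) ≤ k := by exact_mod_cast hk
  have e : ∑ x ∈ box l N, smoothDivisor F k x = ∑ q ∈ Icc 1 k, ∑ x ∈ box l N,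
      (ramanujanSum q (F.eval x) : ℝ) / q * logDensity q (F.eval x : ℤ) := sum_comm
  rw [e, ← sum_sub_distrib]
  refine (abs_sum_le_sum_abs _ _).trans ((sum_le_sum fun q hq =>
    h.abs_sum_ramanujanSum_mul_sub_le (mem_Icc.1 hq).1 (mem_Icc.1 hq).2 hkN).trans ?_)
  rw [sum_add_distrib, sum_add_distrib, ← mul_sum, ← mul_sum, ← sum_mul]
  have h1 : ∑ q ∈ Icc 1 k, ∑ x ∈ boundary l k N, |(ramanujanSum q (F.eval x) : ℝ)| / q ≤
      2 * Λ ^ 2 * (2 * l * k * W) := by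
    rw [sum_comm]
    calc _ ≤ ∑ x ∈ boundary l k N, 2 * Λ ^ 2 := sum_le_sum fun x hx =>
          h.sum_abs_ramanujanSum_le hk hkN (boundary_subset_box _ _ _ hx)
      _ = 2 * Λ ^ 2 * #(boundary l k N) := by rw [sum_const, nsmul_eq_mul, mul_comm]
      _ ≤ _ := by gcongr
  have h2 : ∑ q ∈ Icc 1 k, ∑ x ∈ box l N, |(ramanujanSum q (F.eval x) : ℝ)| / q *
      min 1 (k * X / (F.eval x : ℤ)) ≤ 2 * Λ ^ 2 * (k * W) := by
    rw [sum_comm]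
    calc _ ≤ ∑ x ∈ box l N, 2 * Λ ^ 2 * min 1 (k * X / (F.eval x : ℤ)) := by
          refine sum_le_sum fun x hx => ?_
          rw [← sum_mul]
          have := h.one_le_eval hx
          exact mul_le_mul_of_nonneg_right (h.sum_abs_ramanujanSum_le hk hkN hx) (by positivity)
      _ ≤ _ := by
          rw [← mul_sum]
          exact mul_le_mul_of_nonneg_left (h.sum_min_le k hk1) (by positivity)
  have h3 : ∑ q ∈ Icc 1 k, |F.realGaussSum q| / (q : ℝ) ^ l ≤ F.gaussBound * (2 * Λ) := by
    calc _ ≤ ∑ q ∈ Icc 1 k, F.gaussBound * (q : ℝ)⁻¹ := by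
          refine sum_le_sum fun q hq => ?_
          have hq1 : (1 : ℝ) ≤ q := by exact_mod_cast (mem_Icc.1 hq).1
          have hq0 : (0 : ℝ) < q := by linarith
          rw [div_le_iff₀ (by positivity)]
          refine (F.abs_realGaussSum_le hF q).trans ?_
          rw [mul_assoc]
          refine mul_le_mul_of_nonneg_left ?_ hG
          rw [← Real.rpow_natCast, ← Real.rpow_neg_one, ← Real.rpow_add hq0]
          refine Real.rpow_le_rpow_of_exponent_le hq1 ?_
          have : (2 : ℝ) ≤ l := by exact_mod_cast hl
          linarith
      _ ≤ _ := by
          rw [← mul_sum]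
          refine mul_le_mul_of_nonneg_left ((sum_Icc_inv_le le_rfl).trans ?_) hG
          linarith [h.log_nat_le hk hkN]
  calc _ ≤ 5 * Λ * (2 * Λ ^ 2 * (2 * l * k * W)) + 2 * C * Λ * (2 * Λ ^ 2 * (k * W)) +
        F.gaussBound * (2 * Λ) * (5 * Λ * (2 * l * k * W)) := by
        gcongr
    _ = (20 * l + 4 * C) * Λ ^ 3 * k * W + 20 * l * F.gaussBound * Λ ^ 2 * k * W := by ring
    _ ≤ (20 * l + 4 * C) * Λ ^ 3 * k * W + 20 * l * F.gaussBound * Λ ^ 3 * k * W := by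
        have : Λ ^ 2 ≤ Λ ^ 3 := pow_le_pow_right₀ hΛ (by norm_num)
        gcongr
    _ = _ := by ring

end IntQuadPoly

/-! ### Harmonic numbers and the hyperbola method. -/

open Finset in
-- With m = ⌊y⌋, γ lies between H_m − log(m+1) and H_m − log m, and log y lies between the same two
-- logarithms, whose gap is at most 1/m ≤ 2/y.
theorem abs_harmonic_floor_sub_le {y : ℝ} (hy : 1 ≤ y) :
    |(harmonic ⌊y⌋₊ : ℝ) - (Real.log y + Real.eulerMascheroniConstant)| ≤ 2 / y := by
  obtain ⟨m, hm⟩ : ∃ m, m = ⌊y⌋₊ := ⟨_, rfl⟩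
  rw [← hm]
  have hm1 : 1 ≤ m := by rw [hm]; exact Nat.one_le_floor_iff y |>.2 hy
  have hm0 : (0 : ℝ) < m := by exact_mod_cast hm1
  have hm1' : (1 : ℝ) ≤ m := by exact_mod_cast hm1
  have h1 : (m : ℝ) ≤ y := by rw [hm]; exact Nat.floor_le (by linarith)
  have h2 : y < m + 1 := by rw [hm]; exact Nat.lt_floor_add_one y
  have h3 := Real.eulerMascheroniSeq_lt_eulerMascheroniConstant m
  have h4 := Real.eulerMascheroniConstant_lt_eulerMascheroniSeq' m
  rw [Real.eulerMascheroniSeq] at h3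
  rw [Real.eulerMascheroniSeq', if_neg (by omega)] at h4
  have h5 : Real.log m ≤ Real.log y := Real.log_le_log hm0 h1
  have h6 : Real.log y ≤ Real.log (m + 1) := Real.log_le_log (by linarith) h2.le
  have h7 : Real.log (m + 1) - Real.log m ≤ 1 / m := by
    rw [← Real.log_div (by positivity) hm0.ne']
    refine (Real.log_le_sub_one_of_pos (by positivity)).trans (le_of_eq ?_)
    field_simp
    ring
  have h8 : 1 / (m : ℝ) ≤ 2 / y := by
    rw [div_le_div_iff₀ hm0 (by linarith)]
    linarith
  rw [abs_le]
  constructor <;> linarith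

/-- Here z is a value frozen on a cell in place of n. If n ≥ 2A, then z ≥ n/2 and both the floor
error and log(z/n) are O(A/n); otherwise the minimum is at least 1/2 and crude bounds by L suffice.
-/
theorem abs_harmonic_toNat_div_sub_le {z : ℤ} {K : ℕ} (hK : 1 ≤ K) {n A Z L : ℝ} (hn : 1 ≤ n)
    (hA : (K : ℝ) ≤ A) (hzn : |(z : ℝ) - n| ≤ A) (hnZ : n ≤ Z) (hzZ : (z : ℝ) ≤ Z)
    (hKZ : (K : ℝ) ≤ Z) (hL : Real.log Z ≤ L) :
    |(harmonic (z.toNat / K) : ℝ) - (Real.log (n / K) + Real.eulerMascheroniConstant)| ≤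
      (6 + 4 * L) * min 1 (A / n) := by
  have hn0 : 0 < n := by linarith
  have hK1 : (1 : ℝ) ≤ K := by exact_mod_cast hK
  have hK0 : (0 : ℝ) < K := by linarith
  have hlogn : Real.log n ≤ L := (Real.log_le_log hn0 hnZ).trans hL
  have hlogn0 := Real.log_nonneg hn
  have hL0 : 0 ≤ L := hlogn0.trans hlogn
  have hA0 : 0 < A := by linarith
  rw [Real.log_div hn0.ne' hK0.ne']
  rcases le_or_gt (2 * A) n with h | h
  · have h1 : A / n ≤ 1 := (div_le_one hn0).2 (by linarith)
    have hz := abs_le.1 hzn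
    have hz2 : n / 2 ≤ z := by linarith
    have hz0 : (0 : ℝ) < z := by linarith
    have hz0' : 0 < z := by exact_mod_cast hz0
    have hfl : z.toNat / K = ⌊(z : ℝ) / K⌋₊ := by
      rw [show (z : ℝ) = ((z.toNat : ℕ) : ℝ) by
        rw [← Int.cast_natCast, Int.toNat_of_nonneg hz0'.le], Nat.floor_div_eq_div]
    have h2 := abs_harmonic_floor_sub_le (y := (z : ℝ) / K) (by rw [one_le_div hK0]; linarith)
    rw [Real.log_div hz0.ne' hK0.ne'] at h2
    have h3 : |(z : ℝ) / n - 1| ≤ A / n := by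
      rw [div_sub_one hn0.ne', abs_div, abs_of_pos hn0]
      gcongr
    have h4 := abs_log_le_two_mul (h3.trans (by rw [div_le_div_iff₀ hn0 two_pos]; linarith))
    rw [Real.log_div hz0.ne' hn0.ne'] at h4
    have h5 : 2 / ((z : ℝ) / K) ≤ 4 * (A / n) := by
      rw [div_div_eq_mul_div, ← mul_div_assoc, div_le_div_iff₀ hz0 hn0]
      nlinarith
    rw [hfl, min_eq_right h1]
    have h6 : 0 ≤ 4 * L * (A / n) := by positivity
    rw [abs_le] at h2 h4 ⊢
    constructor <;> linarith [h2.1, h2.2, h4.1, h4.2]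
  · have h1 : 1 / 2 ≤ min 1 (A / n) := by
      refine le_min (by norm_num) ?_
      rw [div_le_div_iff₀ two_pos hn0]
      linarith
    have hlogK : Real.log K ≤ L := (Real.log_le_log hK0 hKZ).trans hL
    have hlogK0 := Real.log_nonneg hK1
    have hH : (harmonic (z.toNat / K) : ℝ) ≤ 1 + L := by
      refine (harmonic_le_one_add_log _).trans (add_le_add_right ?_ _)
      rcases Nat.eq_zero_or_pos (z.toNat / K) with h0 | h0
      · rw [h0]; simpa using hL0
      · refine (Real.log_le_log (by exact_mod_cast h0) ?_).trans hL
        have h2 : z.toNat / K ≤ z.toNat := Nat.div_le_self _ _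
        have h3 : 0 < z := by
          by_contra! h3
          rw [Int.toNat_of_nonpos h3] at h0
          simp at h0
        have h4 : ((z.toNat / K : ℕ) : ℝ) ≤ ((z.toNat : ℕ) : ℝ) := by exact_mod_cast h2
        refine h4.trans (le_trans (le_of_eq ?_) hzZ)
        rw [← Int.cast_natCast, Int.toNat_of_nonneg h3.le]
    have hH0 := IntQuadPoly.harmonic_cast_nonneg (z.toNat / K)
    have hγ := Real.eulerMascheroniConstant_lt_two_thirds
    have hγ0 := Real.one_half_lt_eulerMascheroniConstant
    calc _ ≤ 3 + 2 * L := abs_le.2 ⟨by linarith, by linarith⟩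
      _ = (6 + 4 * L) * (1 / 2) := by ring
      _ ≤ _ := mul_le_mul_of_nonneg_left h1 (by linarith)

namespace Nat

open Finset

/-- Divisors d > N are counted by their cofactors e = n/d, which satisfy e N < n. P only has to
bound these cofactors, so one cutoff can serve all the values on a cell. -/
theorem card_divisors_le_add {n N P : ℕ} (hn : n ≠ 0) (hP : ∀ e, e * N < n → e ≤ P) :
    #n.divisors ≤ #((Icc 1 N).filter (· ∣ n)) + #((Icc 1 P).filter (· ∣ n)) := by
  rw [← card_filter_add_card_filter_not (s := n.divisors) (fun d => d ≤ N)]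
  refine Nat.add_le_add (card_le_card fun d hd => ?_) ?_
  · rw [mem_filter, mem_divisors] at hd
    exact mem_filter.2 ⟨mem_Icc.2 ⟨Nat.pos_of_dvd_of_pos hd.1.1 (Nat.pos_of_ne_zero hn), hd.2⟩, hd.1.1⟩
  · refine card_le_card_of_injOn (fun d => n / d) (fun d hd => ?_) fun d hd d' hd' hdd' => ?_
    · obtain ⟨⟨⟨e, rfl⟩, -⟩, hd2⟩ : (d ∣ n ∧ n ≠ 0) ∧ ¬ d ≤ N := by
        simpa only [coe_filter, mem_divisors, Set.mem_ofPred_eq] using hd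
      have hd0 : 0 < d := by omega
      have he0 : 0 < e := Nat.pos_of_ne_zero fun h => hn (by simp [h])
      simp only [Nat.mul_div_cancel_left _ hd0, mem_coe, mem_filter, mem_Icc]
      exact ⟨⟨he0, hP e (by nlinarith)⟩, dvd_mul_left _ _⟩
    · have h1 : d ∈ n.divisors := (mem_filter.1 (mem_coe.1 hd)).1
      have h2 : d' ∈ n.divisors := (mem_filter.1 (mem_coe.1 hd')).1
      have := congrArg (n / ·) hdd'
      simpa only [Nat.div_div_self (dvd_of_mem_divisors h1) hn,
        Nat.div_div_self (dvd_of_mem_divisors h2) hn] using this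

/-- A divisor e ≤ P with P N < n has cofactor larger than N, so the two families give different
divisors of n. -/
theorem add_le_card_divisors {n N P : ℕ} (hn : n ≠ 0) (hP : P * N < n) :
    #((Icc 1 N).filter (· ∣ n)) + #((Icc 1 P).filter (· ∣ n)) ≤ #n.divisors := by
  rw [← card_filter_add_card_filter_not (s := n.divisors) (fun d => d ≤ N)]
  refine Nat.add_le_add (card_le_card fun d hd => ?_) ?_
  · rw [mem_filter, mem_Icc] at hd
    exact mem_filter.2 ⟨mem_divisors.2 ⟨hd.2, hn⟩, hd.1.2⟩
  · refine card_le_card_of_injOn (fun d => n / d) (fun d hd => ?_) fun d hd d' hd' hdd' => ?_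
    · obtain ⟨⟨hd0, hdP⟩, e, rfl⟩ : (1 ≤ d ∧ d ≤ P) ∧ d ∣ n := by
        simpa only [coe_filter, mem_Icc, Set.mem_ofPred_eq] using hd
      simp only [Nat.mul_div_cancel_left _ hd0, mem_coe, mem_filter, mem_divisors]
      refine ⟨⟨dvd_mul_left _ _, hn⟩, fun h => ?_⟩
      have := Nat.mul_le_mul hdP h
      omega
    · have h1 : d ∣ n := (mem_filter.1 (mem_coe.1 hd)).2
      have h2 : d' ∣ n := (mem_filter.1 (mem_coe.1 hd')).2
      have := congrArg (n / ·) hdd'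
      simpa only [Nat.div_div_self h1 hn, Nat.div_div_self h2 hn] using this

end Nat

/-! ### The divisor function against the smooth main term. -/

namespace IntQuadPoly

variable {l : ℕ} {F : IntQuadPoly l}

open Finset

namespace BoxControl

variable {C X Λ W : ℝ} {N : ℕ}

theorem log_three_mul_le (h : F.BoxControl C X Λ W N) : Real.log (3 * (C * X ^ 2)) ≤ 3 * Λ := by
  have hC := h.one_le_C
  have hX := h.one_le_X
  have h1 := Real.log_le_sub_one_of_pos (show (0 : ℝ) < 3 by norm_num)
  have h2 := h.log_le
  have h3 := h.one_le_Λ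
  rw [Real.log_mul (by norm_num) (by positivity)]
  linarith

theorem abs_smoothDivisor_le (h : F.BoxControl C X Λ W N) {k : ℕ} (hk : 1 ≤ k) (hkN : k ≤ N)
    {x : Fin l → ℤ} (hx : x ∈ box l N) : |smoothDivisor F k x| ≤ 10 * Λ ^ 3 := by
  have hΛ := h.one_le_Λ
  calc |smoothDivisor F k x| ≤ ∑ q ∈ Icc 1 k, |(ramanujanSum q (F.eval x) : ℝ)| / q * (5 * Λ) := by
        refine (abs_sum_le_sum_abs _ _).trans (sum_le_sum fun q hq => ?_)
        rw [abs_mul, abs_div, Nat.abs_cast]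
        rw [mem_Icc] at hq
        exact mul_le_mul_of_nonneg_left (h.abs_logDensity_le hq.1 (hq.2.trans hkN) hx)
          (by positivity)
    _ ≤ 2 * Λ ^ 2 * (5 * Λ) := by
        rw [← sum_mul]
        exact mul_le_mul_of_nonneg_right (h.sum_abs_ramanujanSum_le hk hkN hx) (by positivity)
    _ = _ := by ring

/-- The harmonic weights at the moduli up to `k` are close to `logDensity`. -/
theorem abs_sum_harmonic_sub_smoothDivisor_le (h : F.BoxControl C X Λ W N) {k : ℕ} (hk : 1 ≤ k)
    (hkN : k ≤ N) {x : Fin l → ℤ} (hx : x ∈ box l N) {z : ℤ}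
    (hz : |(z : ℝ) - (F.eval x : ℤ)| ≤ 5 * C * k * X) (hzle : (z : ℝ) ≤ 3 * (C * X ^ 2)) :
    |(∑ q ∈ Icc 1 k, (ramanujanSum q (F.eval x) : ℝ) / q * (harmonic (N / q) : ℝ) +
        ∑ q ∈ Icc 1 k, (ramanujanSum q (F.eval x) : ℝ) / q * (harmonic (z.toNat / N / q) : ℝ)) -
      smoothDivisor F k x| ≤
      2 * Λ ^ 2 * (2 * k / N + 90 * C * Λ * min 1 (k * X / (F.eval x : ℤ))) := by
  have hC := h.one_le_C
  have hΛ := h.one_le_Λ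
  have hX := h.one_le_X
  have hN := h.one_le_N
  have hN0 : (0 : ℝ) < N := by exact_mod_cast hN
  have hk1 : (1 : ℝ) ≤ k := by exact_mod_cast hk
  have hkX : (k : ℝ) ≤ X := le_trans (by exact_mod_cast hkN) h.N_le
  have hn := h.one_le_eval hx
  have hnle := h.le x hx
  have key : ∀ q ∈ Icc 1 k, |(harmonic (N / q) : ℝ) + (harmonic (z.toNat / N / q) : ℝ) -
      logDensity q (F.eval x : ℤ)| ≤
      2 * k / N + 90 * C * Λ * min 1 (k * X / (F.eval x : ℤ)) := by
    intro q hq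
    obtain ⟨hq1, hqk⟩ := mem_Icc.1 hq
    generalize ((F.eval x : ℤ) : ℝ) = n at hn hnle hz
    have hn0 : 0 < n := by linarith
    have hq1' : (1 : ℝ) ≤ q := by exact_mod_cast hq1
    have hq0 : (0 : ℝ) < q := by linarith
    have hqk' : (q : ℝ) ≤ k := by exact_mod_cast hqk
    have hqN : (q : ℝ) ≤ N := by exact_mod_cast hqk.trans hkN
    have h1 := abs_harmonic_floor_sub_le (y := (N : ℝ) / q) (by rwa [one_le_div hq0])
    rw [Nat.floor_div_eq_div] at h1
    have h2 : 2 / ((N : ℝ) / q) ≤ 2 * k / N := by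
      rw [div_div_eq_mul_div]
      gcongr
    have hNq : ((N * q : ℕ) : ℝ) ≤ k * X := by
      push_cast
      rw [mul_comm (k : ℝ)]
      exact mul_le_mul h.N_le hqk' hq0.le (by linarith)
    have hkXX : k * X ≤ X ^ 2 := by
      rw [sq]
      exact mul_le_mul_of_nonneg_right hkX (by linarith)
    have hX2 : X ^ 2 ≤ C * X ^ 2 := le_mul_of_one_le_left (by positivity) hC
    have h3 := abs_harmonic_toNat_div_sub_le (z := z) (K := N * q) (n := n) (A := 5 * C * k * X)
      (Z := 3 * (C * X ^ 2)) (L := 3 * Λ) (Nat.mul_pos hN hq1) hn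
      (by
        refine hNq.trans ?_
        rw [mul_assoc]
        exact le_mul_of_one_le_left (by positivity) (by linarith)) hz (by linarith [sq_nonneg X])
      hzle (by linarith [sq_nonneg X]) h.log_three_mul_le
    rw [← Nat.div_div_eq_div_mul] at h3
    have h4 : (6 + 4 * (3 * Λ)) * min 1 (5 * C * k * X / n) ≤
        90 * C * Λ * min 1 (k * X / n) := by
      have h5 : min 1 (5 * C * k * X / n) ≤ 5 * C * min 1 (k * X / n) := by
        rw [mul_min_of_nonneg _ _ (by positivity)]
        refine min_le_min (by linarith) (le_of_eq ?_)
        ring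
      have h6 : 0 ≤ min 1 (k * X / n) := by positivity
      calc _ ≤ 18 * Λ * (5 * C * min 1 (k * X / n)) := by
            refine mul_le_mul (by linarith) h5 (by positivity) (by linarith)
        _ = _ := by ring
    -- The cutoff N cancels: log(N/q) + log(n/(N q)) = log n − 2 log q, and the two harmonic numbers
    -- supply 2γ.
    have h5 : logDensity q n = (Real.log ((N : ℝ) / q) + Real.eulerMascheroniConstant) +
        (Real.log (n / ((N * q : ℕ) : ℝ)) + Real.eulerMascheroniConstant) := by
      push_cast
      rw [logDensity, Real.log_div hN0.ne' hq0.ne', Real.log_div hn0.ne' (by positivity),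
        Real.log_mul hN0.ne' hq0.ne']
      ring
    rw [h5]
    rw [abs_le] at h1 h3 ⊢
    constructor <;> linarith [h1.1, h1.2, h3.1, h3.2]
  have e : (∑ q ∈ Icc 1 k, (ramanujanSum q (F.eval x) : ℝ) / q * (harmonic (N / q) : ℝ) +
        ∑ q ∈ Icc 1 k, (ramanujanSum q (F.eval x) : ℝ) / q * (harmonic (z.toNat / N / q) : ℝ)) -
      smoothDivisor F k x = ∑ q ∈ Icc 1 k, (ramanujanSum q (F.eval x) : ℝ) / q *
        ((harmonic (N / q) : ℝ) + (harmonic (z.toNat / N / q) : ℝ) -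
          logDensity q (F.eval x : ℤ)) := by
    rw [smoothDivisor, ← sum_add_distrib, ← sum_sub_distrib]
    exact sum_congr rfl fun q _ => by ring
  rw [e]
  calc _ ≤ ∑ q ∈ Icc 1 k, |(ramanujanSum q (F.eval x) : ℝ)| / q *
        (2 * k / N + 90 * C * Λ * min 1 (k * X / (F.eval x : ℤ))) := by
        refine (abs_sum_le_sum_abs _ _).trans (sum_le_sum fun q hq => ?_)
        rw [abs_mul, abs_div, Nat.abs_cast]
        exact mul_le_mul_of_nonneg_left (key q hq) (by positivity)
    _ ≤ _ := by
        rw [← sum_mul]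
        refine mul_le_mul_of_nonneg_right (h.sum_abs_ramanujanSum_le hk hkN hx) ?_
        positivity

/-- The sum over `[1, N]^l` of the error of the harmonic weights. -/
theorem sum_harmonic_error_le (h : F.BoxControl C X Λ W N) (hl : 1 ≤ l) {k : ℕ} (hk : 1 ≤ k) :
    ∑ x ∈ box l N, 2 * Λ ^ 2 * (2 * k / N + 90 * C * Λ * min 1 (k * X / (F.eval x : ℤ))) ≤
      184 * C * Λ ^ 3 * k * W := by
  have hC := h.one_le_C
  have hΛ := h.one_le_Λ
  have hN0 : (0 : ℝ) < N := by exact_mod_cast h.one_le_N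
  have hk1 : (1 : ℝ) ≤ k := by exact_mod_cast hk
  have hW := h.W_nonneg
  rw [← mul_sum, sum_add_distrib, sum_const, card_box, ← mul_sum, nsmul_eq_mul]
  have h1 : ((N ^ l : ℕ) : ℝ) * (2 * k / N) ≤ 2 * k * W := by
    obtain ⟨m, rfl⟩ : ∃ m, l = m + 1 := ⟨l - 1, by omega⟩
    have := h.pow_le
    rw [Nat.add_sub_cancel] at this
    push_cast
    calc (N : ℝ) ^ (m + 1) * (2 * k / N) = 2 * k * (N : ℝ) ^ m := by
          field_simp
          ring
      _ ≤ _ := by gcongr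
  have h2 := h.sum_min_le k hk1
  calc _ ≤ 2 * Λ ^ 2 * (2 * k * W + 90 * C * Λ * (k * W)) := by gcongr
    _ = 4 * (Λ ^ 2 * k * W) + 180 * C * Λ ^ 3 * k * W := by ring
    _ ≤ 4 * (C * Λ ^ 3 * k * W) + 180 * C * Λ ^ 3 * k * W := by
        have h3 : Λ ^ 2 ≤ Λ ^ 3 := pow_le_pow_right₀ hΛ (by norm_num)
        have h4 : Λ ^ 2 ≤ C * Λ ^ 3 := h3.trans (le_mul_of_one_le_left (by positivity) hC)
        gcongr
    _ = _ := by ring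

/-- The bound for the contribution of the large moduli. -/
noncomputable def modulusError (F : IntQuadPoly l) (C X Λ : ℝ) (k : ℕ) : ℝ :=
  24 * C * X * Λ * (X ^ l * √((7 * C * F.discr.natAbs) ^ l) * √((k : ℝ) ^ l))

/-- The cutoffs in use are N and z/N with z ≤ 3 C X² and N ≥ X/2, all at most 6 C X; with T ≤ X this
gives the 7 C inside `modulusError`. -/
theorem abs_sum_card_dvd_sub_le (h : F.BoxControl C X Λ W N) (hF : F.discr ≠ 0) {k T : ℕ}
    (hTN : T ≤ N) (M : (Fin l → ℤ) → ℕ) (hM : ∀ t ∈ box l T, (M t : ℝ) ≤ 6 * C * X) :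
    |∑ t ∈ box l T, ∑ u ∈ cell l k,
      ((#((Icc 1 (M t)).filter fun d : ℕ => (d : ℤ) ∣ F.eval (t + u)) : ℝ) -
        ∑ q ∈ Icc 1 k, (ramanujanSum q (F.eval (t + u)) : ℝ) / q * (harmonic (M t / q) : ℝ))| ≤
      modulusError F C X Λ k := by
  have hC := h.one_le_C
  have hΛ := h.one_le_Λ
  have hX := h.one_le_X
  have hCX : 1 ≤ C * X := by nlinarith
  set Mm : ℕ := ⌊6 * C * X⌋₊ with hMm
  have hMm_le : (Mm : ℝ) ≤ 6 * C * X := Nat.floor_le (by positivity)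
  have hMm1 : 1 ≤ Mm := Nat.one_le_floor_iff _ |>.2 (by linarith)
  refine (F.abs_sum_card_dvd_sub_le hF k T Mm M fun t ht => Nat.le_floor (hM t ht)).trans ?_
  have hH : (harmonic Mm : ℝ) ≤ 4 * Λ := by
    refine (harmonic_le_one_add_log _).trans ?_
    have h1 : Real.log Mm ≤ Real.log (3 * (C * X ^ 2) * 2) := by
      refine Real.log_le_log (by exact_mod_cast hMm1) (hMm_le.trans ?_)
      have : X ≤ X ^ 2 := by nlinarith
      have := mul_le_mul_of_nonneg_left this (show 0 ≤ 6 * C by linarith)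
      linarith
    have h2 : Real.log (3 * (C * X ^ 2) * 2) ≤ 3 * Λ := by
      rw [show 3 * (C * X ^ 2) * 2 = 6 * (C * X ^ 2) by ring,
        Real.log_mul (by norm_num) (by positivity)]
      have h3 : Real.log 6 ≤ 2 := by
        rw [Real.log_le_iff_le_exp (by norm_num)]
        have h4 : Real.exp 2 = Real.exp 1 * Real.exp 1 := by rw [← Real.exp_add]; norm_num
        have h5 := Real.exp_one_gt_d9
        rw [h4]
        nlinarith
      linarith [h.log_le]
    linarith
  have hT : (T : ℝ) ≤ X := le_trans (by exact_mod_cast hTN) h.N_le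
  have hsq : √(((T : ℝ) * (T + Mm) * k * F.discr.natAbs) ^ l) ≤
      X ^ l * √((7 * C * F.discr.natAbs) ^ l) * √((k : ℝ) ^ l) := by
    have h1 : X ^ l = √((X ^ 2) ^ l) := by
      rw [← pow_mul, mul_comm 2 l, pow_mul, Real.sqrt_sq (by positivity)]
    rw [h1, ← Real.sqrt_mul (by positivity), ← Real.sqrt_mul (by positivity), ← mul_pow, ← mul_pow]
    refine Real.sqrt_le_sqrt (pow_le_pow_left₀ (by positivity) ?_ l)
    have h2 : (T : ℝ) * (T + Mm) ≤ X * (7 * C * X) := by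
      refine mul_le_mul hT ?_ (by positivity) (by linarith)
      nlinarith
    calc _ ≤ X * (7 * C * X) * k * F.discr.natAbs := by gcongr
      _ = _ := by ring
  have hH0 := harmonic_cast_nonneg Mm
  calc _ ≤ 6 * C * X * (4 * Λ) *
        (X ^ l * √((7 * C * F.discr.natAbs) ^ l) * √((k : ℝ) ^ l)) := by gcongr
    _ = _ := by rw [modulusError]; ring

/-- The divisor counts up to `N` and up to `z_t / N` in terms of the smooth main term. -/
theorem abs_sum_card_dvd_add_sub_le (h : F.BoxControl C X Λ W N) (hl : 1 ≤ l) (hF : F.discr ≠ 0)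
    {k T : ℕ} (hk : 1 ≤ k) (hkN : k ≤ N) (hT : T + k = N + 1) (z : (Fin l → ℤ) → ℤ)
    (hz : ∀ t ∈ box l T, ∀ u ∈ cell l k, |(z t : ℝ) - (F.eval (t + u) : ℤ)| ≤ 5 * C * k * X)
    (hzle : ∀ t ∈ box l T, (z t : ℝ) ≤ 3 * (C * X ^ 2)) :
    |∑ t ∈ box l T, ∑ u ∈ cell l k,
      ((#((Icc 1 N).filter fun d : ℕ => (d : ℤ) ∣ F.eval (t + u)) : ℝ) +
        #((Icc 1 ((z t).toNat / N)).filter fun d : ℕ => (d : ℤ) ∣ F.eval (t + u)) -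
        smoothDivisor F k (t + u))| ≤
      2 * modulusError F C X Λ k + (k : ℝ) ^ l * (184 * C * Λ ^ 3 * k * W) := by
  have hC := h.one_le_C
  have hΛ := h.one_le_Λ
  have hX := h.one_le_X
  have hTN : T ≤ N := by omega
  have hN0 : (0 : ℝ) < N := by exact_mod_cast h.one_le_N
  have h1 := h.abs_sum_card_dvd_sub_le hF (k := k) hTN (fun _ => N) fun t _ => by
    have := h.N_le
    nlinarith
  have h2 := h.abs_sum_card_dvd_sub_le hF (k := k) hTN (fun t => (z t).toNat / N) fun t ht => by
    refine Nat.cast_div_le.trans ?_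
    rw [div_le_iff₀ hN0]
    have h3 : (((z t).toNat : ℕ) : ℝ) ≤ 3 * (C * X ^ 2) := by
      have h4 : (((z t).toNat : ℕ) : ℝ) = ((max (z t) 0 : ℤ) : ℝ) := by
        rw [← Int.toNat_eq_max, Int.cast_natCast]
      rw [h4]
      push_cast
      exact max_le (hzle t ht) (by positivity)
    have h5 : X ≤ 2 * N := by
      have h6 := h.le_N
      have h7 : (1 : ℝ) ≤ N := by exact_mod_cast h.one_le_N
      linarith
    have h6 := mul_le_mul_of_nonneg_left h5 (show 0 ≤ 3 * C * X by positivity)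
    calc _ ≤ 3 * C * X * X := by rw [← mul_assoc] at h3; nlinarith
      _ ≤ _ := by linarith
  have h3 : |∑ t ∈ box l T, ∑ u ∈ cell l k,
      ((∑ q ∈ Icc 1 k, (ramanujanSum q (F.eval (t + u)) : ℝ) / q * (harmonic (N / q) : ℝ) +
        ∑ q ∈ Icc 1 k, (ramanujanSum q (F.eval (t + u)) : ℝ) / q *
          (harmonic ((z t).toNat / N / q) : ℝ)) - smoothDivisor F k (t + u))| ≤
      (k : ℝ) ^ l * (184 * C * Λ ^ 3 * k * W) := by
    refine le_trans ?_ (mul_le_mul_of_nonneg_left (h.sum_harmonic_error_le hl hk) (by positivity))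
    refine le_trans ?_ (sum_sum_shift_le hT
      (g := fun x => 2 * Λ ^ 2 * (2 * k / N + 90 * C * Λ * min 1 (k * X / (F.eval x : ℤ))))
      fun x hx => ?_)
    · refine (abs_sum_le_sum_abs _ _).trans (sum_le_sum fun t ht =>
        (abs_sum_le_sum_abs _ _).trans (sum_le_sum fun u hu => ?_))
      exact h.abs_sum_harmonic_sub_smoothDivisor_le hk hkN (add_mem_box hT ht hu) (hz t ht u hu)
        (hzle t ht)
    · have := h.one_le_eval hx
      positivity
  -- Insert the truncations to q ≤ k: the first two differences are large-modulus errors, the third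
  -- compares harmonic weights with `logDensity`.
  have e : ∀ a b c d s : (Fin l → ℤ) → (Fin l → ℤ) → ℝ,
      ∑ t ∈ box l T, ∑ u ∈ cell l k, (a t u + b t u - s t u) =
      ∑ t ∈ box l T, ∑ u ∈ cell l k, (a t u - c t u) +
      ∑ t ∈ box l T, ∑ u ∈ cell l k, (b t u - d t u) +
      ∑ t ∈ box l T, ∑ u ∈ cell l k, ((c t u + d t u) - s t u) := by
    intro a b c d s
    simp only [← sum_add_distrib]
    exact sum_congr rfl fun t _ => sum_congr rfl fun u _ => by ring
  rw [e _ _ (fun t u => ∑ q ∈ Icc 1 k, (ramanujanSum q (F.eval (t + u)) : ℝ) / q *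
      (harmonic (N / q) : ℝ)) (fun t u => ∑ q ∈ Icc 1 k, (ramanujanSum q (F.eval (t + u)) : ℝ) / q *
          (harmonic ((z t).toNat / N / q) : ℝ))]
  refine (abs_add_three _ _ _).trans ?_
  linarith

/-- The divisor function on the values of `F`, up to short shifts, lies between two divisor
counts. -/
theorem card_divisors_bounds (h : F.BoxControl C X Λ W N) {x : Fin l → ℤ} (hx : x ∈ box l N) (a B : ℤ)
    (hB : |F.eval x - a| ≤ B) :
    #((Icc 1 N).filter fun d : ℕ => (d : ℤ) ∣ F.eval x) +
        #((Icc 1 ((a - B - 1).toNat / N)).filter fun d : ℕ => (d : ℤ) ∣ F.eval x) ≤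
      #(F.eval x).toNat.divisors ∧
    #(F.eval x).toNat.divisors ≤
      #((Icc 1 N).filter fun d : ℕ => (d : ℤ) ∣ F.eval x) +
        #((Icc 1 ((a + B).toNat / N)).filter fun d : ℕ => (d : ℤ) ∣ F.eval x) := by
  have hpos := h.pos x hx
  have hN := h.one_le_N
  obtain ⟨n, hn⟩ : ∃ n : ℕ, F.eval x = n := ⟨(F.eval x).toNat, (Int.toNat_of_nonneg hpos.le).symm⟩
  rw [hn] at hB hpos ⊢
  have hn0 : n ≠ 0 := by rintro rfl; simp at hpos
  have hB' := abs_le.1 hB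
  simp only [Int.natCast_dvd_natCast, Int.toNat_natCast]
  constructor
  -- The −1 in the lower cutoff provides the strict inequality P N < F(x).
  · refine Nat.add_le_card_divisors hn0 ((Nat.div_mul_le_self _ _).trans_lt ?_)
    omega
  · refine Nat.card_divisors_le_add hn0 fun e he => ?_
    rw [Nat.le_div_iff_mul_le hN]
    omega

/-- On the cell at t the values F(t + u) stay within B = ⌈C X k⌉ of F(t), so τ lies between the
counts with frozen cutoffs (F(t) − B − 1)/N and (F(t) + B)/N. Both have the same main term up to the
admitted error. Passing from the box to cells costs only its boundary. -/
theorem abs_sum_card_divisors_sub_le (h : F.BoxControl C X Λ W N) (hl : 1 ≤ l) (hF : F.discr ≠ 0)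
    {k : ℕ} (hk : 1 ≤ k) (hkN : k ≤ N) :
    |∑ x ∈ box l N, ((#(F.eval x).toNat.divisors : ℝ) - smoothDivisor F k x)| ≤
      (22 * l + 184 * C) * Λ ^ 3 * k * W + 2 * modulusError F C X Λ k / (k : ℝ) ^ l := by
  have hC := h.one_le_C
  have hΛ := h.one_le_Λ
  have hX := h.one_le_X
  have hW := h.W_nonneg
  have hk1 : (1 : ℝ) ≤ k := by exact_mod_cast hk
  have hkX : (k : ℝ) ≤ X := le_trans (by exact_mod_cast hkN) h.N_le
  obtain ⟨T, hT⟩ : ∃ T, T + k = N + 1 := ⟨N + 1 - k, by omega⟩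
  have hkl : (0 : ℝ) < (k : ℝ) ^ l := by positivity
  set B : ℤ := ⌈C * X * k⌉ with hB
  have hB1 : C * X * k ≤ B := Int.le_ceil _
  have hB2 : (B : ℝ) < C * X * k + 1 := Int.ceil_lt_add_one _
  have hCXk : 1 ≤ C * X * k := by
    have h1 : 1 ≤ C * X := by nlinarith
    nlinarith
  have h0cell : (0 : Fin l → ℤ) ∈ cell l k := mem_cell.2 fun i => by simp; omega
  have hmem : ∀ t ∈ box l T, t ∈ box l N := fun t ht => by
    have := add_mem_box hT ht h0cell
    rwa [add_zero] at this
  have hlip : ∀ t ∈ box l T, ∀ u ∈ cell l k,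
      |((F.eval (t + u) : ℤ) : ℝ) - (F.eval t : ℤ)| ≤ C * X * k := fun t ht u hu =>
    h.lip t (hmem t ht) k hkN u hu
  have hCXk2 : C * X * k ≤ C * X ^ 2 := by
    rw [sq, ← mul_assoc]
    exact mul_le_mul_of_nonneg_left hkX (by positivity)
  have hplus := h.abs_sum_card_dvd_add_sub_le hl hF hk hkN hT (fun t => F.eval t + B)
    (fun t ht u hu => by
      have := abs_le.1 (hlip t ht u hu)
      push_cast
      rw [abs_le]
      constructor <;> nlinarith [this.1, this.2])
    (fun t ht => by
      have := h.le t (hmem t ht)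
      push_cast
      linarith)
  have hminus := h.abs_sum_card_dvd_add_sub_le hl hF hk hkN hT (fun t => F.eval t - B - 1)
    (fun t ht u hu => by
      have := abs_le.1 (hlip t ht u hu)
      push_cast
      rw [abs_le]
      constructor <;> nlinarith [this.1, this.2])
    (fun t ht => by
      have := h.le t (hmem t ht)
      push_cast
      nlinarith)
  have hbd : ∀ t ∈ box l T, ∀ u ∈ cell l k, |F.eval (t + u) - F.eval t| ≤ B := by
    intro t ht u hu
    have := (hlip t ht u hu).trans hB1
    exact_mod_cast this
  have hle : ∑ t ∈ box l T, ∑ u ∈ cell l k,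
      ((#(F.eval (t + u)).toNat.divisors : ℝ) - smoothDivisor F k (t + u)) ≤
      2 * modulusError F C X Λ k + (k : ℝ) ^ l * (184 * C * Λ ^ 3 * k * W) := by
    refine le_trans (sum_le_sum fun t ht => sum_le_sum fun u hu => ?_) ((le_abs_self _).trans hplus)
    have := (h.card_divisors_bounds (add_mem_box hT ht hu) _ _ (hbd t ht u hu)).2
    exact sub_le_sub_right (by exact_mod_cast this) _
  have hge : -(2 * modulusError F C X Λ k + (k : ℝ) ^ l * (184 * C * Λ ^ 3 * k * W)) ≤
      ∑ t ∈ box l T, ∑ u ∈ cell l k,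
        ((#(F.eval (t + u)).toNat.divisors : ℝ) - smoothDivisor F k (t + u)) := by
    refine le_trans (abs_le.1 hminus).1 (sum_le_sum fun t ht => sum_le_sum fun u hu => ?_)
    have := (h.card_divisors_bounds (add_mem_box hT ht hu) _ _ (hbd t ht u hu)).1
    exact sub_le_sub_right (by exact_mod_cast this) _
  have hav := abs_mul_sum_box_sub_le (l := l) hT fun x =>
    (#(F.eval x).toNat.divisors : ℝ) - smoothDivisor F k x
  have hbdry : ∑ x ∈ boundary l k N,
      |(#(F.eval x).toNat.divisors : ℝ) - smoothDivisor F k x| ≤ 22 * l * Λ ^ 3 * k * W := by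
    have hΛ3 : Λ ≤ Λ ^ 3 := le_self_pow₀ hΛ (by norm_num)
    calc _ ≤ ∑ x ∈ boundary l k N, 11 * Λ ^ 3 := by
          refine sum_le_sum fun x hx => ?_
          have hx' := boundary_subset_box _ _ _ hx
          have h1 := h.divisors_le x hx'
          have h2 := h.abs_smoothDivisor_le hk hkN hx'
          have h3 := abs_sub ((#(F.eval x).toNat.divisors : ℝ)) (smoothDivisor F k x)
          rw [Nat.abs_cast] at h3
          linarith
      _ = 11 * Λ ^ 3 * #(boundary l k N) := by rw [sum_const, nsmul_eq_mul, mul_comm]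
      _ ≤ 11 * Λ ^ 3 * (2 * l * k * W) := by
          gcongr
          exact h.card_boundary_le
      _ = _ := by ring
  have hfin : |(k : ℝ) ^ l *
      ∑ x ∈ box l N, ((#(F.eval x).toNat.divisors : ℝ) - smoothDivisor F k x)| ≤
      (k : ℝ) ^ l * (22 * l * Λ ^ 3 * k * W) +
        (2 * modulusError F C X Λ k + (k : ℝ) ^ l * (184 * C * Λ ^ 3 * k * W)) := by
    have h1 := hav.trans (mul_le_mul_of_nonneg_left hbdry hkl.le)
    rw [abs_le] at h1 ⊢
    constructor <;> linarith [h1.1, h1.2]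
  rw [abs_mul, abs_of_pos hkl] at hfin
  have h2 : (22 * l + 184 * C) * Λ ^ 3 * k * W + 2 * modulusError F C X Λ k / (k : ℝ) ^ l =
      ((k : ℝ) ^ l * (22 * l * Λ ^ 3 * k * W) +
        (2 * modulusError F C X Λ k + (k : ℝ) ^ l * (184 * C * Λ ^ 3 * k * W))) / (k : ℝ) ^ l := by
    field_simp
    ring
  rw [h2, le_div_iff₀ hkl, mul_comm]
  exact hfin

end BoxControl

end IntQuadPoly

/-! ### Sizes of the control quantities and tails of the series at s = l. -/

namespace IntQuadPoly

variable {l : ℕ} (F : IntQuadPoly l)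

open Finset

theorem exists_boxControl (hl : 2 ≤ l) (hF : F.discr ≠ 0) {δ : ℝ} (hδ : 0 < δ) (hδ1 : δ < 1) :
    ∃ C c : ℝ, 1 ≤ c ∧ ∀ X : ℝ, 1 ≤ X → ∀ N : ℕ, 1 ≤ N → (N : ℝ) ≤ X → X ≤ N + 1 →
      (∀ x ∈ box l N, 0 < F.eval x) →
        F.BoxControl C X (c * X ^ δ) (c * X ^ ((l : ℝ) - 1 + δ)) N := by
  obtain ⟨C, hC, hLip, hsize⟩ := F.exists_eval_bounds
  -- Exponent δ/2 because F(x) has size up to X².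
  obtain ⟨Cτ, hCτ, hτ⟩ := Nat.exists_card_divisors_le (δ := δ / 2) (by positivity)
  obtain ⟨C₂, hC₂, hmin⟩ := F.exists_sum_min_le hl hF hδ hδ1
  have hδ2 : 0 < 2 / δ := by positivity
  refine ⟨C, Cτ * C + C + 2 / δ + C₂, by nlinarith, fun X hX N hN hNX hXN hpos => ?_⟩
  have hX0 : 0 < X := by linarith
  have hXδ : 1 ≤ X ^ δ := Real.one_le_rpow hX hδ.le
  have hCC : 1 ≤ Cτ * C := by nlinarith
  have habs : ∀ x ∈ box l N, ∀ i, |((x i : ℤ) : ℝ)| ≤ X := by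
    intro x hx i
    have h2 := mem_box.1 hx i
    have h3 : (1 : ℝ) ≤ x i := by exact_mod_cast h2.1
    have h4 : (x i : ℝ) ≤ N := by exact_mod_cast h2.2
    rw [abs_of_nonneg (by linarith)]
    linarith
  have hle : ∀ x ∈ box l N, ((F.eval x : ℤ) : ℝ) ≤ C * X ^ 2 := by
    intro x hx
    have h := hsize X hX (fun i => (x i : ℝ)) (habs x hx)
    rw [F.eval_intCast] at h
    exact (le_abs_self _).trans h
  refine ⟨hC, hN, hNX, hXN, hpos, hle, ?_, by nlinarith, ?_, ?_, ?_, ?_⟩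
  · intro x hx k hk u hu
    have h := hLip X hX (fun i => (x i : ℝ)) (fun i => (u i : ℝ)) k (by positivity)
      (le_trans (by exact_mod_cast hk) hNX) (habs x hx) fun i => by
        obtain ⟨h1, h2⟩ := mem_cell.1 hu i
        have h3 : (0 : ℝ) ≤ u i := by exact_mod_cast h1
        have h4 : (u i : ℝ) ≤ k := by exact_mod_cast h2.le
        rwa [abs_of_nonneg h3]
    have e : (fun i => (x i : ℝ)) + (fun i => (u i : ℝ)) = fun i => (((x + u) i : ℤ) : ℝ) := by
      ext i; simp
    rwa [e, F.eval_intCast, F.eval_intCast] at h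
  · rw [Real.log_mul (by positivity) (by positivity), Real.log_pow]
    have h1 := Real.log_le_sub_one_of_pos (show 0 < C by linarith)
    have h2 : Real.log X ≤ X ^ δ / δ := Real.log_le_rpow_div hX0.le hδ
    push_cast
    calc Real.log C + 2 * Real.log X ≤ C * X ^ δ + 2 * (X ^ δ / δ) := by nlinarith
      _ = (C + 2 / δ) * X ^ δ := by ring
      _ ≤ _ := mul_le_mul_of_nonneg_right (by linarith) (by positivity)
  · intro x hx
    have hp := hpos x hx
    have h1 := hτ (F.eval x).toNat (by omega)
    have h2 : (((F.eval x).toNat : ℕ) : ℝ) = (F.eval x : ℤ) := by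
      rw [← Int.cast_natCast, Int.toNat_of_nonneg hp.le]
    rw [h2] at h1
    have h3 : (0 : ℝ) ≤ (F.eval x : ℤ) := by exact_mod_cast hp.le
    calc _ ≤ Cτ * ((F.eval x : ℤ) : ℝ) ^ (δ / 2) := h1
      _ ≤ Cτ * (C * X ^ 2) ^ (δ / 2) := by
          gcongr
          exact hle x hx
      _ ≤ Cτ * (C * X ^ δ) := by
          rw [Real.mul_rpow (by positivity) (by positivity), ← Real.rpow_natCast X 2,
            ← Real.rpow_mul hX0.le]
          have e : ((2 : ℕ) : ℝ) * (δ / 2) = δ := by push_cast; ring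
          rw [e]
          have : C ^ (δ / 2) ≤ C := by
            calc C ^ (δ / 2) ≤ C ^ (1 : ℝ) := Real.rpow_le_rpow_of_exponent_le hC (by linarith)
              _ = C := Real.rpow_one C
          gcongr
      _ = (Cτ * C) * X ^ δ := by ring
      _ ≤ _ := mul_le_mul_of_nonneg_right (by linarith) (by positivity)
  · intro K hK
    refine (hmin X hX N hNX hpos K hK).trans ?_
    calc _ = C₂ * (K * X ^ ((l : ℝ) - 1 + δ)) := by ring
      _ ≤ (Cτ * C + C + 2 / δ + C₂) * (K * X ^ ((l : ℝ) - 1 + δ)) :=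
          mul_le_mul_of_nonneg_right (by linarith) (by positivity)
      _ = _ := by ring
  · calc (N : ℝ) ^ (l - 1) ≤ X ^ (l - 1) := by gcongr
      _ = X ^ ((l : ℝ) - 1) := by
          rw [← Real.rpow_natCast, Nat.cast_sub (by omega), Nat.cast_one]
      _ ≤ X ^ ((l : ℝ) - 1 + δ) := Real.rpow_le_rpow_of_exponent_le hX (by linarith)
      _ ≤ _ := le_mul_of_one_le_left (by positivity) (by linarith)

/-- The tail of a series with terms of size at most `q^(δ - a)`. -/
theorem exists_abs_tsum_sub_sum_le {a δ : ℝ} (hδ : 0 < δ) (ha : 1 + 2 * δ ≤ a) {D : ℝ}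
    {f : ℕ → ℝ} (hf0 : f 0 = 0) (hf : ∀ q : ℕ, 1 ≤ q → |f q| ≤ D * (q : ℝ) ^ (δ - a)) :
    ∃ B : ℝ, 0 ≤ B ∧ ∀ k : ℕ, 1 ≤ k →
      |∑' q, f q - ∑ q ∈ Icc 1 k, f q| ≤ B * (k : ℝ) ^ (1 + 2 * δ - a) := by
  have hD : 0 ≤ D := by
    have := hf 1 le_rfl
    simp only [Nat.cast_one, Real.one_rpow, mul_one] at this
    exact (abs_nonneg _).trans this
  have hs : Summable fun q : ℕ => (q : ℝ) ^ (-1 - δ) := Real.summable_nat_rpow.2 (by linarith)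
  have hsum : Summable f := by
    refine Summable.of_norm_bounded (hs.mul_left D) fun q => ?_
    rcases Nat.eq_zero_or_pos q with rfl | hq
    · rw [hf0, norm_zero]
      positivity
    · refine (hf q hq).trans (mul_le_mul_of_nonneg_left ?_ hD)
      exact Real.rpow_le_rpow_of_exponent_le (by exact_mod_cast hq) (by linarith)
  refine ⟨D * ∑' q : ℕ, (q : ℝ) ^ (-1 - δ), mul_nonneg hD (tsum_nonneg fun q => by positivity),
    fun k hk => ?_⟩
  have hg : HasSum (fun q => f q - if q ∈ Icc 1 k then f q else 0)
      (∑' q, f q - ∑ q ∈ Icc 1 k, f q) := by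
    refine hsum.hasSum.sub ?_
    have : HasSum (fun q => if q ∈ Icc 1 k then f q else 0)
        (∑ q ∈ Icc 1 k, if q ∈ Icc 1 k then f q else 0) :=
      hasSum_sum_of_ne_finset_zero fun q hq => if_neg hq
    rwa [sum_congr rfl fun q hq => if_pos hq] at this
  rw [← hg.tsum_eq, ← Real.norm_eq_abs]
  have hb := ((hs.mul_left (D * (k : ℝ) ^ (1 + 2 * δ - a))).hasSum)
  refine (tsum_of_norm_bounded hb fun q => ?_).trans (le_of_eq ?_)
  · have hk0 : (0 : ℝ) < k := by exact_mod_cast hk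
    split_ifs with h
    · rw [sub_self, norm_zero]
      positivity
    · rw [sub_zero]
      rcases Nat.eq_zero_or_pos q with rfl | hq
      · rw [hf0, norm_zero]
        positivity
      · have hkq : k < q := by
          by_contra! h'
          exact h (mem_Icc.2 ⟨hq, h'⟩)
        have hq0 : (0 : ℝ) < q := by exact_mod_cast hq
        refine (hf q hq).trans ?_
        rw [mul_assoc]
        refine mul_le_mul_of_nonneg_left ?_ hD
        -- Beyond k the first factor is estimated by its value at k, and q^(−1−δ) keeps the series
        -- summable.
        have e : δ - a = (1 + 2 * δ - a) + (-1 - δ) := by ring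
        rw [e, Real.rpow_add hq0]
        refine mul_le_mul_of_nonneg_right ?_ (by positivity)
        exact Real.rpow_le_rpow_of_nonpos hk0 (by exact_mod_cast hkq.le) (by linarith)
  · rw [tsum_mul_left]
    ring

theorem realGaussSum_zero : F.realGaussSum 0 = 0 := by
  rw [realGaussSum, gaussSum_zero, Complex.zero_re]

theorem L_natCast_eq (hl : 3 ≤ l) (hF : F.discr ≠ 0) :
    F.L l = ((∑' q : ℕ, F.realGaussSum q / (q : ℝ) ^ l : ℝ) : ℂ) := by
  rw [F.L_eq_lSeries hl hF (by simp), LSeries, Complex.ofReal_tsum]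
  refine tsum_congr fun q => ?_
  rw [LSeries.term_def]
  split_ifs with h
  · rw [h, realGaussSum_zero]
    simp
  · rw [Complex.cpow_natCast, ← F.ofReal_realGaussSum]
    push_cast
    rfl

theorem deriv_L_natCast_eq (hl : 3 ≤ l) (hF : F.discr ≠ 0) :
    deriv F.L l = ((-∑' q : ℕ, Real.log q * (F.realGaussSum q / (q : ℝ) ^ l) : ℝ) : ℂ) := by
  rw [(F.hasDerivAt_L hl hF).deriv, LSeries, Complex.ofReal_neg, Complex.ofReal_tsum]
  congr 1
  refine tsum_congr fun q => ?_
  rw [LSeries.term_def]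
  split_ifs with h
  · rw [h, realGaussSum_zero]
    simp
  · rw [Complex.cpow_natCast, LSeries.logMul, ← F.ofReal_realGaussSum, ← Complex.ofReal_natCast,
      ← Complex.ofReal_log (by positivity)]
    push_cast
    ring

theorem abs_realGaussSum_div_le (hF : F.discr ≠ 0) {q : ℕ} (hq : 1 ≤ q) :
    |F.realGaussSum q / (q : ℝ) ^ l| ≤ F.gaussBound * (q : ℝ) ^ (-((l : ℝ) / 2)) := by
  have hq0 : (0 : ℝ) < q := by exact_mod_cast hq
  rw [abs_div, abs_of_pos (show (0 : ℝ) < (q : ℝ) ^ l by positivity), div_le_iff₀ (by positivity),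
    mul_assoc, ← Real.rpow_natCast, ← Real.rpow_add hq0]
  refine (F.abs_realGaussSum_le hF q).trans (le_of_eq ?_)
  congr 2
  ring

/-- Truncation of the series for `L(l, F)` and `L'(l, F)`. -/
theorem exists_tail_bounds (hl : 3 ≤ l) (hF : F.discr ≠ 0) {δ : ℝ} (hδ : 0 < δ)
    (hδ1 : δ ≤ 1 / 4) :
    ∃ B : ℝ, 0 ≤ B ∧ ∀ k : ℕ, 1 ≤ k →
      |∑' q : ℕ, F.realGaussSum q / (q : ℝ) ^ l - ∑ q ∈ Icc 1 k, F.realGaussSum q / (q : ℝ) ^ l| ≤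
        B * (k : ℝ) ^ (1 + 2 * δ - (l : ℝ) / 2) ∧
      |∑' q : ℕ, Real.log q * (F.realGaussSum q / (q : ℝ) ^ l) -
        ∑ q ∈ Icc 1 k, Real.log q * (F.realGaussSum q / (q : ℝ) ^ l)| ≤
        B * (k : ℝ) ^ (1 + 2 * δ - (l : ℝ) / 2) := by
  have hl' : (3 : ℝ) ≤ l := by exact_mod_cast hl
  have hG := F.gaussBound_nonneg
  have hbd : ∀ q : ℕ, 1 ≤ q → |F.realGaussSum q / (q : ℝ) ^ l| ≤
      F.gaussBound * (q : ℝ) ^ (δ - (l : ℝ) / 2) := fun q hq =>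
    (F.abs_realGaussSum_div_le hF hq).trans (mul_le_mul_of_nonneg_left
      (Real.rpow_le_rpow_of_exponent_le (by exact_mod_cast hq) (by linarith)) hG)
  have hbd' : ∀ q : ℕ, 1 ≤ q → |Real.log q * (F.realGaussSum q / (q : ℝ) ^ l)| ≤
      (F.gaussBound / δ) * (q : ℝ) ^ (δ - (l : ℝ) / 2) := by
    intro q hq
    have hq0 : (0 : ℝ) < q := by exact_mod_cast hq
    have h1 : Real.log q ≤ (q : ℝ) ^ δ / δ := Real.log_le_rpow_div hq0.le hδ
    rw [abs_mul, abs_of_nonneg (Real.log_natCast_nonneg q)]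
    calc _ ≤ (q : ℝ) ^ δ / δ * (F.gaussBound * (q : ℝ) ^ (-((l : ℝ) / 2))) :=
          mul_le_mul h1 (F.abs_realGaussSum_div_le hF hq) (abs_nonneg _) (by positivity)
      _ = F.gaussBound / δ * ((q : ℝ) ^ δ * (q : ℝ) ^ (-((l : ℝ) / 2))) := by ring
      _ = _ := by rw [← Real.rpow_add hq0, ← sub_eq_add_neg]
  obtain ⟨B₁, hB₁, h1⟩ := exists_abs_tsum_sub_sum_le hδ (a := (l : ℝ) / 2) (by linarith)
    (f := fun q => F.realGaussSum q / (q : ℝ) ^ l) (by simp [realGaussSum_zero]) hbd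
  obtain ⟨B₂, hB₂, h2⟩ := exists_abs_tsum_sub_sum_le hδ (a := (l : ℝ) / 2) (by linarith)
    (f := fun q => Real.log q * (F.realGaussSum q / (q : ℝ) ^ l)) (by simp) hbd'
  refine ⟨B₁ + B₂, by positivity, fun k hk => ⟨(h1 k hk).trans ?_, (h2 k hk).trans ?_⟩⟩ <;>
  exact mul_le_mul_of_nonneg_right (by linarith) (by positivity)

end IntQuadPoly

/-! ### The asymptotic formula. -/

namespace IntQuadPoly

variable {l : ℕ} (F : IntQuadPoly l)

open Finset

theorem divisorSum_eq {X : ℝ} (hX : 0 ≤ X) :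
    (F.divisorSum X : ℝ) = ∑ x ∈ box l ⌊X⌋₊, (#(F.eval x).toNat.divisors : ℝ) := by
  rw [divisorSum, box, ← Int.natCast_floor_eq_floor hX]
  push_cast
  rfl

theorem sum_logDensity {N : ℕ} (q : ℕ) :
    ∑ x ∈ box l N, logDensity q (F.eval x : ℤ) =
      ∑ x ∈ box l N, Real.log (F.eval x : ℤ) +
        2 * Real.eulerMascheroniConstant * (N : ℝ) ^ l - 2 * Real.log q * (N : ℝ) ^ l := by
  simp only [logDensity]
  rw [sum_sub_distrib, sum_add_distrib, sum_const, sum_const, card_box, nsmul_eq_mul, nsmul_eq_mul]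
  push_cast
  ring

theorem sum_realGaussSum_mul_logDensity (k N : ℕ) :
    ∑ q ∈ Icc 1 k, F.realGaussSum q / (q : ℝ) ^ l * ∑ x ∈ box l N, logDensity q (F.eval x : ℤ) =
      (∑ q ∈ Icc 1 k, F.realGaussSum q / (q : ℝ) ^ l) * (∑ x ∈ box l N, Real.log (F.eval x : ℤ) +
        2 * Real.eulerMascheroniConstant * (N : ℝ) ^ l) -
      2 * (∑ q ∈ Icc 1 k, Real.log q * (F.realGaussSum q / (q : ℝ) ^ l)) * (N : ℝ) ^ l := by
  rw [mul_sum, sum_mul, sum_mul, ← sum_sub_distrib]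
  refine sum_congr rfl fun q _ => ?_
  rw [F.sum_logDensity]
  ring

/-- Passing from the truncated main term to the main term. -/
theorem abs_main_sub_le {A₀ A₁ L₀ L₁ S I V Vn lx g t e d Λ : ℝ}
    (h0 : |L₀ - A₀| ≤ t) (h1 : |L₁ - A₁| ≤ t) (hS : |S + 2 * g * Vn| ≤ 3 * Λ * V)
    (hVn0 : 0 ≤ Vn) (hVn : Vn ≤ V) (hd : V - Vn ≤ d) (he : |S - (2 * Vn * lx + V * I)| ≤ e)
    (hlg : |2 * lx + 2 * g| ≤ 4 * Λ) (hΛ : 1 ≤ Λ) :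
    |A₀ * (S + 2 * g * Vn) - 2 * A₁ * Vn -
      (L₀ * (2 * V * lx + V * I + 2 * g * V) - 2 * L₁ * V)| ≤
      5 * Λ * (t * V) + |L₀| * (e + 4 * Λ * d) + 2 * |L₁| * d := by
  have ht : 0 ≤ t := (abs_nonneg _).trans h0
  have hV : 0 ≤ V := hVn0.trans hVn
  have key : A₀ * (S + 2 * g * Vn) - 2 * A₁ * Vn -
      (L₀ * (2 * V * lx + V * I + 2 * g * V) - 2 * L₁ * V) =
      -((L₀ - A₀) * (S + 2 * g * Vn)) + 2 * ((L₁ - A₁) * Vn) +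
      L₀ * ((S - (2 * Vn * lx + V * I)) - (V - Vn) * (2 * lx + 2 * g)) +
      2 * (L₁ * (V - Vn)) := by ring
  have hd0 : |V - Vn| ≤ d := by rwa [abs_of_nonneg (by linarith)]
  have b1 : |(L₀ - A₀) * (S + 2 * g * Vn)| ≤ t * (3 * Λ * V) := by
    rw [abs_mul]; exact mul_le_mul h0 hS (abs_nonneg _) ht
  have b2 : |(L₁ - A₁) * Vn| ≤ t * V := by
    rw [abs_mul, abs_of_nonneg hVn0]; exact mul_le_mul h1 hVn hVn0 ht
  have b3 : |L₀ * ((S - (2 * Vn * lx + V * I)) - (V - Vn) * (2 * lx + 2 * g))| ≤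
      |L₀| * (e + 4 * Λ * d) := by
    rw [abs_mul]
    refine mul_le_mul_of_nonneg_left ((abs_sub _ _).trans (add_le_add he ?_)) (abs_nonneg _)
    rw [abs_mul, mul_comm]
    exact mul_le_mul hlg hd0 (abs_nonneg _) (by linarith)
  have b4 : |L₁ * (V - Vn)| ≤ |L₁| * d := by
    rw [abs_mul]; exact mul_le_mul_of_nonneg_left hd0 (abs_nonneg _)
  have htV : t * V ≤ Λ * (t * V) := le_mul_of_one_le_left (by positivity) hΛ
  rw [key]
  rw [abs_le] at b1 b2 b3 b4 ⊢
  constructor <;> linarith [b1.1, b1.2, b2.1, b2.2, b3.1, b3.2, b4.1, b4.2]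

/-- Up to powers of X^δ the errors are k X^(l−1) from the small moduli, X^(l+1) k^(−l/2) from the
large ones, and X^l k^(1−l/2) from the tails. The first two balance at k = X^(4/(l+2)), which gives
the stated exponent; the third is then no larger. -/
theorem exists_divisorSum_asymptotic (hl : 3 ≤ l) (hF : F.discr ≠ 0) {ε : ℝ} (hε : 0 < ε) :
    ∃ K : ℝ, ∀ X : ℝ, 3 ≤ X →
      (∀ x : Fin l → ℝ, (∀ i, x i ∈ Set.Icc 1 X) → 0 < F.eval x) →
        IntegrableOn (fun t => Real.log (F.scaled X t)) (Set.Icc (0 : Fin l → ℝ) 1) ∧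
        |(F.divisorSum X : ℝ) -
          ((∑' q : ℕ, F.realGaussSum q / (q : ℝ) ^ l) * (2 * X ^ l * Real.log X +
            X ^ l * F.logIntegral X + 2 * Real.eulerMascheroniConstant * X ^ l) -
          2 * (∑' q : ℕ, Real.log q * (F.realGaussSum q / (q : ℝ) ^ l)) * X ^ l)| ≤
          K * X ^ ((l : ℝ) - ((l : ℝ) - 2) / ((l : ℝ) + 2) + ε) := by
  have hl' : (3 : ℝ) ≤ l := by exact_mod_cast hl
  -- The worst product Λ³ k W contains X^δ four times, hence 4δ ≤ ε.
  obtain ⟨δ, hδ, hδ1, hδε⟩ : ∃ δ : ℝ, 0 < δ ∧ δ ≤ 1 / 4 ∧ 4 * δ ≤ ε :=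
    ⟨min (1 / 4) (ε / 4), by positivity, min_le_left _ _, by
      have := min_le_right (1 / 4) (ε / 4)
      linarith⟩
  obtain ⟨κ, hκ⟩ : ∃ κ : ℝ, κ = 4 / ((l : ℝ) + 2) := ⟨_, rfl⟩
  have hκ0 : 0 < κ := by rw [hκ]; positivity
  have hκ1 : κ ≤ 1 := by rw [hκ, div_le_one (by positivity)]; linarith
  -- The balance k X^(l−1) = X^(l+1) k^(−l/2) for k = X^κ.
  have hκl : κ * ((l : ℝ) / 2) = 2 - κ := by rw [hκ]; field_simp; ring
  obtain ⟨C, c, hc, hbox⟩ := F.exists_boxControl (by omega) hF hδ (by linarith)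
  obtain ⟨E, hE, hlog⟩ := F.exists_sum_log (by omega) hF hδ (by linarith)
  obtain ⟨B, hB, htail⟩ := F.exists_tail_bounds hl hF hδ hδ1
  obtain ⟨L₀, hL₀⟩ : ∃ L₀ : ℝ, L₀ = ∑' q : ℕ, F.realGaussSum q / (q : ℝ) ^ l := ⟨_, rfl⟩
  obtain ⟨L₁, hL₁⟩ : ∃ L₁ : ℝ, L₁ = ∑' q : ℕ, Real.log q * (F.realGaussSum q / (q : ℝ) ^ l) :=
    ⟨_, rfl⟩
  rw [← hL₀, ← hL₁]
  rw [← hL₀, ← hL₁] at htail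
  obtain ⟨R, hR⟩ : ∃ R : ℝ, R = √((7 * C * F.discr.natAbs) ^ l) := ⟨_, rfl⟩
  obtain ⟨G, hG⟩ : ∃ G : ℝ, G = 20 * l + 4 * C + 20 * l * F.gaussBound := ⟨_, rfl⟩
  refine ⟨((22 * l + 184 * C) + G) * c ^ 4 + 48 * C * c * R * 2 ^ ((l : ℝ) / 2) +
    5 * c * B * 2 ^ ((l : ℝ) / 2) + |L₀| * (E + 4 * c * l) + 2 * |L₁| * l, fun X hX hpos => ?_⟩
  have hX1 : 1 ≤ X := by linarith
  have hX0 : 0 < X := by linarith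
  obtain ⟨N, hN⟩ : ∃ N, N = ⌊X⌋₊ := ⟨_, rfl⟩
  have hN1 : 1 ≤ N := by rw [hN]; exact (Nat.one_le_floor_iff X).2 hX1
  have hNX : (N : ℝ) ≤ X := by rw [hN]; exact Nat.floor_le hX0.le
  have hXN : X ≤ N + 1 := by rw [hN]; exact (Nat.lt_floor_add_one X).le
  have hpos' : ∀ x ∈ box l N, 0 < F.eval x := by
    intro x hx
    have h := hpos (fun i => (x i : ℝ)) fun i => by
      obtain ⟨h1, h2⟩ := mem_box.1 hx i
      exact ⟨by exact_mod_cast h1, le_trans (by exact_mod_cast h2) hNX⟩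
    rw [F.eval_intCast] at h
    exact_mod_cast h
  obtain ⟨hint, hsumlog⟩ := hlog X hX1 N hNX hXN hpos'
  refine ⟨hint, ?_⟩
  have h := hbox X hX1 N hN1 hNX hXN hpos'
  have hC := h.one_le_C
  have hΛ := h.one_le_Λ
  -- the truncation point
  obtain ⟨k, hk⟩ : ∃ k, k = ⌊X ^ κ⌋₊ := ⟨_, rfl⟩
  have hXκ : 1 ≤ X ^ κ := Real.one_le_rpow hX1 hκ0.le
  have hk1 : 1 ≤ k := by rw [hk]; exact (Nat.one_le_floor_iff _).2 hXκ
  have hk1' : (1 : ℝ) ≤ k := by exact_mod_cast hk1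
  have hk0 : (0 : ℝ) < k := by linarith
  have hkle : (k : ℝ) ≤ X ^ κ := by rw [hk]; exact Nat.floor_le (by positivity)
  -- The floor loses at most a factor 2, the origin of the powers 2^(l/2) in the constant.
  have hkge : X ^ κ / 2 ≤ k := by
    have : X ^ κ < k + 1 := by rw [hk]; exact Nat.lt_floor_add_one _
    linarith
  have hkN : k ≤ N := by
    rw [hN]
    refine Nat.le_floor (hkle.trans ?_)
    calc X ^ κ ≤ X ^ (1 : ℝ) := Real.rpow_le_rpow_of_exponent_le hX1 hκ1
      _ = X := Real.rpow_one X
  obtain ⟨Λ, hΛdef⟩ : ∃ Λ : ℝ, Λ = c * X ^ δ := ⟨_, rfl⟩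
  obtain ⟨W, hWdef⟩ : ∃ W : ℝ, W = c * X ^ ((l : ℝ) - 1 + δ) := ⟨_, rfl⟩
  rw [← hΛdef, ← hWdef] at h
  rw [← hΛdef] at hΛ
  obtain ⟨Y, hY⟩ : ∃ Y : ℝ, Y = X ^ ((l : ℝ) - 1 + κ + 4 * δ) := ⟨_, rfl⟩
  have hY0 : 0 < Y := by rw [hY]; positivity
  have hXY : ∀ r : ℝ, r ≤ (l : ℝ) - 1 + κ + 4 * δ → X ^ r ≤ Y := fun r hr => by
    rw [hY]; exact Real.rpow_le_rpow_of_exponent_le hX1 hr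
  have hΛ3 : Λ ^ 3 * k * W ≤ c ^ 4 * Y := by
    rw [hΛdef, hWdef]
    calc (c * X ^ δ) ^ 3 * k * (c * X ^ ((l : ℝ) - 1 + δ))
        ≤ (c * X ^ δ) ^ 3 * X ^ κ * (c * X ^ ((l : ℝ) - 1 + δ)) := by gcongr
      _ = c ^ 4 * ((X ^ δ) ^ (3 : ℕ) * X ^ κ * X ^ ((l : ℝ) - 1 + δ)) := by ring
      _ = c ^ 4 * Y := by
          rw [hY, ← Real.rpow_natCast (X ^ δ), ← Real.rpow_mul hX0.le, ← Real.rpow_add hX0,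
            ← Real.rpow_add hX0]
          congr 2
          push_cast
          ring
  have hXκl : (X ^ κ) ^ ((l : ℝ) / 2) = X ^ (2 - κ) := by
    rw [← Real.rpow_mul hX0.le, hκl]
  -- the large moduli
  have hmod : 2 * BoxControl.modulusError F C X Λ k / (k : ℝ) ^ l ≤
      48 * C * c * R * 2 ^ ((l : ℝ) / 2) * Y := by
    have h1 : √((k : ℝ) ^ l) = (k : ℝ) ^ ((l : ℝ) / 2) := by
      rw [Real.sqrt_eq_rpow, ← Real.rpow_natCast, ← Real.rpow_mul hk0.le]
      congr 1
      ring
    have h2 : (k : ℝ) ^ l = (k : ℝ) ^ ((l : ℝ) / 2) * (k : ℝ) ^ ((l : ℝ) / 2) := by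
      rw [← Real.rpow_add hk0, ← Real.rpow_natCast]
      congr 1
      ring
    have h3 : X ^ (2 - κ) / 2 ^ ((l : ℝ) / 2) ≤ (k : ℝ) ^ ((l : ℝ) / 2) := by
      rw [← hXκl, ← Real.div_rpow (by positivity) (by norm_num)]
      exact Real.rpow_le_rpow (by positivity) hkge (by positivity)
    have h4 : X ^ l = X ^ (l : ℝ) := (Real.rpow_natCast X l).symm
    have hR0 : 0 ≤ R := by rw [hR]; positivity
    rw [BoxControl.modulusError, h1, h2, ← hR, h4]
    have hkp : (0 : ℝ) < (k : ℝ) ^ ((l : ℝ) / 2) := by positivity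
    calc _ = 48 * C * R * (X * Λ * X ^ (l : ℝ)) / (k : ℝ) ^ ((l : ℝ) / 2) := by
          field_simp
          ring
      _ ≤ 48 * C * R * (X * Λ * X ^ (l : ℝ)) / (X ^ (2 - κ) / 2 ^ ((l : ℝ) / 2)) := by
          have : 0 ≤ Λ := by linarith
          gcongr
      _ = 48 * C * c * R * 2 ^ ((l : ℝ) / 2) * (X * X ^ δ * X ^ (l : ℝ) / X ^ (2 - κ)) := by
          rw [hΛdef]
          field_simp
      _ ≤ _ := by
          refine mul_le_mul_of_nonneg_left ?_ (by positivity)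
          nth_rewrite 1 [← Real.rpow_one X]
          rw [← Real.rpow_add hX0, ← Real.rpow_add hX0, ← Real.rpow_sub hX0]
          exact hXY _ (by linarith)
  -- the tails
  have htl : ∀ t : ℝ, t = B * (k : ℝ) ^ (1 + 2 * δ - (l : ℝ) / 2) →
      Λ * (t * X ^ l) ≤ c * B * 2 ^ ((l : ℝ) / 2) * Y := by
    rintro t rfl
    have h1 : (k : ℝ) ^ (1 + 2 * δ - (l : ℝ) / 2) ≤
        X ^ (κ * (1 + 2 * δ) - (2 - κ)) * 2 ^ ((l : ℝ) / 2) := by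
      calc (k : ℝ) ^ (1 + 2 * δ - (l : ℝ) / 2) ≤ (X ^ κ / 2) ^ (1 + 2 * δ - (l : ℝ) / 2) :=
            Real.rpow_le_rpow_of_nonpos (by positivity) hkge (by linarith)
        _ = X ^ (κ * (1 + 2 * δ) - (2 - κ)) * 2 ^ (-(1 + 2 * δ - (l : ℝ) / 2)) := by
            rw [Real.div_rpow (by positivity) (by norm_num), ← Real.rpow_mul hX0.le, mul_sub, hκl,
              Real.rpow_neg (by norm_num), div_eq_mul_inv]
        _ ≤ _ := by
            refine mul_le_mul_of_nonneg_left ?_ (by positivity)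
            exact Real.rpow_le_rpow_of_exponent_le (by norm_num) (by linarith)
    have h4 : X ^ l = X ^ (l : ℝ) := (Real.rpow_natCast X l).symm
    rw [hΛdef, h4]
    calc _ ≤ c * X ^ δ * (B * (X ^ (κ * (1 + 2 * δ) - (2 - κ)) * 2 ^ ((l : ℝ) / 2)) *
          X ^ (l : ℝ)) := by gcongr
      _ = c * B * 2 ^ ((l : ℝ) / 2) *
          (X ^ δ * X ^ (κ * (1 + 2 * δ) - (2 - κ)) * X ^ (l : ℝ)) := by ring
      _ ≤ _ := by
          refine mul_le_mul_of_nonneg_left ?_ (by positivity)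
          rw [← Real.rpow_add hX0, ← Real.rpow_add hX0]
          refine hXY _ ?_
          nlinarith
  -- assembling
  have hT1 := h.abs_sum_card_divisors_sub_le (by omega) hF hk1 hkN
  have hT2 := h.abs_sum_smoothDivisor_sub_le (by omega) hF hk1 hkN
  rw [F.sum_realGaussSum_mul_logDensity, ← hG] at hT2
  obtain ⟨ht0, ht1⟩ := htail k hk1
  have hVn : (N : ℝ) ^ l ≤ X ^ l := by gcongr
  have hγ := Real.eulerMascheroniConstant_lt_two_thirds
  have hγ0 := Real.one_half_lt_eulerMascheroniConstant
  have hlogs0 : 0 ≤ ∑ x ∈ box l N, Real.log (F.eval x : ℤ) :=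
    sum_nonneg fun x hx => h.log_eval_nonneg hx
  have hlogs1 : ∑ x ∈ box l N, Real.log (F.eval x : ℤ) ≤ Λ * (N : ℝ) ^ l := by
    calc _ ≤ ∑ x ∈ box l N, Λ := sum_le_sum fun x hx => h.log_eval_le hx
      _ = _ := by rw [sum_const, card_box, nsmul_eq_mul, mul_comm]; push_cast; rfl
  have hS : |∑ x ∈ box l N, Real.log (F.eval x : ℤ) +
      2 * Real.eulerMascheroniConstant * (N : ℝ) ^ l| ≤ 3 * Λ * X ^ l := by
    rw [abs_of_nonneg (by positivity)]
    have : (0 : ℝ) ≤ (N : ℝ) ^ l := by positivity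
    calc _ ≤ Λ * (N : ℝ) ^ l + 2 * Λ * (N : ℝ) ^ l := by
          refine add_le_add hlogs1 (mul_le_mul_of_nonneg_right (by linarith) this)
      _ = 3 * Λ * (N : ℝ) ^ l := by ring
      _ ≤ _ := mul_le_mul_of_nonneg_left hVn (by linarith)
  have hlogX0 := Real.log_nonneg hX1
  have hlogX := h.log_X_le
  have hmain := abs_main_sub_le ht0 ht1 hS (by positivity) hVn
    (pow_sub_pow_le_mul (by positivity) hX1 hXN l) hsumlog (lx := Real.log X) (Λ := Λ) (by
      rw [abs_of_nonneg (by linarith)]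
      linarith) hΛ
  have htl' := htl _ rfl
  have hEY : X ^ ((l : ℝ) - 1 + 2 * δ) ≤ Y := hXY _ (by linarith)
  have hdY : X ^ ((l : ℝ) - 1) ≤ Y := hXY _ (by linarith)
  have hΛdY : Λ * (l * X ^ ((l : ℝ) - 1)) ≤ c * l * Y := by
    rw [hΛdef]
    calc _ = c * l * (X ^ δ * X ^ ((l : ℝ) - 1)) := by ring
      _ ≤ _ := by
          refine mul_le_mul_of_nonneg_left ?_ (by positivity)
          rw [← Real.rpow_add hX0]
          exact hXY _ (by linarith)
  have hYle : Y ≤ X ^ ((l : ℝ) - ((l : ℝ) - 2) / ((l : ℝ) + 2) + ε) := by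
    rw [hY]
    refine Real.rpow_le_rpow_of_exponent_le hX1 ?_
    have : (l : ℝ) - 1 + κ = (l : ℝ) - ((l : ℝ) - 2) / ((l : ℝ) + 2) := by
      rw [hκ]; field_simp; ring
    linarith
  rw [F.divisorSum_eq hX0.le, ← hN]
  rw [sum_sub_distrib] at hT1
  have hC0 : 0 ≤ C := by linarith
  have hG0 : 0 ≤ G := by
    rw [hG]
    have := F.gaussBound_nonneg
    positivity
  have b1 : (22 * l + 184 * C) * Λ ^ 3 * k * W ≤ (22 * l + 184 * C) * (c ^ 4 * Y) := by
    have := mul_le_mul_of_nonneg_left hΛ3 (show 0 ≤ 22 * (l : ℝ) + 184 * C by positivity)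
    linarith
  have b2 : G * Λ ^ 3 * k * W ≤ G * (c ^ 4 * Y) := by
    have := mul_le_mul_of_nonneg_left hΛ3 hG0
    linarith
  have b3 : |L₀| * (E * X ^ ((l : ℝ) - 1 + 2 * δ) + 4 * Λ * (l * X ^ ((l : ℝ) - 1))) ≤
      |L₀| * (E * Y + 4 * (c * l * Y)) := by
    refine mul_le_mul_of_nonneg_left (add_le_add (mul_le_mul_of_nonneg_left hEY hE.le) ?_)
      (abs_nonneg _)
    linarith
  have b4 : 2 * |L₁| * (l * X ^ ((l : ℝ) - 1)) ≤ 2 * |L₁| * (l * Y) := by gcongr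
  have hR0 : 0 ≤ R := by rw [hR]; positivity
  refine le_trans ?_ (mul_le_mul_of_nonneg_left hYle (by positivity))
  rw [abs_le] at hT1 hT2 hmain ⊢
  constructor <;>
    linarith [hT1.1, hT1.2, hT2.1, hT2.2, hmain.1, hmain.2]

end IntQuadPoly

theorem theorem1p2 (l : ℕ) (hl : 3 ≤ l) (F : IntQuadPoly l) (hF : F.discr ≠ 0) :
    -- On `Re s > l - 1` all series and products converge unconditionally, and the Dirichlet series of `S_F`
    -- equals the explicit Euler product.
    (∀ s : ℂ, (l : ℝ) - 1 < s.re →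
      LSeriesSummable F.gaussSum s ∧
      (∀ p : ℕ, p.Prime →
        Summable fun m : ℕ => (F.rho (p ^ m) : ℂ) / (p : ℂ) ^ ((m : ℂ) * s)) ∧
      (F.root = 0 → Multipliable fun p : IntQuadPoly.OddPrimes => F.eulerFactor₀ s p) ∧
      (F.root ≠ 0 → Multipliable fun p : F.GoodPrimes => F.eulerFactor₁ s p) ∧
      F.L s = LSeries F.gaussSum s) ∧
    DifferentiableAt ℂ F.L l ∧
    F.L l ≠ 0 ∧
    -- The asymptotic formula; the implied constant depends on `F` and `ε` only.
    (∀ ε : ℝ, 0 < ε → ∃ C : ℝ, ∀ X : ℝ, 3 ≤ X →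
      (∀ x : Fin l → ℝ, (∀ i, x i ∈ Set.Icc 1 X) → 0 < F.eval x) →
        MeasureTheory.IntegrableOn (fun t => Real.log (F.scaled X t))
          (Set.Icc (0 : Fin l → ℝ) 1) ∧
        ‖(F.divisorSum X : ℂ) -
            (2 * F.L l * ((X ^ l * Real.log X : ℝ) : ℂ) +
              ((Real.eulerMascheroniConstant : ℂ) + (F.logIntegral X : ℂ) / 2 +
                deriv F.L l / F.L l) * (2 * F.L l) * ((X ^ l : ℝ) : ℂ))‖
          ≤ C * X ^ ((l : ℝ) - ((l : ℝ) - 2) / ((l : ℝ) + 2) + ε)) := by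
  refine ⟨fun s hs => ⟨F.lSeriesSummable_gaussSum hl hF hs, fun p hp => (F.localSeries_spec hl hF hs hp).1,
    fun hR => F.multipliable_eulerFactor₀ hl hF hR hs,
    fun hR => F.multipliable_eulerFactor₁ hl hF hR hs, F.L_eq_lSeries hl hF hs⟩,
    (F.hasDerivAt_L hl hF).differentiableAt, F.L_ne_zero hl hF, ?_⟩
  intro ε hε
  obtain ⟨K, hK⟩ := F.exists_divisorSum_asymptotic hl hF hε
  refine ⟨K, fun X hX hpos => ?_⟩
  obtain ⟨h1, h2⟩ := hK X hX hpos
  refine ⟨h1, le_of_eq_of_le ?_ h2⟩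
  have hL := F.L_ne_zero hl hF
  rw [← Real.norm_eq_abs, ← Complex.norm_real]
  congr 1
  -- As L(l,F) ≠ 0 the quotient clears to 2 L'(l,F); the sign from differentiating q^(−s) matches
  -- the −2 log q of `logDensity`.
  have e : ((Real.eulerMascheroniConstant : ℂ) + (F.logIntegral X : ℂ) / 2 +
      deriv F.L l / F.L l) * (2 * F.L l) =
      F.L l * (2 * Real.eulerMascheroniConstant + F.logIntegral X) + 2 * deriv F.L l := by
    field_simp
  rw [e, F.deriv_L_natCast_eq hl hF, F.L_natCast_eq hl hF]
  push_cast
  ring
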